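/- Let $\Omega\subset\mathbb C$ be a simply connected domain and let $A:\Omega\to\mathbb R^{2\times 2}$ have measurable entries $a_{kl}$ and satisfy, for almost every $z\in\Omega$: $A(z)$ is symmetric, $\det A(z)=1$, and $\frac1K|\xi|^2\le\langle A(z)\xi,\xi\rangle\le K|\xi|^2$ for all $\xi\in\mathbb R^2$, with some constant $1\le K<\infty$. Functions are real valued and derivatives are weak. For $\nabla f\in L^1_{\rm loc}(\Omega)$ put $\|f\,|\,L^{1,2}(\Omega,A)\|=\big(\iint_\Omega\langle A\nabla f,\nabla f\rangle\,dx\,dy\big)^{1/2}$; the space $W^{1,2}(\Omega,A)$ consists of the $f\in L^2(\Omega)$ for which this is finite, with norm $\|f\,|\,L^2(\Omega)\|+\|f\,|\,L^{1,2}(\Omega,A)\|$, and $W^{1,2}_0(\Omega,A)$ is the closure of $C_0^\infty(\Omega)$ in it. An *$A$-quasiconformal mapping* $\varphi:\Omega\to\mathbb D$ onto the open unit disc $\mathbb D$ is a homeomorphism $\varphi\in W^{1,2}_{\rm loc}(\Omega)$ such that, for some $1\le K<\infty$, $|D\varphi|^2\le K|J(\cdot,\varphi)|$ a.e. in $\Omega$,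 and $$\varphi_{\overline z}=\mu\,\varphi_z\ \text{ a.e. in }\Omega,\qquad \mu=\frac{a_{22}-a_{11}-2i\,a_{12}}{\det(I+A)} .$$ Assume that $\Omega$ is a *volume-preserving $A$-quasiconformal $\infty$-regular domain*: there is an $A$-quasiconformal mapping $\varphi:\Omega\to\mathbb D$ with $|J(z,\varphi)|=1$ for almost every $z\in\Omega$ and $J(\cdot,\varphi^{-1})\in L^\infty(\mathbb D)$. Let $B_{2,2}(A,\Omega)$ be the least constant $B\ge 0$ such that $$\|f\,|\,L^2(\Omega)\|\le B\,\|f\,|\,L^{1,2}(\Omega,A)\|\qquad\text{for all } f\in W^{1,2}_0(\Omega,A),$$ and let $\lambda_1(A,\Omega)$ be the least Dirichlet eigenvalue, that is, the least $\lambda\in\mathbb R$ for which there is $f\in W_0^{1,2}(\Omega,A)$, $f\ne0$, with $\iint_\Omega\langle A\nabla f,\nabla g\rangle\,dx\,dy=\lambda\iint_\Omega fg\,dx\,dy$ for all $g\in W_0^{1,2}(\Omega,A)$. Write $B_{2,2}(\mathbb D)=B_{2,2}(I,\mathbb D)$ and $\lambda_1(\mathbb D)=\lambda_1(I,\mathbb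 D)$. Then the least constants $B_{2,2}(A,\Omega)$ and $B_{2,2}(\mathbb D)$ and the least eigenvalues $\lambda_1(A,\Omega)$ and $\lambda_1(\mathbb D)$ exist, and $$B_{2,2}(A,\Omega)\le B_{2,2}(\mathbb D),\qquad \lambda_1(A,\Omega)\ge\lambda_1(\mathbb D).$$ -/

import Mathlib

open MeasureTheory Filter Topology
open scoped ContDiff Matrix ENNReal

noncomputable section

namespace DirichletEig

/-- The open unit disc `𝔻` in the complex plane. -/
def disc : Set ℂ := Metric.ball (0 : ℂ) 1

/-- `u ∈ C₀^∞(Ω)`, with values in `ℝ`. -/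
structure IsTestFunction (Ω : Set ℂ) (u : ℂ → ℝ) : Prop where
  smooth : ContDiff ℝ ∞ u
  compact : HasCompactSupport u
  support : tsupport u ⊆ Ω

/-- `D` is the weak (distributional) differential of the locally integrable function `f` on the
open set `Ω`; `D z 1` and `D z I` are the weak partial derivatives in `x` and in `y`. -/
structure HasWeakFDeriv {E : Type*} [NormedAddCommGroup E] [NormedSpace ℝ E]
    (Ω : Set ℂ) (f : ℂ → E) (D : ℂ → ℂ →L[ℝ] E) : Prop where
  locInt : LocallyIntegrableOn f Ω volume
  locInt_deriv : LocallyIntegrableOn D Ω volume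
  byParts : ∀ ψ : ℂ → ℝ, IsTestFunction Ω ψ → ∀ v : ℂ,
    ∫ z in Ω, (fderiv ℝ ψ z v) • f z = - ∫ z in Ω, ψ z • D z v

/-- The gradient `(∂f/∂x, ∂f/∂y)` read off from the differential of a real function. -/
def grad (L : ℂ →L[ℝ] ℝ) : Fin 2 → ℝ := ![L 1, L Complex.I]

/-- The matrix class `M^{2×2}(Ω)`: measurable entries, symmetric, determinant one, and uniformly
elliptic with some constant `1 ≤ K < ∞`. -/
structure MemEllipticClass (Ω : Set ℂ) (A : ℂ → Matrix (Fin 2) (Fin 2) ℝ) : Prop where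
  measurable_entries : ∀ i j, AEMeasurable (fun z => A z i j) (volume.restrict Ω)
  symm : ∀ᵐ z ∂(volume.restrict Ω), (A z).IsSymm
  det_eq_one : ∀ᵐ z ∂(volume.restrict Ω), (A z).det = 1
  elliptic : ∃ K : ℝ, 1 ≤ K ∧ ∀ᵐ z ∂(volume.restrict Ω), ∀ ξ : Fin 2 → ℝ,
    1 / K * (ξ ⬝ᵥ ξ) ≤ (A z *ᵥ ξ) ⬝ᵥ ξ ∧ (A z *ᵥ ξ) ⬝ᵥ ξ ≤ K * (ξ ⬝ᵥ ξ)

/-- `∬_Ω ⟨A ∇f, ∇g⟩ dx dy`, where `F`, `G` are the differentials of `f`, `g`. -/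
def energy (A : ℂ → Matrix (Fin 2) (Fin 2) ℝ) (Ω : Set ℂ) (F G : ℂ → ℂ →L[ℝ] ℝ) : ℝ :=
  ∫ z in Ω, (A z *ᵥ grad (F z)) ⬝ᵥ grad (G z)

/-- The seminorm `‖f | L^{1,2}(Ω, A)‖`, where `F` is the weak differential of `f`. -/
def seminormA (A : ℂ → Matrix (Fin 2) (Fin 2) ℝ) (Ω : Set ℂ) (F : ℂ → ℂ →L[ℝ] ℝ) : ℝ :=
  √(energy A Ω F F)

/-- The norm `‖f | L²(Ω)‖`. -/
def normL2 (Ω : Set ℂ) (f : ℂ → ℝ) : ℝ := √(∫ z in Ω, |f z| ^ 2)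

/-- `f ∈ W^{1,2}(Ω, A)`, with weak differential `F`. -/
structure MemSobolev (A : ℂ → Matrix (Fin 2) (Fin 2) ℝ) (Ω : Set ℂ)
    (f : ℂ → ℝ) (F : ℂ → ℂ →L[ℝ] ℝ) : Prop where
  weakFDeriv : HasWeakFDeriv Ω f F
  memL2 : MemLp f 2 (volume.restrict Ω)
  finite_energy : IntegrableOn (fun z => (A z *ᵥ grad (F z)) ⬝ᵥ grad (F z)) Ω volume

/-- `f ∈ W₀^{1,2}(Ω, A)`, with weak differential `F`: the function `f` lies in the closure of
`C₀^∞(Ω)` in the norm `‖f | L²(Ω)‖ + ‖f | L^{1,2}(Ω, A)‖` of `W^{1,2}(Ω, A)`. -/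
structure MemSobolevZero (A : ℂ → Matrix (Fin 2) (Fin 2) ℝ) (Ω : Set ℂ)
    (f : ℂ → ℝ) (F : ℂ → ℂ →L[ℝ] ℝ) : Prop where
  memSobolev : MemSobolev A Ω f F
  approx : ∃ u : ℕ → ℂ → ℝ, (∀ n, IsTestFunction Ω (u n)) ∧
    Tendsto (fun n => normL2 Ω (fun z => f z - u n z)
      + seminormA A Ω (fun z => F z - fderiv ℝ (u n) z)) atTop (𝓝 0)

/-- The admissible constants `C` in the Poincaré inequality
`‖f | L²(Ω)‖ ≤ C ‖f | L^{1,2}(Ω, A)‖`, `f ∈ W₀^{1,2}(Ω, A)`. -/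
def poincareConstants (A : ℂ → Matrix (Fin 2) (Fin 2) ℝ) (Ω : Set ℂ) : Set ℝ :=
  {C | 0 ≤ C ∧ ∀ f F, MemSobolevZero A Ω f F → normL2 Ω f ≤ C * seminormA A Ω F}

/-- The (best) Poincaré constant `B_{2,2}(A, Ω)`. -/
def poincareConst (A : ℂ → Matrix (Fin 2) (Fin 2) ℝ) (Ω : Set ℂ) : ℝ :=
  sInf (poincareConstants A Ω)

/-- The Dirichlet eigenvalues of `-div (A ∇ f)` in `Ω`, in the weak sense. -/
def dirichletEigenvalues (A : ℂ → Matrix (Fin 2) (Fin 2) ℝ) (Ω : Set ℂ) : Set ℝ :=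
  {Λ | ∃ f F, MemSobolevZero A Ω f F ∧ ¬ (f =ᵐ[volume.restrict Ω] 0) ∧
    ∀ g G, MemSobolevZero A Ω g G → energy A Ω F G = Λ * ∫ z in Ω, f z * g z}

/-- The first Dirichlet eigenvalue `λ₁(A, Ω)`. -/
def firstEigenvalue (A : ℂ → Matrix (Fin 2) (Fin 2) ℝ) (Ω : Set ℂ) : ℝ :=
  sInf (dirichletEigenvalues A Ω)

/-- The Wirtinger derivative `φ_z`, from the (weak) real differential of `φ` at a point. -/
def dz (L : ℂ →L[ℝ] ℂ) : ℂ := (1 / 2) * (L 1 - Complex.I * L Complex.I)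

/-- The Wirtinger derivative `φ_{z̄}`, from the (weak) real differential of `φ` at a point. -/
def dzbar (L : ℂ →L[ℝ] ℂ) : ℂ := (1 / 2) * (L 1 + Complex.I * L Complex.I)

/-- The complex dilatation `μ = (a₂₂ - a₁₁ - 2 i a₁₂) / det (I + A)` of a matrix `A`. -/
def complexDilatation (A : Matrix (Fin 2) (Fin 2) ℝ) : ℂ :=
  ((A 1 1 : ℂ) - (A 0 0 : ℂ) - 2 * Complex.I * (A 0 1 : ℂ)) / (((1 + A).det : ℝ) : ℂ)

/-- `φ : Ω → Ω'` is an `A`-quasiconformal homeomorphism with weak differential `D`: it belongs to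
`W^{1,2}_loc(Ω)`, satisfies `|Dφ|² ≤ K |J(·, φ)|` a.e. for some `1 ≤ K < ∞`, and satisfies the
Beltrami equation with the complex dilatation of `A`. -/
structure IsAQuasiconformal (A : ℂ → Matrix (Fin 2) (Fin 2) ℝ) (Ω Ω' : Set ℂ)
    (φ : OpenPartialHomeomorph ℂ ℂ) (D : ℂ → ℂ →L[ℝ] ℂ) : Prop where
  source_eq : φ.source = Ω
  target_eq : φ.target = Ω'
  weakFDeriv : HasWeakFDeriv Ω φ D
  locL2 : ∀ S ⊆ Ω, IsCompact S →
    MemLp φ 2 (volume.restrict S) ∧ MemLp D 2 (volume.restrict S)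
  distortion : ∃ K : ℝ, 1 ≤ K ∧ ∀ᵐ z ∂(volume.restrict Ω), ‖D z‖ ^ 2 ≤ K * |(D z).det|
  beltrami : ∀ᵐ z ∂(volume.restrict Ω), dzbar (D z) = complexDilatation (A z) * dz (D z)

/-- `Ω` is a volume-preserving `A`-quasiconformal `β`-regular domain (about the unit disc),
`1 < β ≤ ∞`: a simply connected domain with an `A`-quasiconformal map `φ : Ω → 𝔻` such that
`|J(z, φ)| = 1` for a.e. `z ∈ Ω` and `J(·, φ⁻¹) ∈ L^β(𝔻)`. The Jacobian of the quasiconformal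
map `φ⁻¹` is that of its classical differential, which exists almost everywhere in `𝔻`; no
regularity of `φ⁻¹` is assumed. -/
structure IsVolumePreservingRegular (β : ℝ≥0∞) (A : ℂ → Matrix (Fin 2) (Fin 2) ℝ)
    (Ω : Set ℂ) : Prop where
  isOpen : IsOpen Ω
  simplyConnected : IsSimplyConnected Ω
  one_lt : 1 < β
  exists_map : ∃ (φ : OpenPartialHomeomorph ℂ ℂ) (D : ℂ → ℂ →L[ℝ] ℂ),
    IsAQuasiconformal A Ω disc φ D ∧
    (∀ᵐ z ∂(volume.restrict Ω), |(D z).det| = 1) ∧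
    MemLp (fun w => (fderiv ℝ φ.symm w).det) β (volume.restrict disc)

end DirichletEig

end

noncomputable section

namespace DirichletEig

/-! ### Linear algebra of real differentials in the plane -/

/-! Let φ be the given map and T = Dφ. Since |det T| = 1, the distortion inequality bounds T, and
the Beltrami equation of A together with det A = 1 forces det T = 1 and T A Tᵗ = I
(`real_beltrami`). Hence g ↦ g ∘ φ carries the Dirichlet energy on 𝔻 to the A-energy on Ω. As φ also
preserves area, it preserves L² products. Once this composition is a bijection between the W₀^{1,2}
spaces, the two problems have the same Poincaré constants and the same eigenvalues, so both
inequalities are in fact equalities.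

The analytic work is to justify composition in both directions. For elliptic A and finite area,
W₀^{1,2}(Ω, A) is the unweighted space `IsH10Pair`. A continuous map with bounded weak differential
is locally Lipschitz and has that differential classically a.e.
(`HasWeakFDeriv.complex_regularity`). The area formula then gives preservation of area. Pull-backs
of test functions are Lipschitz with compact support, hence in W₀^{1,2} by mollification, and
density does the rest (`IsBoundedPreserving.isH10Pair_comp`).

For φ⁻¹ the candidate differential is adj T ∘ φ⁻¹. In the plane adj is linear and the field adj(T) v
is weakly divergence free, so ∫ ∇k · adj(T) v = 0 for k in W₀^{1,2}. Taking k = (ψ ∘ φ) ℓ and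
changing variables, this becomes integration by parts for ℓ ∘ φ⁻¹
(`IsBoundedPreserving.hasWeakFDeriv_symm`), and the same regularity theorem applies to φ⁻¹.

What remains is existence on the disc. A translation estimate gives a finite Poincaré constant, and
the set of such constants is closed. For the eigenvalue, Rellich's theorem (`exists_cauchy_subseq`)
and the parallelogram law make a minimising sequence of the Rayleigh quotient converge. Its limit
solves the Euler–Lagrange equation, and every eigenvalue is the Rayleigh quotient of its
eigenfunction. -/

lemma clm_apply_eq (L : ℂ →L[ℝ] ℝ) (v : ℂ) : L v = L 1 * v.re + L Complex.I * v.im := by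
  conv_lhs => rw [← Complex.re_add_im v, mul_comm]
  have h1 : ((v.re : ℂ)) = v.re • (1 : ℂ) := by simp
  have h2 : Complex.I * (v.im : ℂ) = v.im • Complex.I := by simp [mul_comm]
  rw [h1, h2, map_add, map_smul, map_smul, smul_eq_mul, smul_eq_mul]; ring

lemma clm_apply_eq_smul (L : ℂ →L[ℝ] ℂ) (v : ℂ) :
    L v = v.re • L 1 + v.im • L Complex.I := by
  conv_lhs => rw [← Complex.re_add_im v, mul_comm]
  have h1 : ((v.re : ℂ)) = v.re • (1 : ℂ) := by simp
  have h2 : Complex.I * (v.im : ℂ) = v.im • Complex.I := by simp [mul_comm]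
  rw [h1, h2, map_add, map_smul, map_smul]

lemma grad_dotProduct (F G : ℂ →L[ℝ] ℝ) :
    grad F ⬝ᵥ grad G = F 1 * G 1 + F Complex.I * G Complex.I := by
  simp [grad]

lemma norm_sq_eq_grad (L : ℂ →L[ℝ] ℝ) : ‖L‖ ^ 2 = grad L ⬝ᵥ grad L := by
  rw [grad_dotProduct]
  -- `w` is the Riesz representative of `L`: Cauchy–Schwarz gives one bound, evaluation at `w` the
  -- other.
  set w : ℂ := ⟨L 1, L Complex.I⟩ with hw
  have hw2 : ‖w‖ ^ 2 = L 1 * L 1 + L Complex.I * L Complex.I := by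
    rw [← Complex.normSq_eq_norm_sq, Complex.normSq_apply]
  rw [← hw2]
  congr 1
  apply le_antisymm
  · refine L.opNorm_le_bound (norm_nonneg _) fun v => ?_
    rw [Real.norm_eq_abs, clm_apply_eq]
    apply abs_le_of_sq_le_sq _ (by positivity)
    rw [mul_pow, hw2, ← Complex.normSq_eq_norm_sq v, Complex.normSq_apply]
    nlinarith [sq_nonneg (L 1 * v.im - L Complex.I * v.re)]
  · have h := L.le_opNorm w
    have h3 : L w = ‖w‖ ^ 2 := by rw [clm_apply_eq, hw2]
    rw [h3, Real.norm_of_nonneg (by positivity)] at h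
    by_cases h0 : ‖w‖ = 0
    · rw [h0]; positivity
    · have : 0 < ‖w‖ := lt_of_le_of_ne (norm_nonneg _) (Ne.symm h0)
      nlinarith

lemma det_clm (L : ℂ →L[ℝ] ℂ) :
    L.det = (L 1).re * (L Complex.I).im - (L Complex.I).re * (L 1).im := by
  rw [ContinuousLinearMap.det, ← LinearMap.det_toMatrix Complex.basisOneI, Matrix.det_fin_two]
  simp [LinearMap.toMatrix_apply, Complex.basisOneI]

lemma quadForm_eq (A : Matrix (Fin 2) (Fin 2) ℝ) (x y : Fin 2 → ℝ) :
    (A *ᵥ x) ⬝ᵥ y = (A 0 0 * x 0 + A 0 1 * x 1) * y 0 + (A 1 0 * x 0 + A 1 1 * x 1) * y 1 := by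
  simp [Matrix.mulVec, dotProduct, Fin.sum_univ_two]

/-- Arithmetic–geometric mean: a positive definite symmetric 2×2 matrix of determinant one has trace
at least 2. -/
lemma trace_ge_two {x y z : ℝ} (hx : 0 < x) (hy : 0 < y) (h : x * y - z ^ 2 = 1) : 2 ≤ x + y := by
  nlinarith [sq_nonneg (x - y), sq_nonneg z]

/-- A positive definite symmetric form `p x² + 2 q x y + s y²` of determinant one. -/
lemma quadForm_pos {p q s x y : ℝ} (hA : p * s - q * q = 1) (hp : 0 < p) (h : x ≠ 0 ∨ y ≠ 0) :
    0 < p * x ^ 2 + 2 * q * x * y + s * y ^ 2 := by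
  have h1 : p * (p * x ^ 2 + 2 * q * x * y + s * y ^ 2) = (p * x + q * y) ^ 2 + y ^ 2 := by
    linear_combination y ^ 2 * hA
  refine (mul_pos_iff_of_pos_left hp).1 ?_
  rw [h1]
  by_cases hy : y = 0
  · have hx : x ≠ 0 := by tauto
    subst hy
    have : p * x + q * 0 ≠ 0 := by simp [hp.ne', hx]
    positivity
  · positivity

/-- The real form of the Beltrami equation: a matrix `T = (a b; c d)` of determinant `±1` solving
the Beltrami equation of `A = (p q; q s)` has determinant one and `T A Tᵗ = 1`. -/
lemma real_beltrami {a b c d p q s : ℝ} (hT : |a * d - b * c| = 1)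
    (hA : p * s - q * q = 1) (hp : 0 < p)
    (e1 : a * (1 + p) - d * (1 + s) = q * (c - b))
    (e2 : c * (1 + p) + b * (1 + s) + q * (a + d) = 0) :
    a * d - b * c = 1 ∧ p * a + q * b = d ∧ q * a + s * b = -c ∧ p * c + q * d = -b ∧
      q * c + s * d = a := by
  have hs : 0 < s := by nlinarith [sq_nonneg q]
  have hps : 2 ≤ p + s := trace_ge_two hp hs (z := q) (by nlinarith)
  -- the Wirtinger derivatives
  have m1 : (2 + p + s) * (a - d) = (s - p) * (a + d) + 2 * q * (c - b) := by linarith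
  have m2 : (2 + p + s) * (c + b) = (s - p) * (c - b) - 2 * q * (a + d) := by linarith
  -- This is |φ_z̄|² = |μ|² |φ_z|² with |μ|² = (tr A - 2) / (tr A + 2), because (s - p)² + 4q² = (p
  -- + s)² - 4 when det A = 1. Since |μ| < 1, the Jacobian |φ_z|² - |φ_z̄|² is nonnegative.
  have m3 : (2 + p + s) ^ 2 * ((a - d) ^ 2 + (c + b) ^ 2)
      = ((p + s) ^ 2 - 4) * ((a + d) ^ 2 + (c - b) ^ 2) := by
    have : (2 + p + s) ^ 2 * ((a - d) ^ 2 + (c + b) ^ 2)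
      = ((2 + p + s) * (a - d)) ^ 2 + ((2 + p + s) * (c + b)) ^ 2 := by ring
    rw [this, m1, m2]
    linear_combination (-4) * ((a + d) ^ 2 + (c - b) ^ 2) * hA
  have hJ : 0 ≤ a * d - b * c := by
    have h4 : 4 * (a * d - b * c) = (a + d) ^ 2 + (c - b) ^ 2 - ((a - d) ^ 2 + (c + b) ^ 2) := by
      ring
    have h5 : 0 ≤ (2 + p + s) ^ 2 * (4 * (a * d - b * c)) := by
      rw [h4, mul_sub, m3, ← sub_mul]
      apply mul_nonneg
      · nlinarith
      · positivity
    have h6 : 0 < (2 + p + s) ^ 2 := by positivity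
    have := nonneg_of_mul_nonneg_right h5 h6
    linarith
  have hdet : a * d - b * c = 1 := by rwa [abs_of_nonneg hJ] at hT
  have k1 : 0 < p * a ^ 2 + 2 * q * a * b + s * b ^ 2 := by
    refine quadForm_pos hA hp ?_
    by_contra! h
    rw [h.1, h.2] at hdet
    norm_num at hdet
  have k2 : 0 < p * c ^ 2 + 2 * q * c * d + s * d ^ 2 := by
    refine quadForm_pos hA hp ?_
    by_contra! h
    rw [h.1, h.2] at hdet
    norm_num at hdet
  -- The matrix T A Tᵗ is positive definite of determinant one, so its trace is at least 2.
  have k3 : 2 ≤ (p * a ^ 2 + 2 * q * a * b + s * b ^ 2) + (p * c ^ 2 + 2 * q * c * d + s * d ^ 2) := by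
    refine trace_ge_two k1 k2 (z := p * a * c + q * (a * d + b * c) + s * b * d) ?_
    have : (p * a ^ 2 + 2 * q * a * b + s * b ^ 2) * (p * c ^ 2 + 2 * q * c * d + s * d ^ 2)
      - (p * a * c + q * (a * d + b * c) + s * b * d) ^ 2
      = (p * s - q * q) * (a * d - b * c) ^ 2 := by ring
    rw [this, hA, hdet]; norm_num
  -- Let C = (d, -c; -b, a) be the cofactor matrix of T; the goal is T A = C. By the Beltrami
  -- equations the residual T A - C has the conformal form (α, β; -β, α), so its determinant is α² +
  -- β².
  obtain ⟨α, hα⟩ : ∃ α, p * a + q * b - d = α := ⟨_, rfl⟩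
  obtain ⟨β, hβ⟩ : ∃ β, q * a + s * b + c = β := ⟨_, rfl⟩
  have hγ : p * c + q * d + b = -β := by linear_combination e2 - hβ
  have hδ : q * c + s * d - a = α := by linear_combination hα - e1
  have hz : α ^ 2 + β ^ 2 ≤ 0 := by
    -- Expanding, det (T A - C) = det (T A) + det C - tr (T A Tᵗ) = 2 - tr (T A Tᵗ) ≤ 0, which
    -- forces α = β = 0.
    have h8 : (p * a + q * b - d) * (q * c + s * d - a) - (q * a + s * b + c) * (p * c + q * d + b)
      = (p * s - q * q) * (a * d - b * c) + (a * d - b * c)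
        - ((p * a ^ 2 + 2 * q * a * b + s * b ^ 2) + (p * c ^ 2 + 2 * q * c * d + s * d ^ 2)) := by
      ring
    rw [hA, hdet, hα, hβ, hγ, hδ] at h8
    have h9 : α ^ 2 + β ^ 2 = α * α - β * -β := by ring
    rw [h9, h8]
    clear * - k3
    linarith
  have hα0 : α = 0 := 
    pow_eq_zero_iff two_ne_zero |>.1
      (le_antisymm ((le_add_of_nonneg_right (sq_nonneg β)).trans hz) (sq_nonneg α))
  have hβ0 : β = 0 := 
    pow_eq_zero_iff two_ne_zero |>.1
      (le_antisymm ((le_add_of_nonneg_left (sq_nonneg α)).trans hz) (sq_nonneg β))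
  exact ⟨hdet, by linear_combination hα + hα0, by linear_combination hβ + hβ0,
    by linear_combination hγ - hβ0, by linear_combination hδ + hα0⟩

/-- The gradient of F ∘ T is Tᵗ ∇F, so the left side is ⟨T A Tᵗ ∇F, ∇G⟩, and `real_beltrami` gives T
A Tᵗ = I. -/
lemma beltrami_det_and_energy {A : Matrix (Fin 2) (Fin 2) ℝ} {T : ℂ →L[ℝ] ℂ} (hs : A.IsSymm)
    (hd : A.det = 1) (hp : 0 < A 0 0) (hT : |T.det| = 1)
    (hb : dzbar T = complexDilatation A * dz T) :
    T.det = 1 ∧ ∀ F G : ℂ →L[ℝ] ℝ,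
      (A *ᵥ grad (F.comp T)) ⬝ᵥ grad (G.comp T) = ((1 : Matrix (Fin 2) (Fin 2) ℝ) *ᵥ grad F) ⬝ᵥ grad G := by
  have hq : A 1 0 = A 0 1 := hs.apply 0 1
  rw [Matrix.det_fin_two, hq] at hd
  obtain ⟨p, hp'⟩ : ∃ p, A 0 0 = p := ⟨_, rfl⟩
  obtain ⟨q, hq'⟩ : ∃ q, A 0 1 = q := ⟨_, rfl⟩
  obtain ⟨s, hs'⟩ : ∃ s, A 1 1 = s := ⟨_, rfl⟩
  rw [hp', hq', hs'] at hd
  rw [hp'] at hp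
  rw [hq'] at hq
  have hsp : 0 < s := by nlinarith [sq_nonneg q]
  obtain ⟨a, c, ha⟩ : ∃ a c : ℝ, T 1 = ⟨a, c⟩ := ⟨_, _, rfl⟩
  obtain ⟨b, d, hbd⟩ : ∃ b d : ℝ, T Complex.I = ⟨b, d⟩ := ⟨_, _, rfl⟩
  have hdet : T.det = a * d - b * c := by rw [det_clm, ha, hbd]
  have hI : (1 + A).det = 2 + p + s := by
    rw [Matrix.det_fin_two]
    simp only [Matrix.add_apply, Matrix.one_apply_eq, Matrix.one_apply_ne (show (0 : Fin 2) ≠ 1 by decide),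
      Matrix.one_apply_ne (show (1 : Fin 2) ≠ 0 by decide), hq, hp', hq', hs']
    linear_combination hd
  have hpos : 2 + p + s ≠ 0 := by positivity
  unfold dzbar dz complexDilatation at hb
  rw [hI, ha, hbd, hp', hq', hs'] at hb
  have hpos' : (((2 + p + s : ℝ)) : ℂ) ≠ 0 := by exact_mod_cast hpos
  have hb : (((2 + p + s : ℝ)) : ℂ) * ((⟨a, c⟩ : ℂ) + Complex.I * ⟨b, d⟩)
      = ((s : ℂ) - p - 2 * Complex.I * q) * ((⟨a, c⟩ : ℂ) - Complex.I * ⟨b, d⟩) := by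
    field_simp at hb
    linear_combination hb
  have hre := congrArg Complex.re hb
  have him := congrArg Complex.im hb
  simp at hre him
  have key := real_beltrami (a := a) (b := b) (c := c) (d := d) (p := p) (q := q) (s := s)
    (by rw [← hdet]; exact hT) hd hp (by linarith)
    (by linarith)
  obtain ⟨k0, k1, k2, k3, k4⟩ := key
  refine ⟨by rw [hdet, k0], fun F G => ?_⟩
  rw [Matrix.one_mulVec, grad_dotProduct, quadForm_eq]
  simp only [grad, ContinuousLinearMap.comp_apply, ha, hbd, Matrix.cons_val_zero, Matrix.cons_val_one]
  rw [clm_apply_eq F ⟨a, c⟩, clm_apply_eq F ⟨b, d⟩, clm_apply_eq G ⟨a, c⟩, clm_apply_eq G ⟨b, d⟩, hq, hp', hq', hs']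
  simp only
  generalize F 1 = x
  generalize F Complex.I = y
  generalize G 1 = u
  generalize G Complex.I = v
  have r1 : p * (x * a + y * c) + q * (x * b + y * d) = x * d - y * b := by
    linear_combination x * k1 + y * k3
  have r2 : q * (x * a + y * c) + s * (x * b + y * d) = - x * c + y * a := by
    linear_combination x * k2 + y * k4
  rw [r1, r2]
  linear_combination (x * u + y * v) * k0

/-- The adjugate of a real linear endomorphism of the plane. -/
def adj (L : ℂ →L[ℝ] ℂ) : ℂ →L[ℝ] ℂ :=
  ((L 1).re + (L Complex.I).im) • ContinuousLinearMap.id ℝ ℂ - L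

lemma continuous_adj : Continuous adj := by
  unfold adj; fun_prop

lemma norm_adj_le (L : ℂ →L[ℝ] ℂ) : ‖adj L‖ ≤ 3 * ‖L‖ := by
  have h1 : |(L 1).re| ≤ ‖L‖ := (Complex.abs_re_le_norm _).trans (by simpa using L.le_opNorm 1)
  have h2 : |(L Complex.I).im| ≤ ‖L‖ :=
    (Complex.abs_im_le_norm _).trans (by simpa using L.le_opNorm Complex.I)
  calc ‖adj L‖ ≤ ‖((L 1).re + (L Complex.I).im) • ContinuousLinearMap.id ℝ ℂ‖ + ‖L‖ :=
        norm_sub_le _ _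
    _ ≤ (‖L‖ + ‖L‖) * 1 + ‖L‖ := by
        rw [norm_smul]
        gcongr
        · exact (abs_add_le _ _).trans (add_le_add h1 h2)
        · exact ContinuousLinearMap.norm_id_le
    _ = 3 * ‖L‖ := by ring

lemma adj_apply (L : ℂ →L[ℝ] ℂ) (v : ℂ) : adj L v =
    ⟨(L Complex.I).im * v.re - (L Complex.I).re * v.im, (L 1).re * v.im - (L 1).im * v.re⟩ := by
  simp only [adj, _root_.sub_apply, _root_.smul_apply, ContinuousLinearMap.id_apply]
  rw [clm_apply_eq_smul L v]
  apply Complex.ext <;> simp <;> ring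

lemma comp_adj {L : ℂ →L[ℝ] ℂ} (h : L.det = 1) : L.comp (adj L) = ContinuousLinearMap.id ℝ ℂ := by
  rw [det_clm] at h
  ext v
  rw [ContinuousLinearMap.comp_apply, clm_apply_eq_smul, adj_apply]
  apply Complex.ext
  · simp; linear_combination v.re * h
  · simp; linear_combination v.im * h

lemma adj_comp {L : ℂ →L[ℝ] ℂ} (h : L.det = 1) : (adj L).comp L = ContinuousLinearMap.id ℝ ℂ := by
  rw [det_clm] at h
  ext v
  rw [ContinuousLinearMap.comp_apply, adj_apply, clm_apply_eq_smul L v]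
  apply Complex.ext
  · simp; linear_combination v.re * h
  · simp; linear_combination v.im * h

/-! ### Pairs in the closure of the test functions -/

section Enorm

variable {α E : Type*} [MeasurableSpace α] [NormedAddCommGroup E] {μ : Measure α}

lemma enorm_integral_smul_le [NormedSpace ℝ E] {a : α → ℝ} {b : α → E}
    (ha : AEStronglyMeasurable a μ) (hb : AEStronglyMeasurable b μ) :
    ‖∫ x, a x • b x ∂μ‖ₑ ≤ eLpNorm a 2 μ * eLpNorm b 2 μ := by
  calc ‖∫ x, a x • b x ∂μ‖ₑ ≤ eLpNorm (a • b) 1 μ := by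
        rw [eLpNorm_one_eq_lintegral_enorm]
        exact enorm_integral_le_lintegral_enorm _
    _ ≤ _ := eLpNorm_smul_le_mul_eLpNorm hb ha

lemma integrable_smul_of_memLp [NormedSpace ℝ E] {a : α → ℝ} {b : α → E}
    (ha : MemLp a 2 μ) (hb : MemLp b 2 μ) : Integrable (fun x => a x • b x) μ :=
  memLp_one_iff_integrable.1 (MemLp.smul (p := 2) (q := 2) hb ha)

lemma MemLp.eLpNorm_two_eq {f : α → E} (hf : MemLp f 2 μ) :
    eLpNorm f 2 μ = ENNReal.ofReal (√(∫ x, ‖f x‖ ^ 2 ∂μ)) := by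
  rw [hf.eLpNorm_eq_integral_rpow_norm (by simp) (by simp), Real.sqrt_eq_rpow]
  norm_num

/-- The closing step of the density arguments: an integral is bounded by a finite constant times an
arbitrarily small approximation error. -/
lemma eq_zero_of_le_const_mul {x C : ℝ≥0∞} (hC : C ≠ ⊤) (h : ∀ ε : ℝ≥0∞, ε ≠ 0 → x ≤ C * ε) :
    x = 0 := by
  have h1 : Tendsto (fun n : ℕ => C * (n : ℝ≥0∞)⁻¹) atTop (𝓝 (C * 0)) :=
    ENNReal.Tendsto.const_mul ENNReal.tendsto_inv_nat_nhds_zero (Or.inr hC)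
  rw [mul_zero] at h1
  exact le_antisymm (ge_of_tendsto' h1 fun n => h _ (by simp)) bot_le

end Enorm

section TestFunctions

variable {Ω : Set ℂ} {u ψ : ℂ → ℝ}

lemma IsTestFunction.contDiff_fderiv (hu : IsTestFunction Ω u) : ContDiff ℝ ∞ (fderiv ℝ u) :=
  hu.smooth.fderiv_right (by simp)

lemma IsTestFunction.differentiable (hu : IsTestFunction Ω u) : Differentiable ℝ u :=
  hu.smooth.differentiable (by simp)

lemma IsTestFunction.memLp (hu : IsTestFunction Ω u) (p : ℝ≥0∞) (S : Set ℂ) :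
    MemLp u p (volume.restrict S) :=
  (hu.smooth.continuous.memLp_of_hasCompactSupport hu.compact (μ := volume)).restrict S

lemma IsTestFunction.memLp_fderiv (hu : IsTestFunction Ω u) (p : ℝ≥0∞) (S : Set ℂ) :
    MemLp (fderiv ℝ u) p (volume.restrict S) :=
  (hu.contDiff_fderiv.continuous.memLp_of_hasCompactSupport
    (hu.compact.fderiv (𝕜 := ℝ)) (μ := volume)).restrict S

/-- Directional derivatives of test functions are test functions. -/
lemma IsTestFunction.fderiv_apply (hu : IsTestFunction Ω u) (v : ℂ) :
    IsTestFunction Ω (fun z => fderiv ℝ u z v) where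
  smooth := hu.contDiff_fderiv.clm_apply contDiff_const
  compact := (hu.compact.fderiv (𝕜 := ℝ)).comp_left (g := fun L : ℂ →L[ℝ] ℝ => L v) rfl
  support := by
    refine (closure_mono ?_).trans ((tsupport_fderiv_subset ℝ (f := u)).trans hu.support)
    intro z hz h0
    exact hz (by simp [h0])

lemma IsTestFunction.eq_zero (hu : IsTestFunction Ω u) {z : ℂ} (hz : z ∉ Ω) : u z = 0 :=
  image_eq_zero_of_notMem_tsupport fun h => hz (hu.support h)

lemma IsTestFunction.add (hu : IsTestFunction Ω u) (hψ : IsTestFunction Ω ψ) :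
    IsTestFunction Ω (u + ψ) where
  smooth := hu.smooth.add hψ.smooth
  compact := hu.compact.add hψ.compact
  support := (tsupport_add u ψ).trans (Set.union_subset hu.support hψ.support)

lemma IsTestFunction.const_smul (hu : IsTestFunction Ω u) (c : ℝ) :
    IsTestFunction Ω (c • u) where
  smooth := hu.smooth.const_smul c
  compact := hu.compact.smul_left (f := fun _ => c)
  support := (tsupport_smul_subset_right (fun _ => c) u).trans hu.support

lemma IsTestFunction.integral_fderiv_mul (hu : IsTestFunction Ω u) (hψ : IsTestFunction Ω ψ)
    (v : ℂ) : ∫ z in Ω, fderiv ℝ ψ z v * u z = - ∫ z in Ω, ψ z * fderiv ℝ u z v := by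
  have hu' := (hu.fderiv_apply v)
  have hψ' := (hψ.fderiv_apply v)
  rw [setIntegral_eq_integral_of_forall_compl_eq_zero fun z hz => by simp [hu.eq_zero hz],
    setIntegral_eq_integral_of_forall_compl_eq_zero fun z hz => by simp [hψ.eq_zero hz]]
  have int : ∀ {a b : ℂ → ℝ}, IsTestFunction Ω a → IsTestFunction Ω b →
      Integrable (fun z => a z * b z) volume := fun {a b} ha hb =>
    (ha.smooth.continuous.mul hb.smooth.continuous).integrable_of_hasCompactSupport
      (HasCompactSupport.mul_left hb.compact)
  rw [integral_mul_fderiv_eq_neg_fderiv_mul_of_integrable (int hψ' hu) (int hψ hu') (int hψ hu)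
    (fun z _ => hψ.differentiable z) (fun z _ => hu.differentiable z), neg_neg]

end TestFunctions

/-- `(f, F)` lies in the closure of the pairs `(u, ∇u)`, `u ∈ C₀^∞(Ω)`, in `L²(Ω)`. -/
structure IsH10Pair (Ω : Set ℂ) (f : ℂ → ℝ) (F : ℂ → ℂ →L[ℝ] ℝ) : Prop where
  memLp : MemLp f 2 (volume.restrict Ω)
  memLp_deriv : MemLp F 2 (volume.restrict Ω)
  approx : ∀ ε : ℝ≥0∞, ε ≠ 0 → ∃ u, IsTestFunction Ω u ∧
    eLpNorm (f - u) 2 (volume.restrict Ω) ≤ ε ∧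
    eLpNorm (F - fderiv ℝ u) 2 (volume.restrict Ω) ≤ ε

namespace IsH10Pair

variable {Ω : Set ℂ} {f g : ℂ → ℝ} {F G : ℂ → ℂ →L[ℝ] ℝ}

lemma congr (h : IsH10Pair Ω f F) (hf : f =ᵐ[volume.restrict Ω] g)
    (hF : F =ᵐ[volume.restrict Ω] G) : IsH10Pair Ω g G := by
  refine ⟨h.memLp.ae_eq hf, h.memLp_deriv.ae_eq hF, fun ε hε => ?_⟩
  obtain ⟨u, hu, h1, h2⟩ := h.approx ε hε
  refine ⟨u, hu, ?_, ?_⟩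
  · rwa [← eLpNorm_congr_ae (hf.sub (ae_eq_refl u))]
  · rwa [← eLpNorm_congr_ae (hF.sub (ae_eq_refl _))]

/-- The `H¹₀` pairs are closed in `L²`. -/
lemma of_approx (hf : MemLp f 2 (volume.restrict Ω)) (hF : MemLp F 2 (volume.restrict Ω))
    (h : ∀ ε : ℝ≥0∞, ε ≠ 0 → ∃ g G, IsH10Pair Ω g G ∧
      eLpNorm (f - g) 2 (volume.restrict Ω) ≤ ε ∧
      eLpNorm (F - G) 2 (volume.restrict Ω) ≤ ε) : IsH10Pair Ω f F := by
  refine ⟨hf, hF, fun ε hε => ?_⟩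
  obtain ⟨g, G, hg, h1, h2⟩ := h (ε / 2) (by simpa using hε)
  obtain ⟨u, hu, h3, h4⟩ := hg.approx (ε / 2) (by simpa using hε)
  refine ⟨u, hu, ?_, ?_⟩
  · have : f - u = (f - g) + (g - u) := by abel
    rw [this]
    refine (eLpNorm_add_le (hf.1.sub hg.memLp.1) (hg.memLp.1.sub (hu.memLp 2 Ω).1)
      (by norm_num)).trans ?_
    exact (add_le_add h1 h3).trans (ENNReal.add_halves ε).le
  · have : F - fderiv ℝ u = (F - G) + (G - fderiv ℝ u) := by abel
    rw [this]
    refine (eLpNorm_add_le (hF.1.sub hg.memLp_deriv.1)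
      (hg.memLp_deriv.1.sub (hu.memLp_fderiv 2 Ω).1) (by norm_num)).trans ?_
    exact (add_le_add h2 h4).trans (ENNReal.add_halves ε).le

lemma add (hf : IsH10Pair Ω f F) (hg : IsH10Pair Ω g G) : IsH10Pair Ω (f + g) (F + G) := by
  refine ⟨hf.memLp.add hg.memLp, MemLp.add (f := F) (g := G) hf.memLp_deriv hg.memLp_deriv, fun ε hε => ?_⟩
  obtain ⟨u, hu, h1, h2⟩ := hf.approx (ε / 2) (by simpa using hε)
  obtain ⟨w, hw, h3, h4⟩ := hg.approx (ε / 2) (by simpa using hε)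
  refine ⟨u + w, hu.add hw, ?_, ?_⟩
  · rw [add_sub_add_comm]
    refine (eLpNorm_add_le (hf.memLp.1.sub (hu.memLp 2 Ω).1) (hg.memLp.1.sub (hw.memLp 2 Ω).1)
      (by norm_num)).trans ?_
    exact (add_le_add h1 h3).trans (ENNReal.add_halves ε).le
  · have : F + G - fderiv ℝ (u + w) = (F - fderiv ℝ u) + (G - fderiv ℝ w) := by
      have : fderiv ℝ (u + w) = fderiv ℝ u + fderiv ℝ w := by
        ext1 z; exact fderiv_add (hu.differentiable z) (hw.differentiable z)
      rw [this, add_sub_add_comm]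
    rw [this]
    refine (eLpNorm_add_le (hf.memLp_deriv.1.sub (hu.memLp_fderiv 2 Ω).1)
      (hg.memLp_deriv.1.sub (hw.memLp_fderiv 2 Ω).1) (by norm_num)).trans ?_
    exact (add_le_add h2 h4).trans (ENNReal.add_halves ε).le

lemma const_smul (hf : IsH10Pair Ω f F) (c : ℝ) : IsH10Pair Ω (c • f) (c • F) := by
  refine ⟨hf.memLp.const_smul c, hf.memLp_deriv.const_smul c, fun ε hε => ?_⟩
  obtain ⟨u, hu, h1, h2⟩ := hf.approx (ε / (‖c‖ₑ + 1))
    (ENNReal.div_ne_zero.2 ⟨hε, by simp⟩)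
  have key : ‖c‖ₑ * (ε / (‖c‖ₑ + 1)) ≤ ε := by
    calc ‖c‖ₑ * (ε / (‖c‖ₑ + 1)) ≤ (‖c‖ₑ + 1) * (ε / (‖c‖ₑ + 1)) := by gcongr; simp
      _ ≤ ε := ENNReal.mul_div_le
  refine ⟨c • u, hu.const_smul c, ?_, ?_⟩
  · rw [← smul_sub, eLpNorm_const_smul]
    exact (mul_le_mul_right h1 _).trans key
  · have : fderiv ℝ (c • u) = c • fderiv ℝ u := by
      ext1 z; exact fderiv_const_smul (hu.differentiable z) c
    have h3 : c • F - fderiv ℝ (c • u) = c • (F - fderiv ℝ u) := by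
      rw [this]; ext1 z; exact (smul_sub c (F z) (fderiv ℝ u z)).symm
    rw [h3]
    exact (eLpNorm_const_smul c (F - fderiv ℝ u) 2 _).trans_le ((mul_le_mul_right h2 _).trans key)

/-- For fixed ψ and v the defect `X` in the integration by parts formula is an L²-continuous
functional of the pair, and it vanishes on test functions. Finite area gives local integrability,
since L² ⊆ L¹. -/
lemma hasWeakFDeriv (hΩ : volume Ω ≠ ⊤) (h : IsH10Pair Ω f F) : HasWeakFDeriv Ω f F := by
  have : IsFiniteMeasure (volume.restrict Ω) := ⟨by simpa using hΩ.lt_top⟩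
  refine ⟨IntegrableOn.locallyIntegrableOn (h.memLp.integrable (by norm_num)),
    IntegrableOn.locallyIntegrableOn (h.memLp_deriv.integrable (by norm_num)), fun ψ hψ v => ?_⟩
  set μ := volume.restrict Ω
  have hψ' := hψ.fderiv_apply v
  have hFv : MemLp (fun z => F z v) 2 μ :=
    (ContinuousLinearMap.apply ℝ ℝ v).comp_memLp' h.memLp_deriv
  set X : ℝ := ∫ z in Ω, (fderiv ℝ ψ z v) • f z + ψ z • F z v with hX
  have i1 := integrable_smul_of_memLp (hψ'.memLp 2 Ω) h.memLp
  have i2 := integrable_smul_of_memLp (hψ.memLp 2 Ω) hFv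
  have hX2 : X = (∫ z in Ω, (fderiv ℝ ψ z v) • f z) + ∫ z in Ω, ψ z • F z v :=
    integral_add i1 i2
  suffices X = 0 by linarith
  rw [← enorm_eq_zero]
  have hC : eLpNorm (fun z => fderiv ℝ ψ z v) 2 μ + eLpNorm ψ 2 μ * ENNReal.ofReal ‖v‖ ≠ ⊤ :=
    ENNReal.add_ne_top.2 ⟨(hψ'.memLp 2 Ω).2.ne, ENNReal.mul_ne_top (hψ.memLp 2 Ω).2.ne (by simp)⟩
  refine eq_zero_of_le_const_mul hC fun ε hε => ?_
  obtain ⟨u, hu, h1, h2⟩ := h.approx ε hε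
  have huv : MemLp (fun z => fderiv ℝ u z v) 2 μ := (hu.fderiv_apply v).memLp 2 Ω
  have i3 := integrable_smul_of_memLp (hψ'.memLp 2 Ω) (h.memLp.sub (hu.memLp 2 Ω))
  have i4 := integrable_smul_of_memLp (hψ.memLp 2 Ω) (hFv.sub huv)
  have i5 := integrable_smul_of_memLp (hψ'.memLp 2 Ω) (hu.memLp 2 Ω)
  have i6 := integrable_smul_of_memLp (hψ.memLp 2 Ω) huv
  have hX3 : X = (∫ z in Ω, (fderiv ℝ ψ z v) • (f - u) z)
      + ∫ z in Ω, ψ z • ((fun z => F z v) - fun z => fderiv ℝ u z v) z := by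
    have e1 : ∫ z in Ω, (fderiv ℝ ψ z v) • f z
        = (∫ z in Ω, (fderiv ℝ ψ z v) • (f - u) z) + ∫ z in Ω, (fderiv ℝ ψ z v) • u z := by
      rw [← integral_add i3 i5]; congr 1; ext z; simp; ring
    have e2 : ∫ z in Ω, ψ z • F z v
        = (∫ z in Ω, ψ z • ((fun z => F z v) - fun z => fderiv ℝ u z v) z)
          + ∫ z in Ω, ψ z • fderiv ℝ u z v := by
      rw [← integral_add i4 i6]; congr 1; ext z; simp; ring
    have e3 := hu.integral_fderiv_mul hψ v
    simp only [smul_eq_mul] at *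
    rw [hX2, e1, e2, e3]; ring
  rw [hX3]
  refine (enorm_add_le _ _).trans ?_
  rw [add_mul, mul_assoc]
  refine add_le_add ((enorm_integral_smul_le (hψ'.memLp 2 Ω).1
    (h.memLp.1.sub (hu.memLp 2 Ω).1)).trans (mul_le_mul_right h1 _)) ?_
  refine (enorm_integral_smul_le (hψ.memLp 2 Ω).1 (hFv.1.sub huv.1)).trans ?_
  refine mul_le_mul_right ?_ _
  refine (eLpNorm_le_mul_eLpNorm_of_ae_le_mul (c := ‖v‖) (g := F - fderiv ℝ u)
    (Eventually.of_forall fun z => ?_) 2).trans (mul_le_mul_right h2 _)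
  rw [mul_comm]
  exact (F z - fderiv ℝ u z).le_opNorm v

end IsH10Pair

/-! ### Comparison of the weighted and unweighted energies -/

section Energy

variable {Ω : Set ℂ} {A : ℂ → Matrix (Fin 2) (Fin 2) ℝ} {f : ℂ → ℝ} {F : ℂ → ℂ →L[ℝ] ℝ}

lemma MemEllipticClass.aestronglyMeasurable_energy (hA : MemEllipticClass Ω A)
    (hF : AEStronglyMeasurable F (volume.restrict Ω)) :
    AEStronglyMeasurable (fun z => (A z *ᵥ grad (F z)) ⬝ᵥ grad (F z)) (volume.restrict Ω) := by
  have hm : ∀ v : ℂ, AEMeasurable (fun z => F z v) (volume.restrict Ω) := fun v =>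
    ((ContinuousLinearMap.apply ℝ ℝ v).continuous.comp_aestronglyMeasurable hF).aemeasurable
  have h := hA.measurable_entries
  simp only [quadForm_eq, grad, Matrix.cons_val_zero, Matrix.cons_val_one]
  refine AEMeasurable.aestronglyMeasurable ?_
  exact ((((h 0 0).mul (hm 1)).add ((h 0 1).mul (hm _))).mul (hm 1)).add
    ((((h 1 0).mul (hm 1)).add ((h 1 1).mul (hm _))).mul (hm _))

/-- Ellipticity bounds, in terms of the norm of the differential. -/
lemma MemEllipticClass.exists_bound (hA : MemEllipticClass Ω A) :
    ∃ K : ℝ, 1 ≤ K ∧ ∀ᵐ z ∂(volume.restrict Ω), ∀ L : ℂ →L[ℝ] ℝ,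
      ‖L‖ ^ 2 ≤ K * ((A z *ᵥ grad L) ⬝ᵥ grad L) ∧ (A z *ᵥ grad L) ⬝ᵥ grad L ≤ K * ‖L‖ ^ 2 := by
  obtain ⟨K, hK, h⟩ := hA.elliptic
  refine ⟨K, hK, ?_⟩
  filter_upwards [h] with z hz L
  obtain ⟨h1, h2⟩ := hz (grad L)
  rw [← norm_sq_eq_grad] at h1 h2
  refine ⟨?_, h2⟩
  rwa [one_div, inv_mul_le_iff₀ (by positivity)] at h1

lemma MemEllipticClass.entry_pos (hA : MemEllipticClass Ω A) :
    ∀ᵐ z ∂(volume.restrict Ω), 0 < A z 0 0 := by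
  obtain ⟨K, hK, h⟩ := hA.elliptic
  filter_upwards [h] with z hz
  have h1 := (hz ![1, 0]).1
  rw [quadForm_eq] at h1
  simp at h1
  exact lt_of_lt_of_le (by positivity) h1

lemma MemEllipticClass.memLp_of_energy (hA : MemEllipticClass Ω A)
    (hF : AEStronglyMeasurable F (volume.restrict Ω))
    (h : IntegrableOn (fun z => (A z *ᵥ grad (F z)) ⬝ᵥ grad (F z)) Ω volume) :
    MemLp F 2 (volume.restrict Ω) := by
  obtain ⟨K, hK, hb⟩ := hA.exists_bound
  rw [memLp_two_iff_integrable_sq_norm hF]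
  refine (h.const_mul K).mono (hF.norm.pow 2) ?_
  filter_upwards [hb] with z hz
  rw [Real.norm_of_nonneg (by positivity), Real.norm_eq_abs]
  exact (hz (F z)).1.trans (le_abs_self _)

lemma MemEllipticClass.integrable_energy (hA : MemEllipticClass Ω A)
    (hF : MemLp F 2 (volume.restrict Ω)) :
    IntegrableOn (fun z => (A z *ᵥ grad (F z)) ⬝ᵥ grad (F z)) Ω volume := by
  obtain ⟨K, hK, hb⟩ := hA.exists_bound
  refine (((memLp_two_iff_integrable_sq_norm hF.1).1 hF).const_mul K).mono
    (hA.aestronglyMeasurable_energy hF.1) ?_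
  filter_upwards [hb] with z hz
  have h1 := (hz (F z)).1
  have h0 : 0 ≤ (A z *ᵥ grad (F z)) ⬝ᵥ grad (F z) := by
    have : 0 ≤ K * ((A z *ᵥ grad (F z)) ⬝ᵥ grad (F z)) := (sq_nonneg _).trans h1
    exact (mul_nonneg_iff_of_pos_left (by positivity)).1 this
  rw [Real.norm_of_nonneg h0, Real.norm_of_nonneg (by positivity)]
  exact (hz (F z)).2

lemma normL2_eq (hf : MemLp f 2 (volume.restrict Ω)) :
    ENNReal.ofReal (normL2 Ω f) = eLpNorm f 2 (volume.restrict Ω) := by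
  rw [MemLp.eLpNorm_two_eq hf]; rfl

lemma MemEllipticClass.exists_seminorm_bound (hA : MemEllipticClass Ω A) :
    ∃ K : ℝ, 1 ≤ K ∧ ∀ F : ℂ → ℂ →L[ℝ] ℝ, MemLp F 2 (volume.restrict Ω) →
      eLpNorm F 2 (volume.restrict Ω) ≤ ENNReal.ofReal (K * seminormA A Ω F) ∧
      ENNReal.ofReal (seminormA A Ω F) ≤ ENNReal.ofReal K * eLpNorm F 2 (volume.restrict Ω) := by
  obtain ⟨K, hK, hb⟩ := hA.exists_bound
  refine ⟨√K, Real.one_le_sqrt.2 hK, fun F hF => ?_⟩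
  have hsq := (memLp_two_iff_integrable_sq_norm hF.1).1 hF
  have hen := hA.integrable_energy hF
  rw [MemLp.eLpNorm_two_eq hF, ← ENNReal.ofReal_mul (by positivity)]
  unfold seminormA energy
  rw [← Real.sqrt_mul (by positivity), ← Real.sqrt_mul (by positivity)]
  constructor
  · refine ENNReal.ofReal_le_ofReal (Real.sqrt_le_sqrt ?_)
    rw [← integral_const_mul]
    exact integral_mono_ae hsq (hen.const_mul K) (hb.mono fun z hz => (hz (F z)).1)
  · refine ENNReal.ofReal_le_ofReal (Real.sqrt_le_sqrt ?_)
    rw [← integral_const_mul]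
    exact integral_mono_ae hen (hsq.const_mul K) (hb.mono fun z hz => (hz (F z)).2)

/-- For an elliptic matrix, `W₀^{1,2}(Ω, A)` is the unweighted space. -/
lemma MemEllipticClass.memSobolevZero_iff (hA : MemEllipticClass Ω A) (hΩ : volume Ω ≠ ⊤) :
    MemSobolevZero A Ω f F ↔ IsH10Pair Ω f F := by
  obtain ⟨K, hK, hb⟩ := hA.exists_seminorm_bound
  constructor
  · rintro ⟨⟨hw, hf, hE⟩, u, hu, hlim⟩
    have hF : MemLp F 2 (volume.restrict Ω) :=
      hA.memLp_of_energy hw.locInt_deriv.aestronglyMeasurable hE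
    refine ⟨hf, hF, fun ε hε => ?_⟩
    -- The factor `K` pays for passing from the weighted seminorm to the L² norm of the
    -- differential. As `K ≥ 1`, the same `δ` serves the function itself.
    obtain ⟨δ, hδ, hδε⟩ : ∃ δ : ℝ, 0 < δ ∧ ENNReal.ofReal (K * δ) ≤ ε := by
      by_cases ht : ε = ⊤
      · exact ⟨1, one_pos, by simp [ht]⟩
      · have h0 : 0 < ε.toReal := ENNReal.toReal_pos hε ht
        refine ⟨ε.toReal / K, by positivity, ?_⟩
        rw [mul_div_cancel₀ _ (by positivity), ENNReal.ofReal_toReal ht]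
    obtain ⟨n, hn⟩ := (hlim.eventually_lt_const hδ).exists
    have hn1 : 0 ≤ normL2 Ω (fun z => f z - u n z) := Real.sqrt_nonneg _
    have hn2 : 0 ≤ seminormA A Ω (fun z => F z - fderiv ℝ (u n) z) := Real.sqrt_nonneg _
    refine ⟨u n, hu n, ?_, ?_⟩
    · rw [← normL2_eq (hf.sub ((hu n).memLp 2 Ω))]
      refine le_trans (ENNReal.ofReal_le_ofReal ?_) hδε
      change normL2 Ω (fun z => f z - u n z) ≤ _
      nlinarith
    · refine ((hb _ (hF.sub ((hu n).memLp_fderiv 2 Ω))).1).trans ?_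
      refine le_trans (ENNReal.ofReal_le_ofReal ?_) hδε
      change K * seminormA A Ω (fun z => F z - fderiv ℝ (u n) z) ≤ _
      nlinarith
  · intro h
    refine ⟨⟨h.hasWeakFDeriv hΩ, h.memLp, hA.integrable_energy h.memLp_deriv⟩, ?_⟩
    choose u hu h1 h2 using fun n : ℕ =>
      h.approx (ENNReal.ofReal (1 / ((n : ℝ) + 1))) (by simpa using by positivity)
    refine ⟨u, hu, ?_⟩
    have hlim : Tendsto (fun n : ℕ => (1 + K) * (1 / ((n : ℝ) + 1))) atTop (𝓝 0) := by
      simpa using tendsto_one_div_add_atTop_nhds_zero_nat.const_mul (1 + K)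
    refine squeeze_zero (fun n => add_nonneg (Real.sqrt_nonneg _) (Real.sqrt_nonneg _))
      (fun n => ?_) hlim
    have hp : 0 ≤ 1 / ((n : ℝ) + 1) := by positivity
    rw [add_mul, one_mul]
    refine add_le_add ?_ ?_
    · have := (normL2_eq (h.memLp.sub ((hu n).memLp 2 Ω))).trans_le (h1 n)
      exact (ENNReal.ofReal_le_ofReal_iff hp).1 this
    · have := ((hb _ (h.memLp_deriv.sub ((hu n).memLp_fderiv 2 Ω))).2).trans
        (mul_le_mul_right (h2 n) _)
      rw [← ENNReal.ofReal_mul (by positivity)] at this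
      exact (ENNReal.ofReal_le_ofReal_iff (by positivity)).1 this

lemma memEllipticClass_one (Ω : Set ℂ) : MemEllipticClass Ω (fun _ => 1) where
  measurable_entries := fun i j => aemeasurable_const
  symm := Eventually.of_forall fun _ => Matrix.isSymm_one
  det_eq_one := Eventually.of_forall fun _ => Matrix.det_one
  elliptic := ⟨1, le_rfl, Eventually.of_forall fun _ ξ => by simp⟩

end Energy

/-! ### Mollification -/

lemma tendsto_eLpNorm_two_zero {α E : Type*} [MeasurableSpace α] [NormedAddCommGroup E]
    {μ : Measure α} {f : ℕ → α → E} {C : ℝ} {s : Set α} (hs : μ s ≠ ⊤) (hsm : MeasurableSet s)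
    (hm : ∀ n, AEStronglyMeasurable (f n) μ) (hb : ∀ n, ∀ᵐ x ∂μ, ‖f n x‖ ≤ C)
    (h0 : ∀ n, ∀ x ∉ s, f n x = 0)
    (hl : ∀ᵐ x ∂μ, Tendsto (fun n => f n x) atTop (𝓝 0)) :
    Tendsto (fun n => eLpNorm (f n) 2 μ) atTop (𝓝 0) := by
  have key : Tendsto (fun n => ∫⁻ x, ‖f n x‖ₑ ^ (2 : ℝ) ∂μ) atTop (𝓝 (∫⁻ _, 0 ∂μ)) := by
    refine tendsto_lintegral_of_dominated_convergence'
      (s.indicator fun _ => ENNReal.ofReal C ^ (2 : ℝ)) (fun n => (hm n).enorm.pow_const _)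
      (fun n => ?_) ?_ ?_
    · filter_upwards [hb n] with x hx
      by_cases hxs : x ∈ s
      · rw [Set.indicator_of_mem hxs, ← ofReal_norm]
        gcongr
      · rw [h0 n x hxs]; simp
    · rw [lintegral_indicator hsm, setLIntegral_const]
      exact ENNReal.mul_ne_top (by simp) hs
    · filter_upwards [hl] with x hx
      have h1 := ((continuous_enorm.tendsto _).comp hx)
      have h2 := ((ENNReal.continuous_rpow_const (y := 2)).tendsto _).comp h1
      simpa [Function.comp_def] using h2
  simp only [lintegral_zero] at key
  have h3 := ((ENNReal.continuous_rpow_const (y := 1 / 2)).tendsto _).comp key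
  rw [ENNReal.zero_rpow_of_pos (by norm_num)] at h3
  refine h3.congr fun n => ?_
  rw [eLpNorm_eq_lintegral_rpow_enorm_toReal (by simp) (by simp)]
  simp

/-- A standard family of mollifiers. -/
def mollifier (n : ℕ) : ContDiffBump (0 : ℂ) where
  rIn := 1 / (2 * ((n : ℝ) + 1))
  rOut := 1 / ((n : ℝ) + 1)
  rIn_pos := by positivity
  rIn_lt_rOut := by
    apply one_div_lt_one_div_of_lt (by positivity)
    have : (0 : ℝ) < n + 1 := by positivity
    linarith

lemma tendsto_mollifier_rOut : Tendsto (fun n => (mollifier n).rOut) atTop (𝓝 0) :=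
  tendsto_one_div_add_atTop_nhds_zero_nat

/-- The mollification `ρₙ ∗ f`. -/
def mollify {E : Type*} [NormedAddCommGroup E] [NormedSpace ℝ E] (n : ℕ) (f : ℂ → E) : ℂ → E :=
  convolution ((mollifier n).normed volume) f (ContinuousLinearMap.lsmul ℝ ℝ) volume

section Mollify

variable {E : Type*} [NormedAddCommGroup E] [NormedSpace ℝ E]

/-- The integrand of a mollification. -/
def mollifyIntegrand (n : ℕ) (f : ℂ → E) (x t : ℂ) : E :=
  (mollifier n).normed volume t • f (x - t)

lemma mollify_apply (n : ℕ) (f : ℂ → E) (x : ℂ) :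
    mollify n f x = ∫ t, (mollifier n).normed volume t • f (x - t) := rfl

lemma norm_mollify_le (n : ℕ) {f : ℂ → E} {C : ℝ} (hf : ∀ x, ‖f x‖ ≤ C) (x : ℂ) :
    ‖mollify n f x‖ ≤ C := by
  rw [mollify_apply]
  calc ‖∫ t, (mollifier n).normed volume t • f (x - t)‖
      ≤ ∫ t, (mollifier n).normed volume t * C := by
        refine norm_integral_le_of_norm_le ((mollifier n).integrable_normed.mul_const C)
          (Eventually.of_forall fun t => ?_)
        rw [norm_smul, Real.norm_of_nonneg ((mollifier n).nonneg_normed t)]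
        exact mul_le_mul_of_nonneg_left (hf _) ((mollifier n).nonneg_normed t)
    _ = C := by rw [integral_mul_const, (mollifier n).integral_normed, one_mul]

lemma support_mollify_subset (n : ℕ) (f : ℂ → E) :
    Function.support (mollify n f) ⊆ Metric.cthickening (1 / ((n : ℝ) + 1)) (tsupport f) := by
  intro x hx
  obtain ⟨a, ha, b, hb, rfl⟩ := (support_convolution_subset _) hx
  rw [(mollifier n).support_normed_eq, mem_ball_zero_iff] at ha
  refine Metric.mem_cthickening_of_dist_le _ b _ _ (subset_tsupport _ hb) ?_
  rw [dist_eq_norm, add_sub_cancel_right]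
  exact ha.le

lemma tsupport_mollify_subset (n : ℕ) (f : ℂ → E) :
    tsupport (mollify n f) ⊆ Metric.cthickening (1 / ((n : ℝ) + 1)) (tsupport f) :=
  closure_minimal (support_mollify_subset n f) Metric.isClosed_cthickening

lemma contDiff_mollify [CompleteSpace E] (n : ℕ) {f : ℂ → E} (hf : LocallyIntegrable f) :
    ContDiff ℝ ∞ (mollify n f) :=
  (mollifier n).hasCompactSupport_normed.contDiff_convolution_left _
    (mollifier n).contDiff_normed hf

lemma ae_tendsto_mollify [CompleteSpace E] {f : ℂ → E} (hf : LocallyIntegrable f) :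
    ∀ᵐ x, Tendsto (fun n => mollify n f x) atTop (𝓝 (f x)) := by
  -- `K = 2` is the ratio of the outer to the inner radius of every mollifier; a uniform bound on
  -- this ratio is what Lebesgue differentiation needs.
  refine ContDiffBump.ae_convolution_tendsto_right_of_locallyIntegrable (K := 2)
    tendsto_mollifier_rOut (Eventually.of_forall fun n => ?_) hf
  change 1 / ((n : ℝ) + 1) ≤ 2 * (1 / (2 * ((n : ℝ) + 1)))
  apply le_of_eq; field_simp

lemma aestronglyMeasurable_mollify_integrand (n : ℕ) {F : ℂ → E}
    (hF : AEStronglyMeasurable F volume) (x : ℂ) :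
    AEStronglyMeasurable (mollifyIntegrand n F x) volume :=
  (mollifier n).continuous_normed.aestronglyMeasurable.fun_smul
    (hF.comp_quasiMeasurePreserving (quasiMeasurePreserving_sub_left volume x))

omit [NormedSpace ℝ E] in
lemma memLp_two_of_bound {F : ℂ → E} {K : Set ℂ} {C : ℝ} (hF : AEStronglyMeasurable F volume)
    (hK : IsCompact K) (h0 : ∀ x ∉ K, F x = 0) (hC : ∀ x, ‖F x‖ ≤ C) : MemLp F 2 volume := by
  have h2 : F = K.indicator F := by
    ext1 x
    by_cases hx : x ∈ K
    · rw [Set.indicator_of_mem hx]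
    · rw [Set.indicator_of_notMem hx, h0 x hx]
  rw [h2, memLp_indicator_iff_restrict hK.measurableSet]
  have : IsFiniteMeasure (volume.restrict K) := ⟨by simpa using hK.measure_lt_top⟩
  exact MemLp.of_bound hF.restrict C (Eventually.of_forall hC)

end Mollify

/-! ### Compactly supported Lipschitz functions -/

section Lipschitz

variable {w : ℂ → ℝ} {C : NNReal}

lemma lipschitz_mollify_integrand (hw : LipschitzWith C w) (n : ℕ) (t : ℂ) :
    LipschitzOnWith (Real.nnabs ((mollifier n).normed volume t * C))
      (fun y => (mollifier n).normed volume t • w (y - t)) Set.univ := by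
  generalize (mollifier n).normed volume t = r
  refine LipschitzOnWith.of_dist_le_mul fun a _ b _ => ?_
  have h1 := hw.dist_le_mul (a - t) (b - t)
  rw [dist_sub_right] at h1
  rw [dist_smul₀, Real.coe_nnabs, abs_mul, mul_assoc, Real.norm_eq_abs, NNReal.abs_eq]
  exact mul_le_mul_of_nonneg_left h1 (abs_nonneg _)

/-- Differentiation under the integral sign: by Rademacher the integrand is differentiable at `x`
for almost every `t`, and its Lipschitz constant ρ(t) C is an integrable majorant. -/
lemma hasFDerivAt_mollify (hw : LipschitzWith C w) (n : ℕ) (x : ℂ) :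
    HasFDerivAt (mollify n w) (mollify n (fderiv ℝ w) x) x := by
  have hcont := hw.continuous
  have hρ : Continuous ((mollifier n).normed (volume : Measure ℂ)) := (mollifier n).continuous_normed
  have hρc := (mollifier n).hasCompactSupport_normed (μ := volume)
  have hdm : AEStronglyMeasurable (fderiv ℝ w) volume :=
    (measurable_fderiv ℝ w).aestronglyMeasurable
  refine (hasFDerivAt_integral_of_dominated_loc_of_lip (μ := volume) (s := Set.univ) (x₀ := x)
    (F := fun y t => (mollifier n).normed volume t • w (y - t))
    (F' := mollifyIntegrand n (fderiv ℝ w) x)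
    (bound := fun t => (mollifier n).normed volume t * C) univ_mem ?_ ?_ ?_ ?_ ?_ ?_).2
  · exact Eventually.of_forall fun y => (by fun_prop : Continuous fun t =>
      (mollifier n).normed volume t • w (y - t)).aestronglyMeasurable
  · have h1 : Continuous fun t => (mollifier n).normed volume t • w (x - t) := by fun_prop
    exact h1.integrable_of_hasCompactSupport
      (hρc.mono fun t ht h0 => ht (by simp only [h0, zero_smul]))
  · exact aestronglyMeasurable_mollify_integrand n hdm x
  · exact Eventually.of_forall fun t => lipschitz_mollify_integrand hw n t
  · exact (mollifier n).integrable_normed.mul_const _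
  · have h1 : ∀ᵐ t : ℂ, DifferentiableAt ℝ w (x - t) :=
      (quasiMeasurePreserving_sub_left volume x).ae hw.ae_differentiableAt
    filter_upwards [h1] with t ht
    have h2 : HasFDerivAt (fun y : ℂ => y - t) (ContinuousLinearMap.id ℝ ℂ) x :=
      (hasFDerivAt_id x).sub_const t
    have h3 := ht.hasFDerivAt.comp x h2
    rw [ContinuousLinearMap.comp_id] at h3
    exact h3.const_smul ((mollifier n).normed volume t)

/-- Compactly supported Lipschitz functions belong to `W₀^{1,2}`. -/
lemma isH10Pair_of_lipschitz {Ω : Set ℂ} (hΩ : IsOpen Ω) (hw : LipschitzWith C w)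
    (hc : HasCompactSupport w) (hs : tsupport w ⊆ Ω) : IsH10Pair Ω w (fderiv ℝ w) := by
  have hcont := hw.continuous
  have hbd : ∀ x, ‖fderiv ℝ w x‖ ≤ C := fun x => norm_fderiv_le_of_lipschitz ℝ hw
  have hdm : AEStronglyMeasurable (fderiv ℝ w) volume :=
    (measurable_fderiv ℝ w).aestronglyMeasurable
  -- All mollifying radii are at most 1, so this one compact set carries `w`, its differential and
  -- all their mollifications, and bounded convergence on it suffices.
  set K := Metric.cthickening 1 (tsupport w) with hK
  have hKc : IsCompact K := IsCompact.cthickening hc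
  have hsub : tsupport w ⊆ K := Metric.self_subset_cthickening _
  have hw0 : ∀ x ∉ K, w x = 0 := fun x hx => image_eq_zero_of_notMem_tsupport fun h => hx (hsub h)
  have hd0 : ∀ x ∉ K, fderiv ℝ w x = 0 := fun x hx =>
    image_eq_zero_of_notMem_tsupport fun h => hx (hsub (tsupport_fderiv_subset ℝ h))
  have hdts : tsupport (fderiv ℝ w) ⊆ tsupport w := tsupport_fderiv_subset ℝ
  have hn1 : ∀ n : ℕ, 1 / ((n : ℝ) + 1) ≤ 1 := fun n => by
    rw [div_le_one (by positivity)]; linarith [(Nat.cast_nonneg n : (0 : ℝ) ≤ n)]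
  have hm0 : ∀ n, ∀ x ∉ K, mollify n w x = 0 := fun n x hx => by
    by_contra h
    exact hx (Metric.cthickening_mono (hn1 n) _ (support_mollify_subset n w h))
  have hmd0 : ∀ n, ∀ x ∉ K, mollify n (fderiv ℝ w) x = 0 := fun n x hx => by
    by_contra h
    exact hx (Metric.cthickening_mono (hn1 n) _
      (Metric.cthickening_subset_of_subset _ hdts (support_mollify_subset n (fderiv ℝ w) h)))
  have hdL : MemLp (fderiv ℝ w) 2 volume := memLp_two_of_bound hdm hKc hd0 hbd
  have hwi : LocallyIntegrable w volume := hcont.locallyIntegrable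
  have hdi : LocallyIntegrable (fderiv ℝ w) volume := hdL.locallyIntegrable (by norm_num)
  obtain ⟨M, hM⟩ := hcont.bounded_above_of_compact_support hc
  have hfd : ∀ n, fderiv ℝ (mollify n w) = mollify n (fderiv ℝ w) := fun n => by
    ext1 x; exact (hasFDerivAt_mollify hw n x).fderiv
  have hsm : ∀ n, ContDiff ℝ ∞ (mollify n w) := fun n => contDiff_mollify n hwi
  have lim1 : Tendsto (fun n => eLpNorm (w - mollify n w) 2 volume) atTop (𝓝 0) := by
    refine tendsto_eLpNorm_two_zero (C := M + M) hKc.measure_lt_top.ne hKc.measurableSet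
      (fun n => (hcont.sub (hsm n).continuous).aestronglyMeasurable)
      (fun n => Eventually.of_forall fun x =>
        (norm_sub_le _ _).trans (add_le_add (hM x) (norm_mollify_le n hM x))) ?_ ?_
    · intro n x hx; simp [hw0 x hx, hm0 n x hx]
    · filter_upwards [ae_tendsto_mollify hwi] with x hx
      simpa using hx.const_sub (w x)
  have lim2 : Tendsto (fun n => eLpNorm (fderiv ℝ w - fderiv ℝ (mollify n w)) 2 volume) atTop
      (𝓝 0) := by
    refine tendsto_eLpNorm_two_zero (C := C + C) hKc.measure_lt_top.ne hKc.measurableSet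
      (fun n => hdm.sub (measurable_fderiv ℝ _).aestronglyMeasurable)
      (fun n => Eventually.of_forall fun x => ?_) ?_ ?_
    · simp only [hfd]
      exact (norm_sub_le _ _).trans (add_le_add (hbd x) (norm_mollify_le n hbd x))
    · intro n x hx
      simp only [hfd]
      rw [Pi.sub_apply, hd0 x hx, hmd0 n x hx, sub_zero]
    · filter_upwards [ae_tendsto_mollify hdi] with x hx
      simp only [hfd]
      simpa using hx.const_sub (fderiv ℝ w x)
  refine ⟨(hcont.memLp_of_hasCompactSupport hc (μ := volume)).restrict Ω, hdL.restrict Ω,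
    fun ε hε => ?_⟩
  -- Once the radius is at most `δ`, the mollification is supported in Ω.
  obtain ⟨δ, hδ, hδs⟩ := hc.exists_cthickening_subset_open hΩ hs
  have e1 := lim1.eventually_le_const (pos_iff_ne_zero.2 hε)
  have e2 := lim2.eventually_le_const (pos_iff_ne_zero.2 hε)
  have e3 := tendsto_one_div_add_atTop_nhds_zero_nat (𝕜 := ℝ) |>.eventually_le_const hδ
  obtain ⟨n, h1, h2, h3⟩ := (e1.and (e2.and e3)).exists
  refine ⟨mollify n w, ⟨hsm n, ?_, ?_⟩, ?_, ?_⟩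
  · exact HasCompactSupport.of_support_subset_isCompact hKc fun x hx => by
      by_contra h; exact hx (hm0 n x h)
  · exact (tsupport_mollify_subset n w).trans ((Metric.cthickening_mono h3 _).trans hδs)
  · exact (eLpNorm_mono_measure _ Measure.restrict_le_self).trans h1
  · exact (eLpNorm_mono_measure _ Measure.restrict_le_self).trans h2

end Lipschitz

/-! ### From weak to classical differentials -/

section WeakToClassical

variable {Ω : Set ℂ} {f : ℂ → ℝ} {D : ℂ → ℂ →L[ℝ] ℝ}

lemma fderiv_mollify_apply (n : ℕ) {g : ℂ → ℝ} (hg : LocallyIntegrable g) (x v : ℂ) :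
    fderiv ℝ (mollify n g) x v
      = ∫ t, fderiv ℝ ((mollifier n).normed volume) (x - t) v * g t := by
  have hρ : ContDiff ℝ 1 ((mollifier n).normed (volume : Measure ℂ)) := (mollifier n).contDiff_normed
  have hρc := (mollifier n).hasCompactSupport_normed (μ := volume)
  have h1 : mollify n g = convolution g ((mollifier n).normed volume)
      (ContinuousLinearMap.lsmul ℝ ℝ).flip volume := (convolution_flip _).symm
  rw [h1, (hρc.hasFDerivAt_convolution_right _ hg hρ x).fderiv,
    convolution_precompR_apply _ hg (hρc.fderiv (𝕜 := ℝ)) (hρ.continuous_fderiv (by simp))]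
  rfl

/-- A continuous function with bounded weak differential is Lipschitz on small balls. -/
lemma HasWeakFDeriv.lipschitzOnWith (hf : ContinuousOn f Ω)
    (h : HasWeakFDeriv Ω f D) {L : NNReal} (hL : ∀ᵐ z ∂(volume.restrict Ω), ‖D z‖ ≤ L) {z₀ : ℂ}
    {r : ℝ} (hr : 0 < r) (hball : Metric.closedBall z₀ (2 * r) ⊆ Ω) :
    LipschitzOnWith L f (Metric.ball z₀ r) := by
  set S := Metric.closedBall z₀ (2 * r) with hS
  have hSc : IsCompact S := isCompact_closedBall _ _
  -- Cutting off to the larger ball makes the mollification meaningful on the whole plane. For radii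
  -- below `r` it agrees on the smaller ball with the mollification of `f`.
  set g := S.indicator f with hg
  have hgi : LocallyIntegrable g volume := by
    have : Integrable g := (integrable_indicator_iff hSc.measurableSet).2
      ((hf.mono hball).integrableOn_compact hSc)
    exact this.locallyIntegrable
  have hder : ∀ n : ℕ, 1 / ((n : ℝ) + 1) < r → ∀ x ∈ Metric.ball z₀ r,
      ‖fderiv ℝ (mollify n g) x‖ ≤ L := by
    intro n hn x hx
    refine ContinuousLinearMap.opNorm_le_bound _ L.coe_nonneg fun v => ?_
    have hρ := (mollifier n).contDiff_normed (μ := (volume : Measure ℂ)) (n := ⊤)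
    set ρ := (mollifier n).normed (volume : Measure ℂ) with hρdef
    have hsupp : ∀ t ∉ Metric.closedBall x (1 / ((n : ℝ) + 1)), ρ (x - t) = 0 := by
      intro t ht
      rw [← Function.notMem_support, hρdef, (mollifier n).support_normed_eq, mem_ball_zero_iff]
      rw [Metric.mem_closedBall, dist_comm, dist_eq_norm] at ht
      exact fun hlt => ht hlt.le
    have hsub : Metric.closedBall x (1 / ((n : ℝ) + 1)) ⊆ S := by
      refine Metric.closedBall_subset_closedBall' ?_
      have := Metric.mem_ball.1 hx
      linarith
    have hts : tsupport (fun t => ρ (x - t)) ⊆ Metric.closedBall x (1 / ((n : ℝ) + 1)) := by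
      refine closure_minimal (fun t ht => ?_) Metric.isClosed_closedBall
      by_contra h0
      exact ht (hsupp t h0)
    have hψ : IsTestFunction Ω (fun t => ρ (x - t)) :=
      ⟨hρ.comp (contDiff_const.sub contDiff_id),
        HasCompactSupport.intro (isCompact_closedBall x _) hsupp,
        hts.trans (hsub.trans hball)⟩
    have hψd : ∀ t, fderiv ℝ (fun t => ρ (x - t)) t v = - fderiv ℝ ρ (x - t) v := by
      intro t
      have h1 : HasFDerivAt (fun t => x - t) (-ContinuousLinearMap.id ℝ ℂ) t :=
        (hasFDerivAt_id t).const_sub x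
      have h2 := ((hρ.differentiable (by simp)) (x - t)).hasFDerivAt.comp t h1
      have h3 := h2.fderiv
      rw [Function.comp_def] at h3
      rw [h3]
      simp
    -- Near `x` the kernel ρ(x - ·) is an admissible test function in Ω. Integrating by parts
    -- therefore shows the derivative of the mollification to be a weighted average of `D`, which
    -- inherits the bound `L`.
    have e1 : fderiv ℝ (mollify n g) x v = ∫ z in Ω, ρ (x - z) • D z v := by
      rw [fderiv_mollify_apply n hgi, ← neg_neg (∫ z in Ω, ρ (x - z) • D z v),
        ← h.byParts _ hψ v, ← integral_neg,
        setIntegral_eq_integral_of_forall_compl_eq_zero]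
      · congr 1
        ext t
        rw [hψd]
        by_cases ht : t ∈ S
        · rw [hg, Set.indicator_of_mem ht]; simp [hρdef]
        · have h0 : fderiv ℝ ρ (x - t) v = 0 := by
            have := hψd t
            rw [image_eq_zero_of_notMem_tsupport (f := fderiv ℝ fun t => ρ (x - t))
              (fun hmem => ht (hsub (hts (tsupport_fderiv_subset ℝ hmem))))] at this
            simpa using this.symm
          rw [h0]; simp
      · intro t ht
        have := (hψ.fderiv_apply v).eq_zero ht
        rw [this]; simp
    rw [e1]
    have hint : Integrable (fun z => ρ (x - z)) volume :=
      hψ.smooth.continuous.integrable_of_hasCompactSupport hψ.compact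
    calc ‖∫ z in Ω, ρ (x - z) • D z v‖ ≤ ∫ z in Ω, ρ (x - z) * (L * ‖v‖) := by
          refine norm_integral_le_of_norm_le (hint.restrict.mul_const _) ?_
          filter_upwards [hL] with z hz
          rw [norm_smul, Real.norm_of_nonneg ((mollifier n).nonneg_normed _)]
          exact mul_le_mul_of_nonneg_left ((D z).le_of_opNorm_le hz v)
            ((mollifier n).nonneg_normed _)
      _ = (∫ z, ρ (x - z)) * (L * ‖v‖) := by
          rw [integral_mul_const, setIntegral_eq_integral_of_forall_compl_eq_zero]
          intro t ht; exact hψ.eq_zero ht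
      _ = L * ‖v‖ := by
          rw [integral_sub_left_eq_self ρ volume x, hρdef, (mollifier n).integral_normed, one_mul]
  have hlim : ∀ x ∈ Metric.ball z₀ r, Tendsto (fun n => mollify n g x) atTop (𝓝 (f x)) := by
    intro x hx
    have hxS : S ∈ 𝓝 x := Metric.closedBall_mem_nhds_of_mem
      (Metric.mem_ball.2 ((Metric.mem_ball.1 hx).trans (by linarith)))
    have hgx : g =ᶠ[𝓝 x] f := by
      filter_upwards [hxS] with y hy
      exact Set.indicator_of_mem hy f
    have hc : ContinuousAt g x :=
      (hf.continuousAt (mem_of_superset hxS hball)).congr hgx.symm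
    refine ContDiffBump.convolution_tendsto_right (g := fun _ => g) (k := fun _ => x)
      tendsto_mollifier_rOut (Eventually.of_forall fun _ => hgi.aestronglyMeasurable) ?_
      tendsto_const_nhds
    rw [← hgx.eq_of_nhds]
    exact hc.tendsto.comp tendsto_snd
  -- The mollifications are `L`-Lipschitz on the convex ball by the mean value inequality, and they
  -- converge pointwise by continuity of `f`; the bound passes to the limit.
  refine LipschitzOnWith.of_dist_le_mul fun x hx y hy => ?_
  refine le_of_tendsto ((hlim x hx).dist (hlim y hy)) ?_
  filter_upwards [(tendsto_one_div_add_atTop_nhds_zero_nat (𝕜 := ℝ)).eventually_lt_const hr]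
    with n hn
  rw [dist_comm, dist_eq_norm, dist_comm, dist_eq_norm]
  exact (convex_ball z₀ r).norm_image_sub_le_of_norm_hasFDerivWithin_le
    (fun z _ => ((contDiff_mollify n hgi).differentiable (by simp) z).hasFDerivAt.hasFDerivWithinAt)
    (hder n hn) hx hy

lemma HasWeakFDeriv.locallyLipschitzOn (hΩ : IsOpen Ω) (hf : ContinuousOn f Ω)
    (h : HasWeakFDeriv Ω f D) {L : ℝ} (hL : ∀ᵐ z ∂(volume.restrict Ω), ‖D z‖ ≤ L) :
    LocallyLipschitzOn Ω f := by
  intro x hx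
  obtain ⟨ε, hε, hsub⟩ := Metric.nhds_basis_closedBall.mem_iff.1 (hΩ.mem_nhds hx)
  refine ⟨L.toNNReal, Metric.ball x (ε / 2), mem_nhdsWithin_of_mem_nhds
    (Metric.ball_mem_nhds _ (by positivity)), ?_⟩
  refine h.lipschitzOnWith hf (hL.mono fun z hz => hz.trans (Real.le_coe_toNNReal L))
    (by positivity) ?_
  rwa [mul_div_cancel₀ _ (two_ne_zero)]

/-- The weak differential of a locally Lipschitz function is its classical differential. -/
lemma HasWeakFDeriv.ae_hasFDerivAt (hΩ : IsOpen Ω) (hf : LocallyLipschitzOn Ω f)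
    (h : HasWeakFDeriv Ω f D) : ∀ᵐ z ∂(volume.restrict Ω), HasFDerivAt f (D z) z := by
  rw [ae_restrict_iff' hΩ.measurableSet]
  change volume {z | ¬ (z ∈ Ω → HasFDerivAt f (D z) z)} = 0
  refine measure_null_of_locally_null _ fun z₀ hz₀ => ?_
  have hz₀Ω : z₀ ∈ Ω := by
    by_contra h0; exact hz₀ fun h1 => absurd h1 h0
  obtain ⟨K, t, ht, hK⟩ := hf hz₀Ω
  rw [hΩ.nhdsWithin_eq hz₀Ω] at ht
  obtain ⟨r, hr, hsub⟩ := Metric.mem_nhds_iff.1 (inter_mem ht (hΩ.mem_nhds hz₀Ω))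
  set B := Metric.ball z₀ r with hB
  have hBo : IsOpen B := Metric.isOpen_ball
  have hBΩ : B ⊆ Ω := fun z hz => (hsub hz).2
  -- A global Lipschitz extension of `f` from a small ball makes Rademacher's theorem and
  -- integration by parts on the whole plane available.
  obtain ⟨g, hgl, hgf⟩ := (hK.mono fun z hz => (hsub hz).1).extend_real
  have hgd : ∀ᵐ z : ℂ, DifferentiableAt ℝ g z := hgl.ae_differentiableAt
  -- Both differentials satisfy the same integration by parts formula against functions supported in
  -- `B`, so they agree a.e. by the fundamental lemma of the calculus of variations.
  have key : ∀ v : ℂ, ∀ᵐ z : ℂ, z ∈ B → D z v - fderiv ℝ g z v = 0 := by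
    intro v
    have hm : Measurable fun z => fderiv ℝ g z v := measurable_fderiv_apply_const ℝ g v
    have hgloc : LocallyIntegrable (fun z => fderiv ℝ g z v) volume := by
      refine (memLp_top_of_bound hm.aestronglyMeasurable (K * ‖v‖)
        (Eventually.of_forall fun z => ?_)).locallyIntegrable le_top
      exact (fderiv ℝ g z).le_of_opNorm_le (norm_fderiv_le_of_lipschitz ℝ hgl) v
    have hDv : LocallyIntegrableOn (fun z => D z v) Ω volume := by
      intro z hz
      obtain ⟨s, hs, hi⟩ := h.locInt_deriv z hz
      exact ⟨s, hs, (ContinuousLinearMap.apply ℝ ℝ v).integrable_comp hi⟩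
    refine hBo.ae_eq_zero_of_integral_contDiff_smul_eq_zero
      ((hDv.mono_set hBΩ).sub (hgloc.locallyIntegrableOn B)) fun ψ hψ hψc hψs => ?_
    have hψt : IsTestFunction Ω ψ := ⟨hψ, hψc, hψs.trans hBΩ⟩
    have hψt' := hψt.fderiv_apply v
    have i1 : Integrable (fun z => ψ z • D z v) volume := by
      have h1 : IntegrableOn (fun z => ψ z • D z v) (tsupport ψ) volume := by
        refine IntegrableOn.continuousOn_smul ?_ hψ.continuous.continuousOn hψc
        exact hDv.integrableOn_compact_subset (hψs.trans hBΩ) hψc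
      exact (integrableOn_iff_integrable_of_support_subset fun z hz =>
        subset_tsupport ψ fun h0 => hz (by simp [h0])).1 h1
    have i2 : Integrable (fun z => ψ z • fderiv ℝ g z v) volume :=
      hgloc.integrable_smul_left_of_hasCompactSupport hψ.continuous hψc
    simp only [smul_sub]
    rw [integral_sub i1 i2, sub_eq_zero]
    obtain ⟨C, hC⟩ := hψ.lipschitzWith_of_hasCompactSupport hψc (by simp)
    have e1 : ∫ z, ψ z • D z v = - ∫ z, fderiv ℝ ψ z v * g z := by
      rw [← setIntegral_eq_integral_of_forall_compl_eq_zero (s := Ω) fun z hz => by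
        rw [hψt.eq_zero hz, zero_smul], ← neg_neg (∫ z in Ω, ψ z • D z v), ← h.byParts ψ hψt v,
        setIntegral_eq_integral_of_forall_compl_eq_zero fun z hz => by
          rw [hψt'.eq_zero hz, zero_smul]]
      congr 2
      ext z
      by_cases hz : z ∈ B
      · rw [hgf hz, smul_eq_mul]
      · have : fderiv ℝ ψ z = 0 := image_eq_zero_of_notMem_tsupport fun hmem =>
          hz (hψs (tsupport_fderiv_subset ℝ hmem))
        simp [this]
    have e2 : ∫ z, ψ z • fderiv ℝ g z v = - ∫ z, fderiv ℝ ψ z v * g z := by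
      have h3 := hgl.integral_lineDeriv_mul_eq (μ := volume) hC hψc v
      rw [← integral_neg]
      calc ∫ z, ψ z • fderiv ℝ g z v = ∫ z, lineDeriv ℝ g z v * ψ z := by
            refine integral_congr_ae ?_
            filter_upwards [hgd] with z hz
            rw [hz.lineDeriv_eq_fderiv, smul_eq_mul, mul_comm]
        _ = ∫ z, lineDeriv ℝ ψ z (-v) * g z := h3
        _ = ∫ z, - (fderiv ℝ ψ z v * g z) := by
            congr 1; ext z
            rw [(hψt.differentiable z).lineDeriv_eq_fderiv, map_neg, neg_mul]
    rw [e1, e2]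
  refine ⟨_, inter_mem_nhdsWithin _ (hBo.mem_nhds (Metric.mem_ball_self hr)), ?_⟩
  refine measure_mono_null ?_ (((key 1).and ((key Complex.I).and hgd)) : _)
  rintro z ⟨hz, hzB⟩ ⟨h1, hI, hd⟩
  refine hz fun _ => ?_
  have hDg : D z = fderiv ℝ g z := by
    ext v
    rw [clm_apply_eq (D z), clm_apply_eq (fderiv ℝ g z), sub_eq_zero.1 (h1 hzB),
      sub_eq_zero.1 (hI hzB)]
  rw [hDg]
  refine hd.hasFDerivAt.congr_of_eventuallyEq ?_
  filter_upwards [hBo.mem_nhds hzB] with y hy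
  exact hgf hy

end WeakToClassical

/-! ### Locally Lipschitz maps of the plane and preservation of area -/

section Maps

variable {Ω Ω' : Set ℂ}

lemma IsTestFunction.integrableOn_smul {E : Type*} [NormedAddCommGroup E] [NormedSpace ℝ E]
    {ψ : ℂ → ℝ} (hψ : IsTestFunction Ω ψ) {f : ℂ → E} (hf : LocallyIntegrableOn f Ω volume) :
    IntegrableOn (fun z => ψ z • f z) Ω volume := by
  have h1 : IntegrableOn (fun z => ψ z • f z) (tsupport ψ) volume :=
    IntegrableOn.continuousOn_smul (hf.integrableOn_compact_subset hψ.support hψ.compact)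
      hψ.smooth.continuous.continuousOn hψ.compact
  exact ((integrableOn_iff_integrable_of_support_subset fun z hz =>
    subset_tsupport ψ fun h0 => hz (by simp only [h0, zero_smul])).1 h1).integrableOn

lemma locallyIntegrableOn_clm_comp {E F : Type*} [NormedAddCommGroup E] [NormedSpace ℝ E]
    [NormedAddCommGroup F] [NormedSpace ℝ F] (ℓ : E →L[ℝ] F) {f : ℂ → E}
    (hf : LocallyIntegrableOn f Ω volume) : LocallyIntegrableOn (fun z => ℓ (f z)) Ω volume := by
  intro z hz
  obtain ⟨s, hs, hi⟩ := hf z hz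
  exact ⟨s, hs, ℓ.integrable_comp hi⟩

lemma HasWeakFDeriv.clm_comp {f : ℂ → ℂ} {D : ℂ → ℂ →L[ℝ] ℂ} (h : HasWeakFDeriv Ω f D)
    (ℓ : ℂ →L[ℝ] ℝ) : HasWeakFDeriv Ω (fun z => ℓ (f z)) (fun z => ℓ.comp (D z)) where
  locInt := locallyIntegrableOn_clm_comp ℓ h.locInt
  locInt_deriv :=
    locallyIntegrableOn_clm_comp (ContinuousLinearMap.compL ℝ ℂ ℂ ℝ ℓ) h.locInt_deriv
  byParts := by
    intro ψ hψ v
    have i1 := (hψ.fderiv_apply v).integrableOn_smul h.locInt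
    have i2 := hψ.integrableOn_smul
      (locallyIntegrableOn_clm_comp (ContinuousLinearMap.apply ℝ ℂ v) h.locInt_deriv)
    have e1 := ℓ.integral_comp_comm i1
    have e2 := ℓ.integral_comp_comm i2
    have e3 := h.byParts ψ hψ v
    simp only [ContinuousLinearMap.apply_apply, map_smul] at e1 e2 ⊢
    simp only [ContinuousLinearMap.comp_apply]
    rw [e1, e2, e3, map_neg]

lemma locallyLipschitzOn_of_re_im {φ : ℂ → ℂ}
    (hre : LocallyLipschitzOn Ω fun z => (φ z).re) (him : LocallyLipschitzOn Ω fun z => (φ z).im) :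
    LocallyLipschitzOn Ω φ := by
  intro x hx
  obtain ⟨K₁, t₁, ht₁, h₁⟩ := hre hx
  obtain ⟨K₂, t₂, ht₂, h₂⟩ := him hx
  refine ⟨K₁ + K₂, t₁ ∩ t₂, inter_mem ht₁ ht₂, LipschitzOnWith.of_dist_le_mul fun a ha b hb => ?_⟩
  have e1 := h₁.dist_le_mul a ha.1 b hb.1
  have e2 := h₂.dist_le_mul a ha.2 b hb.2
  rw [dist_eq_norm] at e1 e2 ⊢
  refine (Complex.norm_le_abs_re_add_abs_im _).trans ?_
  rw [NNReal.coe_add, add_mul]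
  exact add_le_add (by simpa using e1) (by simpa using e2)

lemma hasFDerivAt_of_re_im {φ : ℂ → ℂ} {T : ℂ →L[ℝ] ℂ} {z : ℂ}
    (hre : HasFDerivAt (fun z => (φ z).re) (Complex.reCLM.comp T) z)
    (him : HasFDerivAt (fun z => (φ z).im) (Complex.imCLM.comp T) z) : HasFDerivAt φ T z := by
  rw [← Complex.equivRealProdCLM.comp_hasFDerivAt_iff]
  exact hre.prodMk him

/-- A continuous map with bounded weak differential is locally Lipschitz and its weak differential
is its classical differential almost everywhere. -/
lemma HasWeakFDeriv.complex_regularity (hΩ : IsOpen Ω) {φ : ℂ → ℂ} {D : ℂ → ℂ →L[ℝ] ℂ}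
    (hφ : ContinuousOn φ Ω) (h : HasWeakFDeriv Ω φ D) {L : ℝ}
    (hL : ∀ᵐ z ∂(volume.restrict Ω), ‖D z‖ ≤ L) :
    LocallyLipschitzOn Ω φ ∧ ∀ᵐ z ∂(volume.restrict Ω), HasFDerivAt φ (D z) z := by
  have bd : ∀ ℓ : ℂ →L[ℝ] ℝ, ∀ᵐ z ∂(volume.restrict Ω), ‖ℓ.comp (D z)‖ ≤ ‖ℓ‖ * L := fun ℓ =>
    hL.mono fun z hz => (ℓ.opNorm_comp_le _).trans (mul_le_mul_of_nonneg_left hz (norm_nonneg _))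
  have l1 := (h.clm_comp Complex.reCLM).locallyLipschitzOn hΩ
    (Complex.reCLM.continuous.comp_continuousOn hφ) (bd _)
  have l2 := (h.clm_comp Complex.imCLM).locallyLipschitzOn hΩ
    (Complex.imCLM.continuous.comp_continuousOn hφ) (bd _)
  refine ⟨locallyLipschitzOn_of_re_im l1 l2, ?_⟩
  filter_upwards [(h.clm_comp Complex.reCLM).ae_hasFDerivAt hΩ l1,
    (h.clm_comp Complex.imCLM).ae_hasFDerivAt hΩ l2] with z h1 h2
  exact hasFDerivAt_of_re_im h1 h2

/-- Two-dimensional Hausdorff measure is a Haar measure on ℂ, hence has the same null sets as area,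
and a Lipschitz map increases it by at most a constant factor. -/
lemma volume_image_eq_zero_of_lipschitzOnWith {K : NNReal} {φ : ℂ → ℂ} {s : Set ℂ}
    (h : LipschitzOnWith K φ s) (hs : volume s = 0) : volume (φ '' s) = 0 := by
  obtain ⟨d, hd⟩ : ∃ d : ℝ, d = (Module.finrank ℝ ℂ : ℕ) := ⟨_, rfl⟩
  have : (Measure.hausdorffMeasure d : Measure ℂ).IsAddHaarMeasure :=
    hd ▸ isAddHaarMeasure_hausdorffMeasure
  have h1 : Measure.hausdorffMeasure d s = 0 :=
    Measure.absolutelyContinuous_isAddHaarMeasure _ volume hs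
  have h2 := h.hausdorffMeasure_image_le (d := d) (hd ▸ Nat.cast_nonneg _)
  rw [h1, mul_zero] at h2
  exact Measure.absolutelyContinuous_isAddHaarMeasure volume (Measure.hausdorffMeasure d)
    (le_antisymm h2 bot_le)

lemma volume_image_eq_zero_of_locallyLipschitzOn {φ : ℂ → ℂ} {s : Set ℂ}
    (h : LocallyLipschitzOn s φ) (hs : volume s = 0) : volume (φ '' s) = 0 := by
  have h' : ∀ x ∈ s, ∃ K, ∃ t ∈ 𝓝[s] x, LipschitzOnWith K φ t := fun x hx => h hx
  choose! K t ht hK using h'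
  obtain ⟨c, hcs, hc, hcov⟩ := TopologicalSpace.countable_cover_nhdsWithin ht
  have h1 : φ '' s ⊆ ⋃ x ∈ c, φ '' (s ∩ t x) := by
    rintro _ ⟨y, hy, rfl⟩
    obtain ⟨x, hx, hyx⟩ := Set.mem_iUnion₂.1 (hcov hy)
    exact Set.mem_iUnion₂.2 ⟨x, hx, y, ⟨hy, hyx⟩, rfl⟩
  refine measure_mono_null h1 ((measure_biUnion_null_iff hc).2 fun x hx => ?_)
  exact volume_image_eq_zero_of_lipschitzOnWith ((hK x (hcs hx)).mono Set.inter_subset_right)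
    (measure_mono_null Set.inter_subset_left hs)

/-- A locally Lipschitz homeomorphism with Jacobian one preserves the area. -/
lemma map_volume_restrict_eq (hΩ : IsOpen Ω) {φ : ℂ → ℂ} (hmaps : φ '' Ω = Ω')
    (hinj : Set.InjOn φ Ω) (hlip : LocallyLipschitzOn Ω φ) {T : ℂ → ℂ →L[ℝ] ℂ}
    (hT : ∀ᵐ z ∂(volume.restrict Ω), HasFDerivAt φ (T z) z)
    (hdet : ∀ᵐ z ∂(volume.restrict Ω), (T z).det = 1) :
    Measure.map φ (volume.restrict Ω) = volume.restrict Ω' := by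
  have hφm : AEMeasurable φ (volume.restrict Ω) :=
    hlip.continuousOn.aemeasurable hΩ.measurableSet
  -- On the complement of `N` the area formula applies with Jacobian one; the image of the null set
  -- `N` is null because φ is locally Lipschitz.
  set N := {z | ¬ (z ∈ Ω → (HasFDerivAt φ (T z) z ∧ (T z).det = 1))} with hN
  have hN0 : volume N = 0 := (ae_restrict_iff' hΩ.measurableSet).1 (hT.and hdet)
  ext E hE
  rw [Measure.map_apply_of_aemeasurable hφm hE, Measure.restrict_apply' hΩ.measurableSet,
    Measure.restrict_apply hE]
  set s := φ ⁻¹' E ∩ Ω with hs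
  have hsm : NullMeasurableSet s volume :=
    (nullMeasurableSet_restrict hΩ.nullMeasurableSet).1 (hφm.nullMeasurable hE)
  have himg : φ '' s = E ∩ Ω' := by rw [hs, Set.image_preimage_inter, hmaps]
  have hgood : ∀ z ∈ s \ N, HasFDerivAt φ (T z) z ∧ (T z).det = 1 := fun z hz => by
    by_contra h0; exact hz.2 fun h1 => h0 (h1 hz.1.2)
  have h1 := lintegral_abs_det_fderiv_eq_addHaar_image₀ volume
    (hsm.diff (NullMeasurableSet.of_null hN0))
    (fun z hz => (hgood z hz).1.hasFDerivWithinAt)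
    (hinj.mono fun z hz => hz.1.2)
  have h2 : ∫⁻ z in s \ N, ENNReal.ofReal |(T z).det| = volume (s \ N) := by
    rw [lintegral_congr_ae (g := fun _ => 1)
      ((ae_restrict_iff'₀ (hsm.diff (NullMeasurableSet.of_null hN0))).2
        (Eventually.of_forall fun z hz => by simp [(hgood z hz).2]))]
    simp
  have h3 : volume (φ '' (s ∩ N)) = 0 :=
    volume_image_eq_zero_of_locallyLipschitzOn (hlip.mono fun z hz => hz.1.2)
      (measure_mono_null Set.inter_subset_right hN0)
  have h4 : volume (φ '' s) = volume (φ '' (s \ N)) := by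
    refine le_antisymm ?_ (measure_mono (Set.image_mono Set.sdiff_subset))
    calc volume (φ '' s) ≤ volume (φ '' (s \ N) ∪ φ '' (s ∩ N)) := by
          rw [← Set.image_union, Set.sdiff_union_inter]
      _ ≤ volume (φ '' (s \ N)) + volume (φ '' (s ∩ N)) := measure_union_le _ _
      _ = volume (φ '' (s \ N)) := by rw [h3, add_zero]
  rw [← himg, h4, ← h1, h2, measure_sdiff_null hN0]

end Maps

/-! ### Composition with area preserving homeomorphisms -/

section Composition

/-- Compactness gives a constant on a large ball. If one point lies outside it, either both values
vanish or the points are at distance at least 1, where the sup bound `M` serves as a Lipschitz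
constant. -/
lemma exists_lipschitzWith_of_locallyLipschitzOn {Ω : Set ℂ} (hΩ : IsOpen Ω) {w : ℂ → ℝ}
    (hw : LocallyLipschitzOn Ω w) (hc : HasCompactSupport w) (hs : tsupport w ⊆ Ω) :
    ∃ C, LipschitzWith C w := by
  have hloc : LocallyLipschitz w := by
    intro x
    by_cases hx : x ∈ Ω
    · obtain ⟨K, t, ht, hK⟩ := hw hx
      exact ⟨K, t, hΩ.nhdsWithin_eq hx ▸ ht, hK⟩
    · have hx' : x ∈ (tsupport w)ᶜ := fun h => hx (hs h)
      refine ⟨0, _, (isClosed_tsupport w).isOpen_compl.mem_nhds hx',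
        LipschitzOnWith.of_dist_le_mul fun a ha b hb => ?_⟩
      rw [image_eq_zero_of_notMem_tsupport ha, image_eq_zero_of_notMem_tsupport hb]
      simp
  obtain ⟨R, hR⟩ := hc.isBounded.subset_closedBall (0 : ℂ)
  obtain ⟨M, hM⟩ := hloc.continuous.bounded_above_of_compact_support hc
  obtain ⟨K, hK⟩ := (hloc.locallyLipschitzOn (s := Metric.closedBall (0 : ℂ)
    (R + 1))).exists_lipschitzOnWith_of_compact (isCompact_closedBall _ _)
  have hM0 : 0 ≤ M := (norm_nonneg _).trans (hM 0)
  have hzero : ∀ x, x ∉ Metric.closedBall (0 : ℂ) R → w x = 0 := fun x hx =>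
    image_eq_zero_of_notMem_tsupport fun h => hx (hR h)
  have far : ∀ x y, x ∉ Metric.closedBall (0 : ℂ) (R + 1) → dist (w x) (w y) ≤ M * dist x y := by
    intro x y hx
    have hx0 : w x = 0 := hzero x fun h => hx (Metric.closedBall_subset_closedBall (by linarith) h)
    by_cases hy : y ∈ Metric.closedBall (0 : ℂ) R
    · have h1 : 1 ≤ dist x y := by
        rw [mem_closedBall_zero_iff] at hy hx
        rw [dist_eq_norm]
        have := norm_sub_norm_le x y
        linarith
      rw [hx0, dist_zero_left]
      exact (hM y).trans (le_mul_of_one_le_right hM0 h1)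
    · rw [hx0, hzero y hy, dist_self]; positivity
  refine ⟨max K M.toNNReal, LipschitzWith.of_dist_le_mul fun x y => ?_⟩
  have hmax : M ≤ ((max K M.toNNReal : NNReal) : ℝ) :=
    (Real.le_coe_toNNReal M).trans (NNReal.coe_le_coe.2 (le_max_right _ _))
  by_cases hx : x ∈ Metric.closedBall (0 : ℂ) (R + 1)
  · by_cases hy : y ∈ Metric.closedBall (0 : ℂ) (R + 1)
    · refine (hK.dist_le_mul x hx y hy).trans ?_
      gcongr
      exact le_max_left _ _
    · rw [dist_comm, dist_comm x y]
      exact (far y x hy).trans (mul_le_mul_of_nonneg_right hmax dist_nonneg)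
  · exact (far x y hx).trans (mul_le_mul_of_nonneg_right hmax dist_nonneg)

/-- A locally Lipschitz homeomorphism that preserves the area, with a bounded differential `D`. -/
structure IsBoundedPreserving (e : OpenPartialHomeomorph ℂ ℂ) (D : ℂ → ℂ →L[ℝ] ℂ) : Prop where
  lipschitz : LocallyLipschitzOn e.source e
  aestronglyMeasurable : AEStronglyMeasurable D (volume.restrict e.source)
  bounded : ∃ L : ℝ, ∀ᵐ z ∂(volume.restrict e.source), ‖D z‖ ≤ L
  hasFDerivAt : ∀ᵐ z ∂(volume.restrict e.source), HasFDerivAt e (D z) z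
  map_eq : Measure.map e (volume.restrict e.source) = volume.restrict e.target

variable {e : OpenPartialHomeomorph ℂ ℂ} {D : ℂ → ℂ →L[ℝ] ℂ}

lemma IsBoundedPreserving.aemeasurable (_h : IsBoundedPreserving e D) :
    AEMeasurable e (volume.restrict e.source) :=
  e.continuousOn.aemeasurable e.open_source.measurableSet

lemma IsBoundedPreserving.ae_comp (h : IsBoundedPreserving e D) {p : ℂ → Prop}
    (hp : ∀ᵐ w ∂(volume.restrict e.target), p w) :
    ∀ᵐ z ∂(volume.restrict e.source), p (e z) :=
  ae_of_ae_map h.aemeasurable (h.map_eq ▸ hp)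

lemma IsBoundedPreserving.volume_eq (h : IsBoundedPreserving e D) :
    volume e.source = volume e.target := by
  have h1 := congrArg (fun m => m Set.univ) h.map_eq
  simp only [Measure.map_apply_of_aemeasurable h.aemeasurable MeasurableSet.univ] at h1
  simpa using h1

/-- The pull-back of a test function, extended by zero. -/
def pullback (e : OpenPartialHomeomorph ℂ ℂ) (u : ℂ → ℝ) : ℂ → ℝ :=
  e.source.indicator (fun z => u (e z))

lemma pullback_eqOn (u : ℂ → ℝ) : Set.EqOn (pullback e u) (fun z => u (e z)) e.source :=
  fun _ hz => Set.indicator_of_mem hz _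

lemma hasCompactSupport_pullback {u : ℂ → ℝ} (hu : IsTestFunction e.target u) :
    HasCompactSupport (pullback e u) ∧ tsupport (pullback e u) ⊆ e.source := by
  set K := e.symm '' tsupport u
  have hK : IsCompact K := hu.compact.image_of_continuousOn (e.symm.continuousOn.mono hu.support)
  have hKs : K ⊆ e.source := by
    rintro _ ⟨w, hw, rfl⟩
    exact e.map_target (hu.support hw)
  have h0 : ∀ z ∉ K, pullback e u z = 0 := by
    intro z hz
    by_cases hzs : z ∈ e.source
    · rw [pullback_eqOn u hzs]
      refine image_eq_zero_of_notMem_tsupport fun h => hz ⟨e z, h, e.left_inv hzs⟩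
    · exact Set.indicator_of_notMem hzs _
  refine ⟨HasCompactSupport.intro hK h0, (closure_minimal (fun z hz => ?_) hK.isClosed).trans hKs⟩
  by_contra hzK
  exact hz (h0 z hzK)

lemma IsBoundedPreserving.locallyLipschitzOn_pullback (h : IsBoundedPreserving e D) {u : ℂ → ℝ}
    (hu : IsTestFunction e.target u) : LocallyLipschitzOn e.source (pullback e u) := by
  obtain ⟨C, hC⟩ := hu.smooth.lipschitzWith_of_hasCompactSupport hu.compact (by simp)
  intro x hx
  obtain ⟨K, t, ht, hK⟩ := h.lipschitz hx
  refine ⟨C * K, t ∩ e.source, inter_mem ht self_mem_nhdsWithin,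
    LipschitzOnWith.of_dist_le_mul fun a ha b hb => ?_⟩
  rw [pullback_eqOn u ha.2, pullback_eqOn u hb.2]
  exact ((hC.comp_lipschitzOnWith hK).dist_le_mul a ha.1 b hb.1)

lemma IsBoundedPreserving.hasFDerivAt_pullback (h : IsBoundedPreserving e D) {u : ℂ → ℝ}
    (hu : IsTestFunction e.target u) : ∀ᵐ z ∂(volume.restrict e.source),
      HasFDerivAt (pullback e u) ((fderiv ℝ u (e z)).comp (D z)) z := by
  filter_upwards [h.hasFDerivAt, ae_restrict_mem e.open_source.measurableSet] with z hz hzs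
  refine ((hu.differentiable (e z)).hasFDerivAt.comp z hz).congr_of_eventuallyEq ?_
  filter_upwards [e.open_source.mem_nhds hzs] with y hy
  exact pullback_eqOn u hy

/-- The pull-back need not be smooth. It is Lipschitz with compact support, and its differential is
given a.e. by the classical chain rule. -/
lemma IsBoundedPreserving.isH10Pair_test (h : IsBoundedPreserving e D) {u : ℂ → ℝ}
    (hu : IsTestFunction e.target u) :
    IsH10Pair e.source (fun z => u (e z)) (fun z => (fderiv ℝ u (e z)).comp (D z)) := by
  obtain ⟨hc, hs⟩ := hasCompactSupport_pullback hu
  obtain ⟨C, hC⟩ := exists_lipschitzWith_of_locallyLipschitzOn e.open_source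
    (h.locallyLipschitzOn_pullback hu) hc hs
  refine (isH10Pair_of_lipschitz e.open_source hC hc hs).congr ?_ ?_
  · filter_upwards [ae_restrict_mem e.open_source.measurableSet] with z hz
    exact pullback_eqOn u hz
  · filter_upwards [h.hasFDerivAt_pullback hu] with z hz
    exact hz.fderiv

lemma aestronglyMeasurable_clm_comp {α : Type*} [MeasurableSpace α] {μ : Measure α}
    {G : α → ℂ →L[ℝ] ℝ} {T : α → ℂ →L[ℝ] ℂ} (hG : AEStronglyMeasurable G μ)
    (hT : AEStronglyMeasurable T μ) : AEStronglyMeasurable (fun z => (G z).comp (T z)) μ :=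
  (ContinuousLinearMap.compL ℝ ℂ ℂ ℝ).aestronglyMeasurable_comp₂ hG hT

/-- Composition with an area preserving homeomorphism with bounded differential maps `W₀^{1,2}`
into `W₀^{1,2}`. -/
lemma IsBoundedPreserving.isH10Pair_comp (h : IsBoundedPreserving e D) {g : ℂ → ℝ}
    {G : ℂ → ℂ →L[ℝ] ℝ} (hg : IsH10Pair e.target g G) :
    IsH10Pair e.source (fun z => g (e z)) (fun z => (G (e z)).comp (D z)) := by
  obtain ⟨L, hL⟩ := h.bounded
  have hg1 := h.map_eq ▸ hg.memLp
  have hG1 := h.map_eq ▸ hg.memLp_deriv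
  have hGe : MemLp (fun z => G (e z)) 2 (volume.restrict e.source) :=
    (memLp_map_measure_iff hG1.1 h.aemeasurable).1 hG1
  have hbd : ∀ H : ℂ → ℂ →L[ℝ] ℝ, ∀ᵐ z ∂(volume.restrict e.source),
      ‖(H (e z)).comp (D z)‖ ≤ L * ‖H (e z)‖ := fun H => by
    filter_upwards [hL] with z hz
    rw [mul_comm]
    exact ((H (e z)).opNorm_comp_le _).trans (mul_le_mul_of_nonneg_left hz (norm_nonneg _))
  have hm := aestronglyMeasurable_clm_comp hGe.1 h.aestronglyMeasurable
  refine IsH10Pair.of_approx ((memLp_map_measure_iff hg1.1 h.aemeasurable).1 hg1)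
    (hGe.of_le_mul hm (hbd G)) fun ε hε => ?_
  -- The denominator dominates both factors that occur: 1 for the functions, by preservation of
  -- measure, and `L` for the differentials, by the bound on `D`.
  obtain ⟨u, hu, h1, h2⟩ := hg.approx (ε / (ENNReal.ofReal L + 1))
    (ENNReal.div_ne_zero.2 ⟨hε, by simp⟩)
  have k1 : (1 : ℝ≥0∞) * (ε / (ENNReal.ofReal L + 1)) ≤ ε := by
    calc (1 : ℝ≥0∞) * (ε / (ENNReal.ofReal L + 1))
        ≤ (ENNReal.ofReal L + 1) * (ε / (ENNReal.ofReal L + 1)) := by gcongr; simp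
      _ ≤ ε := ENNReal.mul_div_le
  have k2 : ENNReal.ofReal L * (ε / (ENNReal.ofReal L + 1)) ≤ ε := by
    calc ENNReal.ofReal L * (ε / (ENNReal.ofReal L + 1))
        ≤ (ENNReal.ofReal L + 1) * (ε / (ENNReal.ofReal L + 1)) := by gcongr; simp
      _ ≤ ε := ENNReal.mul_div_le
  refine ⟨_, _, h.isH10Pair_test hu, ?_, ?_⟩
  · have h3 : AEStronglyMeasurable (g - u) (Measure.map e (volume.restrict e.source)) := by
      rw [h.map_eq]; exact hg.memLp.1.sub (hu.memLp 2 _).1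
    rw [← h.map_eq, eLpNorm_map_measure h3 h.aemeasurable] at h1
    rw [one_mul] at k1
    exact h1.trans k1
  · have h3 : AEStronglyMeasurable (G - fderiv ℝ u) (Measure.map e (volume.restrict e.source)) := by
      rw [h.map_eq]; exact hg.memLp_deriv.1.sub (hu.memLp_fderiv 2 _).1
    rw [← h.map_eq, eLpNorm_map_measure h3 h.aemeasurable] at h2
    refine (eLpNorm_le_mul_eLpNorm_of_ae_le_mul (c := L)
      (g := fun z => (G - fderiv ℝ u) (e z)) ?_ 2).trans ((mul_le_mul_right h2 _).trans k2)
    filter_upwards [hbd (G - fderiv ℝ u)] with z hz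
    exact hz

end Composition

/-! ### Regularity of the inverse map -/

section Inverse

variable {Ω : Set ℂ}

lemma enorm_integral_clm_le {α : Type*} [MeasurableSpace α] {μ : Measure α}
    {a : α → ℂ →L[ℝ] ℝ} {b : α → ℂ} (ha : AEStronglyMeasurable a μ)
    (hb : AEStronglyMeasurable b μ) :
    ‖∫ x, a x (b x) ∂μ‖ₑ ≤ eLpNorm a 2 μ * eLpNorm b 2 μ := by
  calc ‖∫ x, a x (b x) ∂μ‖ₑ ≤ eLpNorm (fun x => a x (b x)) 1 μ := by
        rw [eLpNorm_one_eq_lintegral_enorm]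
        exact enorm_integral_le_lintegral_enorm _
    _ ≤ (1 : NNReal) * eLpNorm a 2 μ * eLpNorm b 2 μ :=
        eLpNorm_le_eLpNorm_mul_eLpNorm_of_nnnorm ha hb (fun L v => L v) 1
          (Eventually.of_forall fun x => by
            rw [one_mul]; exact (a x).le_opNNNorm (b x))
    _ = _ := by simp

lemma integrable_clm_apply {α : Type*} [MeasurableSpace α] {μ : Measure α}
    {a : α → ℂ →L[ℝ] ℝ} {b : α → ℂ} (ha : MemLp a 2 μ)
    (hb : MemLp b 2 μ) : Integrable (fun x => a x (b x)) μ := by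
  have hm : AEStronglyMeasurable (fun x => a x (b x)) μ :=
    (ContinuousLinearMap.id ℝ (ℂ →L[ℝ] ℝ)).aestronglyMeasurable_comp₂ ha.1 hb.1
  refine (integrable_smul_of_memLp ha.norm hb.norm).mono hm (Eventually.of_forall fun x => ?_)
  rw [smul_eq_mul, norm_mul, norm_norm, norm_norm]
  exact (a x).le_opNorm (b x)

/-- With σ = v.re Im - v.im Re this is the 2×2 determinant of `L` and σ ∘ T. For differentials of
functions it is therefore a Jacobian, hence a null Lagrangian. -/
lemma adj_clm_apply (L : ℂ →L[ℝ] ℝ) (T : ℂ →L[ℝ] ℂ) (v : ℂ) :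
    L (adj T v) = L 1 * (v.re • Complex.imCLM - v.im • Complex.reCLM) (T Complex.I)
      - L Complex.I * (v.re • Complex.imCLM - v.im • Complex.reCLM) (T 1) := by
  rw [clm_apply_eq, adj_apply]
  simp
  ring

/-- The two dimensional null Lagrangian identity, for a smooth function. -/
lemma IsTestFunction.integral_adj_eq_zero {u : ℂ → ℝ} (hu : IsTestFunction Ω u) {φ : ℂ → ℂ}
    {D : ℂ → ℂ →L[ℝ] ℂ} (h : HasWeakFDeriv Ω φ D) (v : ℂ) :
    ∫ z in Ω, fderiv ℝ u z (adj (D z) v) = 0 := by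
  set σ : ℂ →L[ℝ] ℝ := v.re • Complex.imCLM - v.im • Complex.reCLM with hσ
  have hw := h.clm_comp σ
  have h1 := hw.byParts _ (hu.fderiv_apply 1) Complex.I
  have h2 := hw.byParts _ (hu.fderiv_apply Complex.I) 1
  -- The integral is ∫ (u_x ∂_y(σφ) - u_y ∂_x(σφ)). Moving the weak derivatives onto `u` leaves the
  -- difference of its mixed second derivatives.
  have hsymm : ∀ z, fderiv ℝ (fun z => fderiv ℝ u z 1) z Complex.I
      = fderiv ℝ (fun z => fderiv ℝ u z Complex.I) z 1 := by
    intro z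
    have hd : DifferentiableAt ℝ (fderiv ℝ u) z := hu.contDiff_fderiv.differentiable (by simp) z
    have hc : ∀ a b : ℂ, fderiv ℝ (fun z => fderiv ℝ u z a) z b = fderiv ℝ (fderiv ℝ u) z b a := by
      intro a b
      have := (hd.hasFDerivAt.clm_apply (hasFDerivAt_const a z)).fderiv
      rw [this]; simp
    rw [hc, hc]
    exact (hu.smooth.contDiffAt.isSymmSndFDerivAt
      (by simpa using (WithTop.coe_le_coe.2 le_top : ((2 : ℕ∞) : WithTop ℕ∞) ≤ ((⊤ : ℕ∞) : WithTop ℕ∞)))).eq _ _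
  simp only [hsymm] at h1
  rw [h1, neg_inj] at h2
  have hi : ∀ a b : ℂ, IntegrableOn (fun z => fderiv ℝ u z a • (σ.comp (D z)) b) Ω volume :=
    fun a b => (hu.fderiv_apply a).integrableOn_smul
      (locallyIntegrableOn_clm_comp (ContinuousLinearMap.apply ℝ ℝ b) hw.locInt_deriv)
  simp only [adj_clm_apply]
  rw [← hσ]
  have h3 := integral_sub (hi 1 Complex.I) (hi Complex.I 1)
  simp only [smul_eq_mul, ContinuousLinearMap.comp_apply] at h2 h3
  rw [h3, h2, sub_self]

/-- The field adj(D) v is bounded, hence in L² on a set of finite area, so the identity for test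
functions extends by density. -/
lemma IsH10Pair.integral_adj_eq_zero {k : ℂ → ℝ} {k' : ℂ → ℂ →L[ℝ] ℝ} (hk : IsH10Pair Ω k k')
    (hΩ : volume Ω ≠ ⊤) {φ : ℂ → ℂ} {D : ℂ → ℂ →L[ℝ] ℂ} (h : HasWeakFDeriv Ω φ D) {L : ℝ}
    (hL : ∀ᵐ z ∂(volume.restrict Ω), ‖D z‖ ≤ L) (v : ℂ) :
    ∫ z in Ω, k' z (adj (D z) v) = 0 := by
  have : IsFiniteMeasure (volume.restrict Ω) := ⟨by simpa using hΩ.lt_top⟩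
  have hm : AEStronglyMeasurable (fun z => adj (D z) v) (volume.restrict Ω) :=
    (continuous_adj.clm_apply continuous_const).comp_aestronglyMeasurable
      h.locInt_deriv.aestronglyMeasurable
  have hG : MemLp (fun z => adj (D z) v) 2 (volume.restrict Ω) := by
    refine MemLp.of_bound hm (3 * L * ‖v‖) ?_
    filter_upwards [hL] with z hz
    refine (adj (D z)).le_of_opNorm_le ((norm_adj_le _).trans ?_) v
    gcongr
  rw [← enorm_eq_zero]
  refine eq_zero_of_le_const_mul hG.2.ne fun ε hε => ?_
  obtain ⟨u, hu, -, h2⟩ := hk.approx ε hε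
  have e1 : ∫ z in Ω, k' z (adj (D z) v)
      = ∫ z in Ω, (k' - fderiv ℝ u) z (adj (D z) v) := by
    have h3 := integral_sub (integrable_clm_apply hk.memLp_deriv hG)
      (integrable_clm_apply (hu.memLp_fderiv 2 Ω) hG)
    rw [hu.integral_adj_eq_zero h v, sub_zero] at h3
    rw [← h3]
    rfl
  rw [e1, mul_comm]
  exact (enorm_integral_clm_le (hk.memLp_deriv.1.sub (hu.memLp_fderiv 2 Ω).1) hG.1).trans
    (mul_le_mul_left h2 _)

lemma locallyLipschitzOn_mul_clm {w : ℂ → ℝ} {C : NNReal} (hw : LipschitzWith C w)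
    (hc : HasCompactSupport w) (ℓ : ℂ →L[ℝ] ℝ) (S : Set ℂ) :
    LocallyLipschitzOn S (fun z => w z * ℓ z) := by
  obtain ⟨M, hM⟩ := hw.continuous.bounded_above_of_compact_support hc
  have hM0 : 0 ≤ M := (norm_nonneg _).trans (hM 0)
  intro x _
  refine ⟨(M * ‖ℓ‖ + C * (‖ℓ‖ * (‖x‖ + 1))).toNNReal, Metric.ball x 1,
    mem_nhdsWithin_of_mem_nhds (Metric.ball_mem_nhds _ one_pos),
    LipschitzOnWith.of_dist_le_mul fun a _ b hb => ?_⟩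
  rw [Real.coe_toNNReal _ (by positivity), dist_eq_norm]
  have h1 : w a * ℓ a - w b * ℓ b = w a * ℓ (a - b) + (w a - w b) * ℓ b := by
    rw [map_sub]; ring
  have hb' : ‖b‖ ≤ ‖x‖ + 1 := by
    have h3 := norm_le_norm_add_norm_sub' b x
    rw [← dist_eq_norm] at h3
    exact h3.trans (by linarith [Metric.mem_ball.1 hb])
  have h2 := hw.dist_le_mul a b
  rw [dist_eq_norm] at h2
  rw [h1, add_mul]
  refine (norm_add_le _ _).trans (add_le_add ?_ ?_)
  · rw [norm_mul, dist_eq_norm, mul_assoc]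
    exact mul_le_mul (hM a) (ℓ.le_opNorm _) (norm_nonneg _) hM0
  · rw [norm_mul, mul_right_comm]
    refine mul_le_mul h2 ((ℓ.le_opNorm b).trans ?_) (norm_nonneg _) (by positivity)
    gcongr

variable {e : OpenPartialHomeomorph ℂ ℂ} {D : ℂ → ℂ →L[ℝ] ℂ}

lemma IsBoundedPreserving.map_symm (h : IsBoundedPreserving e D) :
    Measure.map e.symm (volume.restrict e.target) = volume.restrict e.source := by
  have hs : AEMeasurable e.symm (volume.restrict e.target) :=
    e.symm.continuousOn.aemeasurable e.open_target.measurableSet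
  rw [← h.map_eq] at hs ⊢
  rw [AEMeasurable.map_map_of_aemeasurable hs h.aemeasurable]
  have : e.symm ∘ e =ᵐ[volume.restrict e.source] id := by
    filter_upwards [ae_restrict_mem e.open_source.measurableSet] with z hz
    exact e.left_inv hz
  rw [Measure.map_congr this, Measure.map_id]

lemma IsBoundedPreserving.symm_integral_eq (h : IsBoundedPreserving e D) {E : Type*}
    [NormedAddCommGroup E] [NormedSpace ℝ E] {F : ℂ → E}
    (hF : AEStronglyMeasurable F (volume.restrict e.target)) :
    ∫ w in e.target, F w = ∫ z in e.source, F (e z) := by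
  rw [← h.map_eq] at hF ⊢
  exact integral_map h.aemeasurable hF

/-- The inverse of an area preserving homeomorphism with bounded differential of determinant one
is weakly differentiable. -/
lemma IsBoundedPreserving.hasWeakFDeriv_symm (h : IsBoundedPreserving e D)
    (hw : HasWeakFDeriv e.source e D) (hfin : volume e.source ≠ ⊤)
    (hdet : ∀ᵐ z ∂(volume.restrict e.source), (D z).det = 1) (ℓ : ℂ →L[ℝ] ℝ) :
    HasWeakFDeriv e.target (fun w => ℓ (e.symm w))
      (fun w => ℓ.comp (adj (D (e.symm w)))) := by
  obtain ⟨L, hL⟩ := h.bounded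
  have hfin' : volume e.target ≠ ⊤ := h.volume_eq ▸ hfin
  have : IsFiniteMeasure (volume.restrict e.target) := ⟨by simpa using hfin'.lt_top⟩
  have hs : AEMeasurable e.symm (volume.restrict e.target) :=
    e.symm.continuousOn.aemeasurable e.open_target.measurableSet
  have hcont : ContinuousOn (fun w => ℓ (e.symm w)) e.target :=
    ℓ.continuous.comp_continuousOn e.symm.continuousOn
  have hD' : AEStronglyMeasurable (fun w => D (e.symm w)) (volume.restrict e.target) :=
    (h.map_symm ▸ h.aestronglyMeasurable).comp_aemeasurable hs
  have hA' : AEStronglyMeasurable (fun w => ℓ.comp (adj (D (e.symm w))))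
      (volume.restrict e.target) :=
    ((ContinuousLinearMap.compL ℝ ℂ ℂ ℝ ℓ).continuous.comp continuous_adj).comp_aestronglyMeasurable
      hD'
  have hb' : ∀ᵐ w ∂(volume.restrict e.target), ‖ℓ.comp (adj (D (e.symm w)))‖ ≤ ‖ℓ‖ * (3 * L) := by
    have h1 : ∀ᵐ w ∂(volume.restrict e.target), ‖D (e.symm w)‖ ≤ L :=
      ae_of_ae_map hs (h.map_symm ▸ hL)
    filter_upwards [h1] with w hw
    refine (ℓ.opNorm_comp_le _).trans (mul_le_mul_of_nonneg_left ?_ (norm_nonneg _))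
    exact (norm_adj_le _).trans (by linarith)
  refine ⟨hcont.locallyIntegrableOn e.open_target.measurableSet,
    IntegrableOn.locallyIntegrableOn (Integrable.of_bound hA' _ hb'), fun ψ hψ v => ?_⟩
  have hψ' := hψ.fderiv_apply v
  -- Both sides are moved to the source, where φ⁻¹ becomes the identity and only the known
  -- differential `D` occurs.
  rw [h.symm_integral_eq, h.symm_integral_eq]
  rotate_left
  · exact hψ.smooth.continuous.aestronglyMeasurable.fun_smul
      ((ContinuousLinearMap.apply ℝ ℝ v).continuous.comp_aestronglyMeasurable hA')
  · exact hψ'.smooth.continuous.aestronglyMeasurable.fun_smul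
      (hcont.aestronglyMeasurable e.open_target.measurableSet)
  obtain ⟨hc, hsub⟩ := hasCompactSupport_pullback hψ
  obtain ⟨C, hC⟩ := exists_lipschitzWith_of_locallyLipschitzOn e.open_source
    (h.locallyLipschitzOn_pullback hψ) hc hsub
  -- Since D adj(D) = 1, the differential of (ψ ∘ e) ℓ applied to adj(D) v is exactly the sum of the
  -- two transported integrands. The null Lagrangian identity says that this sum integrates to zero.
  obtain ⟨k, hk⟩ : ∃ k : ℂ → ℝ, k = fun z => pullback e ψ z * ℓ z := ⟨_, rfl⟩
  have hkc : HasCompactSupport k := hk ▸ hc.mul_right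
  have hks : tsupport k ⊆ e.source := hk ▸ (tsupport_mul_subset_left).trans hsub
  obtain ⟨C', hC'⟩ := exists_lipschitzWith_of_locallyLipschitzOn e.open_source
    (hk ▸ locallyLipschitzOn_mul_clm hC hc ℓ e.source) hkc hks
  have key := (isH10Pair_of_lipschitz e.open_source hC' hkc hks).integral_adj_eq_zero
    hfin hw hL v
  have hid : ∀ᵐ z ∂(volume.restrict e.source), fderiv ℝ k z (adj (D z) v)
      = fderiv ℝ ψ (e z) v • ℓ (e.symm (e z)) + ψ (e z) • (ℓ.comp (adj (D (e.symm (e z))))) v := by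
    filter_upwards [h.hasFDerivAt_pullback hψ, hdet, ae_restrict_mem e.open_source.measurableSet]
      with z hz hd hzs
    have h1 := (hz.mul ℓ.hasFDerivAt).fderiv
    rw [show pullback e ψ * ⇑ℓ = k from hk.symm] at h1
    have h2 : D z (adj (D z) v) = v := by
      have := congrArg (fun T : ℂ →L[ℝ] ℂ => T v) (comp_adj hd)
      simpa using this
    rw [h1, e.left_inv hzs, pullback_eqOn ψ hzs]
    simp only [_root_.add_apply, _root_.smul_apply, ContinuousLinearMap.comp_apply, h2, smul_eq_mul]
    ring
  have i1 : Integrable (fun z => fderiv ℝ ψ (e z) v • ℓ (e.symm (e z)))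
      (volume.restrict e.source) := by
    have h1 := hψ'.integrableOn_smul (hcont.locallyIntegrableOn e.open_target.measurableSet)
    rw [IntegrableOn, ← h.map_eq] at h1
    exact h1.comp_aemeasurable h.aemeasurable
  have i2 : Integrable (fun z => ψ (e z) • (ℓ.comp (adj (D (e.symm (e z))))) v)
      (volume.restrict e.source) := by
    have h1 := hψ.integrableOn_smul (locallyIntegrableOn_clm_comp (ContinuousLinearMap.apply ℝ ℝ v)
      (IntegrableOn.locallyIntegrableOn (Integrable.of_bound hA' _ hb')))
    rw [IntegrableOn, ← h.map_eq] at h1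
    exact h1.comp_aemeasurable h.aemeasurable
  rw [integral_congr_ae hid, integral_add i1 i2] at key
  linarith

/-- The inverse of an area preserving homeomorphism with bounded differential of determinant one
is of the same kind. -/
lemma IsBoundedPreserving.symm (h : IsBoundedPreserving e D)
    (hw : HasWeakFDeriv e.source e D) (hfin : volume e.source ≠ ⊤)
    (hdet : ∀ᵐ z ∂(volume.restrict e.source), (D z).det = 1) :
    IsBoundedPreserving e.symm (fun w => adj (D (e.symm w))) := by
  obtain ⟨L, hL⟩ := h.bounded
  have hs : AEMeasurable e.symm (volume.restrict e.target) :=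
    e.symm.continuousOn.aemeasurable e.open_target.measurableSet
  have hD' : AEStronglyMeasurable (fun w => adj (D (e.symm w))) (volume.restrict e.target) :=
    continuous_adj.comp_aestronglyMeasurable
      ((h.map_symm ▸ h.aestronglyMeasurable).comp_aemeasurable hs)
  have hb : ∀ᵐ w ∂(volume.restrict e.target), ‖adj (D (e.symm w))‖ ≤ 3 * L := by
    have h1 : ∀ᵐ w ∂(volume.restrict e.target), ‖D (e.symm w)‖ ≤ L :=
      ae_of_ae_map hs (h.map_symm ▸ hL)
    filter_upwards [h1] with w hw
    exact (norm_adj_le _).trans (by linarith)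
  have bd : ∀ ℓ : ℂ →L[ℝ] ℝ, ∀ᵐ w ∂(volume.restrict e.target),
      ‖ℓ.comp (adj (D (e.symm w)))‖ ≤ ‖ℓ‖ * (3 * L) := fun ℓ =>
    hb.mono fun z hz => (ℓ.opNorm_comp_le _).trans (mul_le_mul_of_nonneg_left hz (norm_nonneg _))
  have w1 := h.hasWeakFDeriv_symm hw hfin hdet Complex.reCLM
  have w2 := h.hasWeakFDeriv_symm hw hfin hdet Complex.imCLM
  have l1 := w1.locallyLipschitzOn e.open_target
    (Complex.reCLM.continuous.comp_continuousOn e.symm.continuousOn) (bd _)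
  have l2 := w2.locallyLipschitzOn e.open_target
    (Complex.imCLM.continuous.comp_continuousOn e.symm.continuousOn) (bd _)
  refine ⟨locallyLipschitzOn_of_re_im l1 l2, hD', ⟨_, hb⟩, ?_, h.map_symm⟩
  filter_upwards [w1.ae_hasFDerivAt e.open_target l1, w2.ae_hasFDerivAt e.open_target l2]
    with z h1 h2
  exact hasFDerivAt_of_re_im h1 h2

end Inverse

lemma volume_disc_ne_top : volume disc ≠ ⊤ := measure_ball_lt_top.ne

/-! ### Transfer of constants and eigenvalues -/

section Transfer

variable {A : ℂ → Matrix (Fin 2) (Fin 2) ℝ} {Ω : Set ℂ}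

lemma energy_congr {F F' G G' : ℂ → ℂ →L[ℝ] ℝ} (hF : F =ᵐ[volume.restrict Ω] F')
    (hG : G =ᵐ[volume.restrict Ω] G') : energy A Ω F G = energy A Ω F' G' := by
  refine integral_congr_ae ?_
  filter_upwards [hF, hG] with z h1 h2
  rw [h1, h2]

lemma normL2_congr {f f' : ℂ → ℝ} (hf : f =ᵐ[volume.restrict Ω] f') :
    normL2 Ω f = normL2 Ω f' := by
  unfold normL2
  congr 1
  refine integral_congr_ae ?_
  filter_upwards [hf] with z h1
  rw [h1]

lemma aestronglyMeasurable_grad_dotProduct {α : Type*} [MeasurableSpace α] {μ : Measure α}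
    {F G : α → ℂ →L[ℝ] ℝ} (hF : AEStronglyMeasurable F μ)
    (hG : AEStronglyMeasurable G μ) : AEStronglyMeasurable
      (fun z => ((1 : Matrix (Fin 2) (Fin 2) ℝ) *ᵥ grad (F z)) ⬝ᵥ grad (G z)) μ := by
  have hm : ∀ {F : α → ℂ →L[ℝ] ℝ}, AEStronglyMeasurable F μ → ∀ v : ℂ,
      AEStronglyMeasurable (fun z => F z v) μ := fun hF v =>
    (ContinuousLinearMap.apply ℝ ℝ v).continuous.comp_aestronglyMeasurable hF
  simp only [Matrix.one_mulVec, grad_dotProduct]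
  exact ((hm hF 1).mul (hm hG 1)).add ((hm hF _).mul (hm hG _))

/-- An area preserving homeomorphism with bounded differential of determinant one that is isometric
from the energy of `A` on its source to the Dirichlet energy on its target. -/
structure IsEnergyIsometry (A : ℂ → Matrix (Fin 2) (Fin 2) ℝ) (e : OpenPartialHomeomorph ℂ ℂ)
    (D : ℂ → ℂ →L[ℝ] ℂ) : Prop where
  preserving : IsBoundedPreserving e D
  preserving_symm : IsBoundedPreserving e.symm (fun w => adj (D (e.symm w)))
  det_eq_one : ∀ᵐ z ∂(volume.restrict e.source), (D z).det = 1
  energy_eq : ∀ᵐ z ∂(volume.restrict e.source), ∀ F G : ℂ →L[ℝ] ℝ,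
    (A z *ᵥ grad (F.comp (D z))) ⬝ᵥ grad (G.comp (D z))
      = ((1 : Matrix (Fin 2) (Fin 2) ℝ) *ᵥ grad F) ⬝ᵥ grad G

lemma IsAQuasiconformal.isEnergyIsometry {Ω' : Set ℂ} {e : OpenPartialHomeomorph ℂ ℂ}
    {D : ℂ → ℂ →L[ℝ] ℂ} (hA : MemEllipticClass Ω A) (hΩ' : volume Ω' ≠ ⊤)
    (h : IsAQuasiconformal A Ω Ω' e D) (hJ : ∀ᵐ z ∂(volume.restrict Ω), |(D z).det| = 1) :
    IsEnergyIsometry A e D := by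
  obtain ⟨rfl, rfl, hw, -, ⟨K, hK, hdist⟩, hbel⟩ := h
  -- With |J| = 1 the distortion inequality reads ‖D‖² ≤ K.
  have hL : ∀ᵐ z ∂(volume.restrict e.source), ‖D z‖ ≤ √K := by
    filter_upwards [hdist, hJ] with z h1 h2
    rw [h2, mul_one] at h1
    exact Real.le_sqrt_of_sq_le h1
  have halg : ∀ᵐ z ∂(volume.restrict e.source), (D z).det = 1 ∧ ∀ F G : ℂ →L[ℝ] ℝ,
      (A z *ᵥ grad (F.comp (D z))) ⬝ᵥ grad (G.comp (D z))
        = ((1 : Matrix (Fin 2) (Fin 2) ℝ) *ᵥ grad F) ⬝ᵥ grad G := by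
    filter_upwards [hbel, hJ, hA.symm, hA.det_eq_one, hA.entry_pos] with z h1 h2 h3 h4 h5
    exact beltrami_det_and_energy h3 h4 h5 h2 h1
  have hdet := halg.mono fun z hz => hz.1
  obtain ⟨hlip, hder⟩ := hw.complex_regularity e.open_source e.continuousOn hL
  have hp : IsBoundedPreserving e D := ⟨hlip, hw.locInt_deriv.aestronglyMeasurable, ⟨_, hL⟩, hder,
    map_volume_restrict_eq e.open_source e.image_source_eq_target e.injOn hlip hder hdet⟩
  exact ⟨hp, hp.symm hw (hp.volume_eq ▸ hΩ') hdet, hdet, halg.mono fun z hz => hz.2⟩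

namespace IsEnergyIsometry

variable {e : OpenPartialHomeomorph ℂ ℂ} {D : ℂ → ℂ →L[ℝ] ℂ}

lemma energy_comp (h : IsEnergyIsometry A e D) {F G : ℂ → ℂ →L[ℝ] ℝ}
    (hF : AEStronglyMeasurable F (volume.restrict e.target))
    (hG : AEStronglyMeasurable G (volume.restrict e.target)) :
    energy A e.source (fun z => (F (e z)).comp (D z)) (fun z => (G (e z)).comp (D z))
      = energy (fun _ => 1) e.target F G := by
  unfold energy
  rw [h.preserving.symm_integral_eq (aestronglyMeasurable_grad_dotProduct hF hG)]
  refine integral_congr_ae ?_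
  filter_upwards [h.energy_eq] with z hz
  exact hz _ _

lemma normL2_comp (h : IsEnergyIsometry A e D) {f : ℂ → ℝ}
    (hf : AEStronglyMeasurable f (volume.restrict e.target)) :
    normL2 e.source (fun z => f (e z)) = normL2 e.target f := by
  exact congrArg Real.sqrt
    (h.preserving.symm_integral_eq (F := fun w => |f w| ^ 2) (hf.norm.pow 2)).symm

/-- Every pair on the source is the composition of a pair on the target. -/
lemma exists_target_pair (h : IsEnergyIsometry A e D) {f : ℂ → ℝ} {F : ℂ → ℂ →L[ℝ] ℝ}
    (hf : IsH10Pair e.source f F) : ∃ g G, IsH10Pair e.target g G ∧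
      f =ᵐ[volume.restrict e.source] (fun z => g (e z)) ∧
      F =ᵐ[volume.restrict e.source] fun z => (G (e z)).comp (D z) := by
  -- The target pair is the composition with the inverse; composing back returns the original pair,
  -- by adj(D) D = 1 for the differential.
  refine ⟨_, _, h.preserving_symm.isH10Pair_comp hf, ?_, ?_⟩
  · filter_upwards [ae_restrict_mem e.open_source.measurableSet] with z hz
    rw [e.left_inv hz]
  · filter_upwards [ae_restrict_mem e.open_source.measurableSet, h.det_eq_one] with z hz hd
    rw [e.left_inv hz, ContinuousLinearMap.comp_assoc, adj_comp hd, ContinuousLinearMap.comp_id]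

/-- Composition is onto up to a.e. equality and preserves both sides of the Poincaré inequality, so
each admissible constant transfers in either direction. -/
lemma poincareConstants_eq (h : IsEnergyIsometry A e D) (hA : MemEllipticClass e.source A)
    (hfin : volume e.target ≠ ⊤) :
    poincareConstants A e.source = poincareConstants (fun _ => 1) e.target := by
  have hfin' : volume e.source ≠ ⊤ := h.preserving.volume_eq ▸ hfin
  ext C
  refine and_congr_right fun _ => ⟨fun hC g G hg => ?_, fun hC f F hf => ?_⟩
  · rw [(memEllipticClass_one _).memSobolevZero_iff hfin] at hg
    have h1 := hC _ _ ((hA.memSobolevZero_iff hfin').2 (h.preserving.isH10Pair_comp hg))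
    unfold seminormA at h1 ⊢
    rwa [h.normL2_comp hg.memLp.1, h.energy_comp hg.memLp_deriv.1 hg.memLp_deriv.1] at h1
  · rw [hA.memSobolevZero_iff hfin'] at hf
    obtain ⟨g, G, hg, h1, h2⟩ := h.exists_target_pair hf
    have h3 := hC _ _ (((memEllipticClass_one _).memSobolevZero_iff hfin).2 hg)
    unfold seminormA at h3 ⊢
    rwa [normL2_congr h1, energy_congr h2 h2, h.normL2_comp hg.memLp.1,
      h.energy_comp hg.memLp_deriv.1 hg.memLp_deriv.1]

/-- The weak equation is transferred together with its test functions: every admissible test pair on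
one side corresponds to one on the other. Nontriviality survives because `e` and its inverse
preserve null sets. -/
lemma dirichletEigenvalues_eq (h : IsEnergyIsometry A e D) (hA : MemEllipticClass e.source A)
    (hfin : volume e.target ≠ ⊤) :
    dirichletEigenvalues A e.source = dirichletEigenvalues (fun _ => 1) e.target := by
  have hfin' : volume e.source ≠ ⊤ := h.preserving.volume_eq ▸ hfin
  have hs : AEMeasurable e.symm (volume.restrict e.target) :=
    e.symm.continuousOn.aemeasurable e.open_target.measurableSet
  have hmul : ∀ {g₁ g₂ : ℂ → ℝ}, MemLp g₁ 2 (volume.restrict e.target) →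
      MemLp g₂ 2 (volume.restrict e.target) →
      ∫ w in e.target, g₁ w * g₂ w = ∫ z in e.source, g₁ (e z) * g₂ (e z) := fun h1 h2 =>
    h.preserving.symm_integral_eq (h1.1.mul h2.1)
  ext Λ
  constructor
  · rintro ⟨f, F, hf, hf0, hΛ⟩
    rw [hA.memSobolevZero_iff hfin'] at hf
    obtain ⟨g, G, hg, h1, h2⟩ := h.exists_target_pair hf
    refine ⟨g, G, ((memEllipticClass_one _).memSobolevZero_iff hfin).2 hg, fun hg0 => hf0 ?_,
      fun k H hk => ?_⟩
    · exact h1.trans (h.preserving.ae_comp hg0)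
    · rw [(memEllipticClass_one _).memSobolevZero_iff hfin] at hk
      have h3 := hΛ _ _ ((hA.memSobolevZero_iff hfin').2 (h.preserving.isH10Pair_comp hk))
      rw [energy_congr h2 (ae_eq_refl _), h.energy_comp hg.memLp_deriv.1 hk.memLp_deriv.1] at h3
      rw [h3, hmul hg.memLp hk.memLp]
      congr 1
      refine integral_congr_ae ?_
      filter_upwards [h1] with z hz
      rw [hz]
  · rintro ⟨g, G, hg, hg0, hΛ⟩
    rw [(memEllipticClass_one _).memSobolevZero_iff hfin] at hg
    refine ⟨_, _, (hA.memSobolevZero_iff hfin').2 (h.preserving.isH10Pair_comp hg),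
      fun h0 => hg0 ?_, fun k H hk => ?_⟩
    · have h1 : ∀ᵐ w ∂(volume.restrict e.target), g (e (e.symm w)) = 0 :=
        ae_of_ae_map hs (h.preserving.map_symm ▸ h0)
      filter_upwards [h1, ae_restrict_mem e.open_target.measurableSet] with w hw hwt
      rwa [e.right_inv hwt] at hw
    · rw [hA.memSobolevZero_iff hfin'] at hk
      obtain ⟨k', H', hk', h1, h2⟩ := h.exists_target_pair hk
      have h3 := hΛ _ _ (((memEllipticClass_one _).memSobolevZero_iff hfin).2 hk')
      rw [energy_congr (ae_eq_refl _) h2, h.energy_comp hg.memLp_deriv.1 hk'.memLp_deriv.1, h3,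
        hmul hg.memLp hk'.memLp]
      congr 1
      refine integral_congr_ae ?_
      filter_upwards [h1] with z hz
      rw [hz]

end IsEnergyIsometry

end Transfer

/-! ### Convergence in L² and weak compactness -/

section LTwo

variable {α E : Type*} [MeasurableSpace α] [NormedAddCommGroup E] {μ : Measure α}

lemma MemLp.norm_toLp_sq {f : α → E} (hf : MemLp f 2 μ) :
    ‖hf.toLp f‖ ^ 2 = ∫ x, ‖f x‖ ^ 2 ∂μ := by
  rw [Lp.norm_toLp, MemLp.eLpNorm_two_eq hf, ENNReal.toReal_ofReal (Real.sqrt_nonneg _),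
    Real.sq_sqrt (integral_nonneg fun x => by positivity)]

lemma tendsto_integral_norm_sq {f : α → E} {g : ℕ → α → E} (hf : MemLp f 2 μ)
    (hg : ∀ n, MemLp (g n) 2 μ) (h : Tendsto (fun n => eLpNorm (f - g n) 2 μ) atTop (𝓝 0)) :
    Tendsto (fun n => ∫ x, ‖g n x‖ ^ 2 ∂μ) atTop (𝓝 (∫ x, ‖f x‖ ^ 2 ∂μ)) := by
  have h1 : Tendsto (fun n => (hg n).toLp (g n)) atTop (𝓝 (hf.toLp f)) := by
    rw [Lp.tendsto_Lp_iff_tendsto_eLpNorm'' _ hg f hf]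
    refine h.congr fun n => ?_
    rw [← eLpNorm_neg, neg_sub]
  have h2 := (h1.norm).pow 2
  simp only [MemLp.norm_toLp_sq] at h2
  exact h2

lemma exists_limit_of_cauchy [CompleteSpace E] {g : ℕ → α → E} (hg : ∀ n, MemLp (g n) 2 μ)
    (h : ∀ ε : ℝ, 0 < ε → ∃ N, ∀ n ≥ N, ∀ m ≥ N, ∫ x, ‖g n x - g m x‖ ^ 2 ∂μ < ε) :
    ∃ f, MemLp f 2 μ ∧ Tendsto (fun n => eLpNorm (f - g n) 2 μ) atTop (𝓝 0) := by
  have hc : CauchySeq fun n => (hg n).toLp (g n) := by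
    rw [Metric.cauchySeq_iff]
    intro ε hε
    obtain ⟨N, hN⟩ := h (ε ^ 2) (by positivity)
    refine ⟨N, fun n hn m hm => ?_⟩
    rw [dist_eq_norm, ← MemLp.toLp_sub]
    refine lt_of_pow_lt_pow_left₀ 2 hε.le ?_
    rw [MemLp.norm_toLp_sq]
    exact hN n hn m hm
  obtain ⟨f, hf⟩ := cauchySeq_tendsto_of_complete hc
  refine ⟨f, Lp.memLp f, ?_⟩
  rw [Lp.tendsto_Lp_iff_tendsto_eLpNorm'] at hf
  refine hf.congr fun n => ?_
  rw [← eLpNorm_neg, neg_sub]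
  exact eLpNorm_congr_ae ((ae_eq_refl _).sub (hg n).coeFn_toLp)

/-- The variance, the integral of (h - m)² with `m` the mean, is nonnegative. -/
lemma sq_integral_le [IsProbabilityMeasure μ] {h : α → ℝ} (h2 : MemLp h 2 μ) :
    (∫ x, h x ∂μ) ^ 2 ≤ ∫ x, h x ^ 2 ∂μ := by
  have h1 : Integrable h μ := h2.integrable (by norm_num)
  obtain ⟨m, hm⟩ : ∃ m, ∫ x, h x ∂μ = m := ⟨_, rfl⟩
  have h3 : 0 ≤ ∫ x, (h x ^ 2 - (2 * m) * h x + m ^ 2) ∂μ :=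
    integral_nonneg fun x => by
      change 0 ≤ h x ^ 2 - (2 * m) * h x + m ^ 2
      nlinarith [sq_nonneg (h x - m)]
  have i2 : Integrable (fun x => h x ^ 2) μ := h2.integrable_sq
  have e1 := integral_add (f := fun x => h x ^ 2 - (2 * m) * h x) (g := fun _ => m ^ 2)
    (i2.sub (h1.const_mul _)) (integrable_const _)
  have e2 := integral_sub i2 (h1.const_mul (2 * m))
  rw [e1, e2, integral_const_mul, hm, integral_const] at h3
  simp at h3
  rw [hm]
  nlinarith

/-- Bounded sequences in a separable Hilbert space have weakly convergent subsequences. -/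
lemma exists_weakly_convergent_subseq {H : Type*} [NormedAddCommGroup H] [InnerProductSpace ℝ H]
    [CompleteSpace H] [TopologicalSpace.SeparableSpace H] {v : ℕ → H} {R : ℝ}
    (hv : ∀ n, ‖v n‖ ≤ R) : ∃ k : ℕ → ℕ, StrictMono k ∧
      ∀ y : H, ∃ l : ℝ, Tendsto (fun n => inner ℝ (v (k n)) y) atTop (𝓝 l) := by
  -- Sequential Banach–Alaoglu, carried to `H` by the Riesz isometry.
  have hs := WeakDual.isSeqCompact_closedBall ℝ H (0 : StrongDual ℝ H) R
  obtain ⟨a, -, k, hk, ha⟩ := hs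
    (x := fun n => StrongDual.toWeakDual (InnerProductSpace.toDual ℝ H (v n))) (fun n => by
      change InnerProductSpace.toDual ℝ H (v n) ∈ Metric.closedBall 0 R
      rw [mem_closedBall_zero_iff, LinearIsometryEquiv.norm_map]
      exact hv n)
  refine ⟨k, hk, fun y => ⟨a y, ?_⟩⟩
  exact ((WeakDual.eval_continuous y).tendsto a).comp ha

end LTwo

/-! ### Translation estimates and the Poincaré inequality -/

section Compactness

variable {Ω : Set ℂ} {u : ℂ → ℝ}

lemma IsTestFunction.integrable_mul (hu : IsTestFunction Ω u) {g : ℂ → ℝ} (hg : Continuous g) :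
    Integrable (fun x => u x * g x) volume :=
  (hu.smooth.continuous.mul hg).integrable_of_hasCompactSupport hu.compact.mul_right

lemma IsTestFunction.integrable_norm_fderiv_sq (hu : IsTestFunction Ω u) :
    Integrable (fun x => ‖fderiv ℝ u x‖ ^ 2) volume := by
  have h := hu.memLp_fderiv 2 Set.univ
  rw [Measure.restrict_univ] at h
  exact (memLp_two_iff_integrable_sq_norm h.1).1 h

/-- The fundamental theorem of calculus along the segment from x to x + t, followed by
Cauchy–Schwarz in the parameter. -/
lemma IsTestFunction.sq_translate_le (hu : IsTestFunction Ω u) (t x : ℂ) :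
    (u (x + t) - u x) ^ 2
      ≤ ‖t‖ ^ 2 * ∫ s in Set.Ioc (0 : ℝ) 1, ‖fderiv ℝ u (x + s • t)‖ ^ 2 := by
  have hc : Continuous fun s : ℝ => fderiv ℝ u (x + s • t) :=
    hu.contDiff_fderiv.continuous.comp (by fun_prop)
  have hct : Continuous fun s : ℝ => fderiv ℝ u (x + s • t) t := hc.clm_apply continuous_const
  have h1 : ∫ s in (0 : ℝ)..1, fderiv ℝ u (x + s • t) t = u (x + t) - u x := by
    have := intervalIntegral.integral_eq_sub_of_hasDerivAt (a := 0) (b := 1)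
      (f := fun s : ℝ => u (x + s • t)) (f' := fun s => fderiv ℝ u (x + s • t) t)
      (fun s _ => by
        have h2 : HasDerivAt (fun s : ℝ => x + s • t) t s := by
          simpa using ((hasDerivAt_id s).smul_const t).const_add x
        exact (hu.differentiable _).hasFDerivAt.comp_hasDerivAt s h2)
      (hct.intervalIntegrable _ _)
    simpa using this
  rw [intervalIntegral.integral_of_le zero_le_one] at h1
  have : IsProbabilityMeasure (volume.restrict (Set.Ioc (0 : ℝ) 1)) := ⟨by simp⟩
  have hm : MemLp (fun s : ℝ => fderiv ℝ u (x + s • t) t) 2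
      (volume.restrict (Set.Ioc (0 : ℝ) 1)) := by
    rw [memLp_two_iff_integrable_sq hct.aestronglyMeasurable]
    exact ((hct.pow 2).integrableOn_Icc (a := 0) (b := 1)).mono_set Set.Ioc_subset_Icc_self
  rw [← h1, ← integral_const_mul]
  refine (sq_integral_le hm).trans (integral_mono hm.integrable_sq ?_ fun s => ?_)
  · exact ((hc.norm.pow 2).const_mul (‖t‖ ^ 2) |>.integrableOn_Icc (a := 0) (b := 1)).mono_set
      Set.Ioc_subset_Icc_self
  · change (fderiv ℝ u (x + s • t) t) ^ 2 ≤ ‖t‖ ^ 2 * ‖fderiv ℝ u (x + s • t)‖ ^ 2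
    rw [← mul_pow, ← sq_abs, ← Real.norm_eq_abs, mul_comm]
    exact pow_le_pow_left₀ (norm_nonneg _) ((fderiv ℝ u (x + s • t)).le_opNorm t) 2

/-- The `L²` modulus of continuity of a test function. -/
lemma IsTestFunction.integral_sq_translate_le (hu : IsTestFunction Ω u) (t : ℂ) :
    ∫ x, (u (x + t) - u x) ^ 2 ≤ ‖t‖ ^ 2 * ∫ x, ‖fderiv ℝ u x‖ ^ 2 := by
  set ν := volume.restrict (Set.Ioc (0 : ℝ) 1)
  set g : ℂ → ℝ := fun x => ‖fderiv ℝ u x‖ ^ 2 with hg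
  have hgc : Continuous g := hu.contDiff_fderiv.continuous.norm.pow 2
  have hgi : Integrable g volume := hu.integrable_norm_fderiv_sq
  have htr : ∀ s : ℝ, ∫ x, g (x + s • t) = ∫ x, g x := fun s => integral_add_right_eq_self g _
  have hprod : Integrable (fun p : ℂ × ℝ => g (p.1 + p.2 • t)) (volume.prod ν) := by
    have hcont : Continuous fun p : ℂ × ℝ => g (p.1 + p.2 • t) := hgc.comp (by fun_prop)
    rw [integrable_prod_iff' hcont.aestronglyMeasurable]
    refine ⟨Eventually.of_forall fun s => hgi.comp_add_right (s • t), ?_⟩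
    have : ∀ s : ℝ, ∫ x, ‖g (x + s • t)‖ = ∫ x, g x := fun s => by
      rw [← htr s]
      congr 1; ext x
      exact Real.norm_of_nonneg (by positivity)
    simp only [this]
    exact integrable_const _
  -- After exchanging the integrals, translation invariance makes the inner one independent of `s`.
  have hswap := integral_integral_swap (μ := volume) (ν := ν)
    (f := fun x s => g (x + s • t)) hprod
  simp only [htr] at hswap
  rw [integral_const] at hswap
  have hi : Integrable (fun x => ∫ s, g (x + s • t) ∂ν) volume := hprod.integral_prod_left
  have hL : Integrable (fun x => (u (x + t) - u x) ^ 2) volume := by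
    have hm : MemLp u 2 volume := by simpa using hu.memLp 2 Set.univ
    have hmt : MemLp (fun x => u (x + t)) 2 volume :=
      hm.comp_measurePreserving (measurePreserving_add_right volume t)
    exact (hmt.sub hm).integrable_sq
  calc ∫ x, (u (x + t) - u x) ^ 2 ≤ ∫ x, ‖t‖ ^ 2 * ∫ s, g (x + s • t) ∂ν :=
        integral_mono hL (hi.const_mul _) fun x => hu.sq_translate_le t x
    _ = ‖t‖ ^ 2 * ∫ x, ‖fderiv ℝ u x‖ ^ 2 := by
        rw [integral_const_mul, hswap]
        simp [ν, hg]

lemma IsTestFunction.integral_sq_le (hu : IsTestFunction Ω u) (t : ℂ) :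
    ∫ x, u x ^ 2 ≤ ‖t‖ ^ 2 / 2 * (∫ x, ‖fderiv ℝ u x‖ ^ 2) + ∫ x, u x * u (x + t) := by
  have h := hu.integral_sq_translate_le t
  have hm : MemLp u 2 volume := by simpa using hu.memLp 2 Set.univ
  have hmt : MemLp (fun x => u (x + t)) 2 volume :=
    hm.comp_measurePreserving (measurePreserving_add_right volume t)
  have i1 : Integrable (fun x => u x ^ 2) volume := hm.integrable_sq
  have i2 : Integrable (fun x => u (x + t) ^ 2) volume := hmt.integrable_sq
  have i3 : Integrable (fun x => u x * u (x + t)) volume :=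
    hu.integrable_mul (hu.smooth.continuous.comp (by fun_prop))
  have e1 : ∫ x, (u (x + t) - u x) ^ 2
      = (∫ x, u (x + t) ^ 2) + (∫ x, u x ^ 2) - 2 * ∫ x, u x * u (x + t) := by
    rw [← integral_const_mul, ← integral_add i2 i1, 
      ← integral_sub (f := fun x => u (x + t) ^ 2 + u x ^ 2) (i2.add i1) (i3.const_mul 2)]
    congr 1; ext x; ring
  rw [e1, integral_add_right_eq_self (fun x => u x ^ 2) t] at h
  linarith

/-- The Poincaré inequality for test functions in the disc. -/
lemma IsTestFunction.poincare (hu : IsTestFunction disc u) :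
    1 / 2 * ∫ x, u x ^ 2 ≤ ∫ x, ‖fderiv ℝ u x‖ ^ 2 := by
  -- Translation by 2, the diameter of the disc, makes the supports disjoint and the product term
  -- vanish. The factor 2² / 2 = 2 remains.
  have h := hu.integral_sq_le 2
  have h0 : ∀ x, u x * u (x + 2) = 0 := by
    intro x
    by_cases hx : x ∈ disc
    · have hx2 : x + 2 ∉ disc := by
        intro h2
        rw [disc, mem_ball_zero_iff] at hx h2
        have := norm_sub_le (x + 2) x
        rw [add_sub_cancel_left] at this
        norm_num at this
        linarith
      rw [hu.eq_zero hx2, mul_zero]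
    · rw [hu.eq_zero hx, zero_mul]
  simp only [h0, integral_zero] at h
  norm_num at h
  linarith

/-- Control of the `L²` norm by ball averages and the energy. -/
lemma IsTestFunction.integral_sq_le_average (hu : IsTestFunction Ω u) (hfin : volume Ω ≠ ⊤) {r : ℝ}
    (hr : 0 < r) : ∫ x, u x ^ 2 ≤ r ^ 2 * (∫ x, ‖fderiv ℝ u x‖ ^ 2)
      + (volume.real (Metric.closedBall (0 : ℂ) r) ^ 2)⁻¹
        * ∫ x in Ω, (∫ t in Metric.closedBall (0 : ℂ) r, u (x + t)) ^ 2 := by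
  set B := Metric.closedBall (0 : ℂ) r with hB
  have hBc : IsCompact B := isCompact_closedBall _ _
  set m := volume.real B with hm
  have hBfin : IsFiniteMeasure (volume.restrict B) := ⟨by simpa using hBc.measure_lt_top⟩
  have hΩfin : IsFiniteMeasure (volume.restrict Ω) := ⟨by simpa using hfin.lt_top⟩
  have hm0 : 0 < m := ENNReal.toReal_pos
    (Metric.measure_closedBall_pos volume _ hr).ne' hBc.measure_lt_top.ne
  set N := ∫ x, u x ^ 2
  set En := ∫ x, ‖fderiv ℝ u x‖ ^ 2
  have hEn : 0 ≤ En := integral_nonneg fun x => by positivity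
  have hcu := hu.smooth.continuous
  obtain ⟨M, hM⟩ := hcu.bounded_above_of_compact_support hu.compact
  set a : ℂ → ℝ := fun x => ∫ t in B, u (x + t) with ha
  have hac : Continuous a :=
    continuous_parametric_integral_of_continuous (f := fun x t => u (x + t))
      (by fun_prop : Continuous fun p : ℂ × ℂ => u (p.1 + p.2)) hBc
  have hab : ∀ x, ‖a x‖ ≤ M * m := fun x =>
    norm_setIntegral_le_of_norm_le_const hBc.measure_lt_top fun t _ => hM _
  have hprod : Integrable (fun p : ℂ × ℂ => u p.1 * u (p.1 + p.2))
      (volume.prod (volume.restrict B)) := by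
    have hc : Continuous fun p : ℂ × ℂ => u p.1 * u (p.1 + p.2) := by fun_prop
    have hui : Integrable u volume := hcu.integrable_of_hasCompactSupport hu.compact
    refine (hui.mul_prod (integrable_const (μ := volume.restrict B) M)).mono
      hc.aestronglyMeasurable (Eventually.of_forall fun p => ?_)
    rw [norm_mul, norm_mul]
    exact mul_le_mul_of_nonneg_left ((hM _).trans (le_abs_self _)) (norm_nonneg _)
  have hswap := integral_integral_swap (μ := volume) (ν := volume.restrict B)
    (f := fun x t => u x * u (x + t)) hprod
  simp only [integral_const_mul] at hswap
  have i1 : Integrable (fun t => ∫ x, u x * u (x + t)) (volume.restrict B) :=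
    hprod.integral_prod_right
  -- The translation estimate is integrated over `t` in the ball, turning the product term into a
  -- pairing of `u` with its unnormalised ball averages `a`.
  have step1 : m * N ≤ m * (r ^ 2 / 2 * En) + ∫ x, u x * a x := by
    rw [hswap]
    have h1 : ∫ _ in B, N ≤ ∫ t in B, (r ^ 2 / 2 * En + ∫ x, u x * u (x + t)) := by
      refine setIntegral_mono_on (integrable_const _) ((integrable_const _).add i1)
        hBc.measurableSet fun t ht => ?_
      refine (hu.integral_sq_le t).trans ?_
      have : ‖t‖ ^ 2 ≤ r ^ 2 := pow_le_pow_left₀ (norm_nonneg _) (mem_closedBall_zero_iff.1 ht) 2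
      gcongr
    rw [integral_add (integrable_const _) i1, setIntegral_const, setIntegral_const] at h1
    simpa using h1
  have hmem : MemLp u 2 volume := by simpa using hu.memLp 2 Set.univ
  have i2 : Integrable (fun x => u x ^ 2) volume := hmem.integrable_sq
  have i3 : Integrable (fun x => a x ^ 2) (volume.restrict Ω) := by
    refine Integrable.of_bound (hac.pow 2).aestronglyMeasurable ((M * m) ^ 2)
      (Eventually.of_forall fun x => ?_)
    rw [norm_pow]
    exact pow_le_pow_left₀ (norm_nonneg _) (hab x) 2
  -- Young's inequality weighted by `m`, so that half of `m * N` can be absorbed on the left.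
  have step2 : ∫ x, u x * a x ≤ m / 2 * N + 1 / (2 * m) * ∫ x in Ω, a x ^ 2 := by
    have e1 : ∫ x, u x * a x = ∫ x in Ω, u x * a x :=
      (setIntegral_eq_integral_of_forall_compl_eq_zero fun x hx => by
        rw [hu.eq_zero hx, zero_mul]).symm
    have e2 : N = ∫ x in Ω, u x ^ 2 :=
      (setIntegral_eq_integral_of_forall_compl_eq_zero fun x hx => by
        rw [hu.eq_zero hx]; norm_num).symm
    rw [e1, e2, ← integral_const_mul, ← integral_const_mul,
      ← integral_add (i2.restrict.const_mul _) (i3.const_mul _)]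
    refine integral_mono (hu.integrable_mul hac).restrict
      ((i2.restrict.const_mul _).add (i3.const_mul _)) fun x => ?_
    change u x * a x ≤ m / 2 * u x ^ 2 + 1 / (2 * m) * a x ^ 2
    have : m / 2 * u x ^ 2 + 1 / (2 * m) * a x ^ 2 - u x * a x
        = 1 / (2 * m) * (m * u x - a x) ^ 2 := by field_simp; ring
    have h2 : 0 ≤ 1 / (2 * m) * (m * u x - a x) ^ 2 := by positivity
    linarith
  set I := ∫ x in Ω, a x ^ 2
  have h3 : m * N ≤ m * (r ^ 2 * En + (m ^ 2)⁻¹ * I) := by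
    have : m * (r ^ 2 * En + (m ^ 2)⁻¹ * I) = 2 * (m * (r ^ 2 / 2 * En) + 1 / (2 * m) * I) := by
      field_simp
    rw [this]
    linarith
  exact le_of_mul_le_mul_left h3 hm0

end Compactness

/-! ### Rellich's theorem -/

section Rellich

variable {Ω : Set ℂ}

lemma IsTestFunction.sub {u w : ℂ → ℝ} (hu : IsTestFunction Ω u) (hw : IsTestFunction Ω w) :
    IsTestFunction Ω (u - w) := by
  have := hu.add (hw.const_smul (-1))
  rwa [neg_one_smul, ← sub_eq_add_neg] at this

lemma IsTestFunction.fderiv_add' {u w : ℂ → ℝ} (hu : IsTestFunction Ω u)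
    (hw : IsTestFunction Ω w) (x : ℂ) :
    fderiv ℝ (u + w) x = fderiv ℝ u x + fderiv ℝ w x :=
  fderiv_add (hu.differentiable x) (hw.differentiable x)

lemma IsTestFunction.fderiv_sub' {u w : ℂ → ℝ} (hu : IsTestFunction Ω u)
    (hw : IsTestFunction Ω w) (x : ℂ) :
    fderiv ℝ (u - w) x = fderiv ℝ u x - fderiv ℝ w x :=
  fderiv_sub (hu.differentiable x) (hw.differentiable x)

lemma norm_add_sq_add_norm_sub_sq (L L' : ℂ →L[ℝ] ℝ) :
    ‖L + L'‖ ^ 2 + ‖L - L'‖ ^ 2 = 2 * ‖L‖ ^ 2 + 2 * ‖L'‖ ^ 2 := by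
  simp only [norm_sq_eq_grad, grad_dotProduct, _root_.add_apply, _root_.sub_apply]
  ring

/-- The parallelogram law for the Dirichlet energy. -/
lemma IsTestFunction.energy_parallelogram {u w : ℂ → ℝ} (hu : IsTestFunction Ω u)
    (hw : IsTestFunction Ω w) :
    (∫ x, ‖fderiv ℝ (u + w) x‖ ^ 2) + ∫ x, ‖fderiv ℝ (u - w) x‖ ^ 2
      = 2 * (∫ x, ‖fderiv ℝ u x‖ ^ 2) + 2 * ∫ x, ‖fderiv ℝ w x‖ ^ 2 := by
  rw [← integral_add (hu.add hw).integrable_norm_fderiv_sq (hu.sub hw).integrable_norm_fderiv_sq,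
    ← integral_const_mul, ← integral_const_mul,
    ← integral_add (hu.integrable_norm_fderiv_sq.const_mul 2)
      (hw.integrable_norm_fderiv_sq.const_mul 2)]
  congr 1; ext x
  rw [hu.fderiv_add' hw, hu.fderiv_sub' hw, norm_add_sq_add_norm_sub_sq]

lemma IsTestFunction.memLp_volume {u : ℂ → ℝ} (hu : IsTestFunction Ω u) :
    MemLp u 2 (volume : Measure ℂ) := by simpa using hu.memLp 2 Set.univ

lemma IsTestFunction.parallelogram {u w : ℂ → ℝ} (hu : IsTestFunction Ω u)
    (hw : IsTestFunction Ω w) :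
    (∫ x, (u + w) x ^ 2) + ∫ x, (u - w) x ^ 2 = 2 * (∫ x, u x ^ 2) + 2 * ∫ x, w x ^ 2 := by
  have i := fun {u : ℂ → ℝ} (hu : IsTestFunction Ω u) => hu.memLp_volume.integrable_sq
  rw [← integral_add (i (hu.add hw)) (i (hu.sub hw)), ← integral_const_mul, ← integral_const_mul,
    ← integral_add ((i hu).const_mul 2) ((i hw).const_mul 2)]
  congr 1; ext x
  simp only [Pi.add_apply, Pi.sub_apply]; ring

/-- Rellich's compactness theorem. -/
lemma exists_cauchy_subseq (hfin : volume Ω ≠ ⊤) {u : ℕ → ℂ → ℝ}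
    (hu : ∀ n, IsTestFunction Ω (u n)) {R M : ℝ} (hR : ∀ n, ∫ x, u n x ^ 2 ≤ R)
    (hM : ∀ n, ∫ x, ‖fderiv ℝ (u n) x‖ ^ 2 ≤ M) :
    ∃ k : ℕ → ℕ, StrictMono k ∧ ∀ ε : ℝ, 0 < ε → ∃ N, ∀ n ≥ N, ∀ m ≥ N,
      ∫ x, (u (k n) - u (k m)) x ^ 2 < ε := by
  have hR0 : 0 ≤ R := (integral_nonneg fun x => by positivity).trans (hR 0)
  have hM0 : 0 ≤ M := (integral_nonneg fun x => by positivity).trans (hM 0)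
  have hΩfin : IsFiniteMeasure (volume.restrict Ω) := ⟨by simpa using hfin.lt_top⟩
  have hL := fun n => (hu n).memLp_volume
  have hsep : TopologicalSpace.SeparableSpace (Lp ℝ 2 (volume : Measure ℂ)) := by
    have : Fact ((2 : ℝ≥0∞) ≠ ⊤) := ⟨by simp⟩
    infer_instance
  obtain ⟨k, hk, hweak⟩ := exists_weakly_convergent_subseq (v := fun n => (hL n).toLp (u n))
    (R := √R) (fun n => by
      apply Real.le_sqrt_of_sq_le
      rw [MemLp.norm_toLp_sq]
      simpa using hR n)
  refine ⟨k, hk, fun ε hε => ?_⟩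
  -- By the parallelogram law the differences have energy at most 4 M, so this radius makes the
  -- energy term at most ε / 2; using M + 1 keeps the quotient defined when M = 0.
  obtain ⟨r, hr, hrε⟩ : ∃ r : ℝ, 0 < r ∧ r ^ 2 * (4 * M) ≤ ε / 2 := by
    refine ⟨√(ε / (8 * (M + 1))), by positivity, ?_⟩
    rw [Real.sq_sqrt (by positivity), div_mul_eq_mul_div, div_le_iff₀ (by positivity)]
    nlinarith
  set B := Metric.closedBall (0 : ℂ) r with hB
  have hBc : IsCompact B := isCompact_closedBall _ _
  set m := volume.real B with hm
  have hm0 : 0 < m := ENNReal.toReal_pos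
    (Metric.measure_closedBall_pos volume _ hr).ne' hBc.measure_lt_top.ne
  set a : ℕ → ℂ → ℝ := fun n x => ∫ t in B, u (k n) (x + t) with ha
  have hui : ∀ n x, IntegrableOn (fun t => u (k n) (x + t)) B volume := fun n x =>
    ((hu (k n)).smooth.continuous.comp (by fun_prop)).continuousOn.integrableOn_compact hBc
  have hac : ∀ n, Continuous (a n) := fun n => by
    have := (hu (k n)).smooth.continuous
    exact continuous_parametric_integral_of_continuous (f := fun x t => u (k n) (x + t))
      (by fun_prop : Continuous fun p : ℂ × ℂ => u (k n) (p.1 + p.2)) hBc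
  -- the ball averages are scalar products with indicator functions
  have hball : ∀ x : ℂ, volume (Metric.closedBall x r) ≠ ⊤ := fun x =>
    (isCompact_closedBall x r).measure_lt_top.ne
  have hinner : ∀ n x, a n x = inner ℝ ((hL (k n)).toLp (u (k n)))
      (indicatorConstLp 2 Metric.isClosed_closedBall.measurableSet (hball x) (1 : ℝ)) := by
    intro n x
    rw [real_inner_comm, L2.inner_indicatorConstLp_one]
    have h1 : ∫ y in Metric.closedBall x r, (hL (k n)).toLp (u (k n)) y
        = ∫ y in Metric.closedBall x r, u (k n) y :=
      integral_congr_ae (ae_restrict_of_ae (hL (k n)).coeFn_toLp)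
    rw [h1]
    change ∫ t in B, u (k n) (x + t) = _
    rw [← integral_indicator hBc.measurableSet,
      ← integral_indicator Metric.isClosed_closedBall.measurableSet,
      ← integral_add_left_eq_self (Set.indicator (Metric.closedBall x r) _) x]
    congr 1; ext t
    by_cases ht : t ∈ B
    · rw [Set.indicator_of_mem ht, Set.indicator_of_mem]
      rw [mem_closedBall_iff_norm, add_sub_cancel_left]
      exact mem_closedBall_zero_iff.1 ht
    · rw [Set.indicator_of_notMem ht, Set.indicator_of_notMem]
      rw [mem_closedBall_iff_norm, add_sub_cancel_left]
      exact fun h => ht (mem_closedBall_zero_iff.2 h)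
  -- Ball averages are pairings with fixed L² functions, so weak convergence gives pointwise
  -- convergence. Their uniform bound and the finite area of Ω then upgrade this to L² convergence.
  have hconv : ∀ x, ∃ l, Tendsto (fun n => a n x) atTop (𝓝 l) := fun x => by
    simp only [hinner]; exact hweak _
  choose b hb using hconv
  have hbm : Measurable b := measurable_of_tendsto_metrizable (fun n => (hac n).measurable)
    (tendsto_pi_nhds.2 hb)
  have hvol : ∀ x : ℂ, volume.real (Metric.closedBall x r) = m := fun x => by
    rw [hm, hB, Measure.real, Measure.real, Measure.addHaar_closedBall_center]
  have hbound : ∀ n x, |a n x| ≤ √R * √m := by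
    intro n x
    rw [hinner]
    refine (abs_real_inner_le_norm _ _).trans (mul_le_mul ?_ ?_ (norm_nonneg _) (by positivity))
    · apply Real.le_sqrt_of_sq_le
      rw [MemLp.norm_toLp_sq]
      simpa using hR (k n)
    · rw [norm_indicatorConstLp (by simp) (by simp), hvol, Real.sqrt_eq_rpow]
      simp
  have hbb : ∀ x, |b x| ≤ √R * √m := fun x =>
    le_of_tendsto ((hb x).abs) (Eventually.of_forall fun n => hbound n x)
  have hdiff : ∀ n x, ‖(a n x - b x) ^ 2‖ ≤ (2 * (√R * √m)) ^ 2 := by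
    intro n x
    rw [norm_pow]
    refine pow_le_pow_left₀ (norm_nonneg _) ((norm_sub_le _ _).trans ?_) 2
    rw [Real.norm_eq_abs, Real.norm_eq_abs]
    linarith [hbound n x, hbb x]
  have hdm : ∀ n, AEStronglyMeasurable (fun x => (a n x - b x) ^ 2) (volume.restrict Ω) := fun n =>
    (((hac n).measurable.sub hbm).pow_const 2).aestronglyMeasurable
  have hlim : Tendsto (fun n => ∫ x in Ω, (a n x - b x) ^ 2) atTop (𝓝 (∫ _ in Ω, (0 : ℝ))) := by
    refine tendsto_integral_of_dominated_convergence (fun _ => (2 * (√R * √m)) ^ 2) hdm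
      (integrable_const _) (fun n => Eventually.of_forall (hdiff n))
      (Eventually.of_forall fun x => ?_)
    have := ((hb x).sub_const (b x)).pow 2
    simpa using this
  rw [integral_zero] at hlim
  -- Two such errors, each doubled by the inequality for squares of differences, add up to m² ε / 2.
  have hδ : 0 < m ^ 2 * ε / 8 := by positivity
  obtain ⟨N, hN⟩ := eventually_atTop.1 (hlim.eventually_lt_const hδ)
  refine ⟨N, fun n hn p hp => ?_⟩
  have ht := (hu (k n)).sub (hu (k p))
  have hE : ∫ x, ‖fderiv ℝ (u (k n) - u (k p)) x‖ ^ 2 ≤ 4 * M := by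
    have h1 := (hu (k n)).energy_parallelogram (hu (k p))
    have h2 : 0 ≤ ∫ x, ‖fderiv ℝ (u (k n) + u (k p)) x‖ ^ 2 :=
      integral_nonneg fun x => by positivity
    linarith [hM (k n), hM (k p)]
  have key := ht.integral_sq_le_average hfin hr
  have hint : ∀ n, Integrable (fun x => (a n x - b x) ^ 2) (volume.restrict Ω) := fun n =>
    Integrable.of_bound (hdm n) _ (Eventually.of_forall (hdiff n))
  have hI : ∫ x in Ω, (∫ t in B, (u (k n) - u (k p)) (x + t)) ^ 2
      ≤ 2 * (∫ x in Ω, (a n x - b x) ^ 2) + 2 * ∫ x in Ω, (a p x - b x) ^ 2 := by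
    have h1 : ∀ x, ∫ t in B, (u (k n) - u (k p)) (x + t) = a n x - a p x := fun x =>
      integral_sub (hui n x) (hui p x)
    simp only [h1]
    rw [← integral_const_mul, ← integral_const_mul,
      ← integral_add ((hint n).const_mul 2) ((hint p).const_mul 2)]
    refine integral_mono_of_nonneg (Eventually.of_forall fun x => by positivity)
      (((hint n).const_mul 2).add ((hint p).const_mul 2)) (Eventually.of_forall fun x => ?_)
    change (a n x - a p x) ^ 2 ≤ 2 * (a n x - b x) ^ 2 + 2 * (a p x - b x) ^ 2
    nlinarith [sq_nonneg (a n x - b x + (a p x - b x))]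
  have hI2 : (m ^ 2)⁻¹ * ∫ x in Ω, (∫ t in B, (u (k n) - u (k p)) (x + t)) ^ 2 < ε / 2 := by
    rw [inv_mul_lt_iff₀ (by positivity)]
    have h1 := hN n hn
    have h2 := hN p hp
    linarith
  have hE2 : r ^ 2 * ∫ x, ‖fderiv ℝ (u (k n) - u (k p)) x‖ ^ 2 ≤ ε / 2 :=
    (mul_le_mul_of_nonneg_left hE (by positivity)).trans hrε
  linarith

end Rellich

/-! ### Extremals on the disc -/

section GroundState

variable {Ω : Set ℂ}

lemma IsH10Pair.exists_seq {g : ℂ → ℝ} {G : ℂ → ℂ →L[ℝ] ℝ} (h : IsH10Pair Ω g G) :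
    ∃ u : ℕ → ℂ → ℝ, (∀ n, IsTestFunction Ω (u n)) ∧
      Tendsto (fun n => eLpNorm (g - u n) 2 (volume.restrict Ω)) atTop (𝓝 0) ∧
      Tendsto (fun n => eLpNorm (G - fderiv ℝ (u n)) 2 (volume.restrict Ω)) atTop (𝓝 0) := by
  choose u hu h1 h2 using fun n : ℕ => h.approx ((n : ℝ≥0∞)⁻¹) (by simp)
  exact ⟨u, hu,
    tendsto_of_tendsto_of_tendsto_of_le_of_le tendsto_const_nhds
      ENNReal.tendsto_inv_nat_nhds_zero (fun _ => bot_le) h1,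
    tendsto_of_tendsto_of_tendsto_of_le_of_le tendsto_const_nhds
      ENNReal.tendsto_inv_nat_nhds_zero (fun _ => bot_le) h2⟩

lemma IsTestFunction.setIntegral_sq {u : ℂ → ℝ} (hu : IsTestFunction Ω u) :
    ∫ x in Ω, ‖u x‖ ^ 2 = ∫ x, u x ^ 2 := by
  rw [setIntegral_eq_integral_of_forall_compl_eq_zero fun x hx => by rw [hu.eq_zero hx]; simp]
  simp

lemma IsTestFunction.setIntegral_norm_fderiv_sq {u : ℂ → ℝ} (hu : IsTestFunction Ω u) :
    ∫ x in Ω, ‖fderiv ℝ u x‖ ^ 2 = ∫ x, ‖fderiv ℝ u x‖ ^ 2 := by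
  refine setIntegral_eq_integral_of_forall_compl_eq_zero fun x hx => ?_
  have : fderiv ℝ u x = 0 := image_eq_zero_of_notMem_tsupport fun h =>
    hx (hu.support (tsupport_fderiv_subset ℝ h))
  simp [this]

/-- A Rayleigh quotient bound for test functions holds on the whole Sobolev space. -/
lemma IsH10Pair.rayleigh {c : ℝ} (hc : ∀ u, IsTestFunction Ω u →
    c * ∫ x, u x ^ 2 ≤ ∫ x, ‖fderiv ℝ u x‖ ^ 2) {g : ℂ → ℝ} {G : ℂ → ℂ →L[ℝ] ℝ}
    (h : IsH10Pair Ω g G) : c * ∫ x in Ω, ‖g x‖ ^ 2 ≤ ∫ x in Ω, ‖G x‖ ^ 2 := by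
  obtain ⟨u, hu, h1, h2⟩ := h.exists_seq
  have l1 := tendsto_integral_norm_sq h.memLp (fun n => (hu n).memLp 2 Ω) h1
  have l2 := tendsto_integral_norm_sq h.memLp_deriv (fun n => (hu n).memLp_fderiv 2 Ω) h2
  refine le_of_tendsto_of_tendsto' (l1.const_mul c) l2 fun n => ?_
  rw [(hu n).setIntegral_sq, (hu n).setIntegral_norm_fderiv_sq]
  exact hc _ (hu n)

lemma IsTestFunction.exists_normalized {u : ℂ → ℝ} (hu : IsTestFunction Ω u)
    (h0 : 0 < ∫ x, u x ^ 2) : ∃ w, IsTestFunction Ω w ∧ ∫ x, w x ^ 2 = 1 ∧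
      ∫ x, ‖fderiv ℝ w x‖ ^ 2 = (∫ x, u x ^ 2)⁻¹ * ∫ x, ‖fderiv ℝ u x‖ ^ 2 := by
  set N := ∫ x, u x ^ 2
  have hN : (√N)⁻¹ ^ 2 = N⁻¹ := by rw [inv_pow, Real.sq_sqrt h0.le]
  refine ⟨(√N)⁻¹ • u, hu.const_smul _, ?_, ?_⟩
  · simp only [Pi.smul_apply, smul_eq_mul, mul_pow, hN]
    rw [integral_const_mul, inv_mul_cancel₀ h0.ne']
  · rw [← integral_const_mul]
    congr 1; ext x
    rw [fderiv_const_smul (hu.differentiable x), norm_smul, mul_pow, Real.norm_eq_abs, sq_abs, hN]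

lemma exists_testFunction_disc : ∃ u, IsTestFunction disc u ∧ 0 < ∫ x, u x ^ 2 := by
  let b : ContDiffBump (0 : ℂ) := ⟨1 / 4, 1 / 2, by norm_num, by norm_num⟩
  have hb : IsTestFunction disc b := ⟨b.contDiff, b.hasCompactSupport, by
    rw [b.tsupport_eq]
    exact Metric.closedBall_subset_ball (by norm_num)⟩
  refine ⟨b, hb, ?_⟩
  refine (b.continuous.pow 2).integral_pos_of_hasCompactSupport_nonneg_nonzero (x := 0) ?_
    (fun x => sq_nonneg _) ?_
  · exact b.hasCompactSupport.comp_left (g := fun y : ℝ => y ^ 2) (by norm_num)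
  · have : b 0 = 1 := b.one_of_mem_closedBall (Metric.mem_closedBall_self (by norm_num))
    simp [this]

/-- A minimiser of the Rayleigh quotient in the disc. -/
lemma exists_minimizer_disc : ∃ (Λ : ℝ) (f : ℂ → ℝ) (F : ℂ → ℂ →L[ℝ] ℝ), IsH10Pair disc f F ∧
    ∫ x in disc, ‖f x‖ ^ 2 = 1 ∧ ∫ x in disc, ‖F x‖ ^ 2 = Λ ∧
    ∀ g G, IsH10Pair disc g G → Λ * ∫ x in disc, ‖g x‖ ^ 2 ≤ ∫ x in disc, ‖G x‖ ^ 2 := by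
  set S : Set ℝ := {E | ∃ u, IsTestFunction disc u ∧ ∫ x, u x ^ 2 = 1 ∧
    ∫ x, ‖fderiv ℝ u x‖ ^ 2 = E} with hS
  have hbdd : BddBelow S := ⟨0, by
    rintro _ ⟨u, -, -, rfl⟩
    exact integral_nonneg fun x => by positivity⟩
  have hne : S.Nonempty := by
    obtain ⟨u, hu, h0⟩ := exists_testFunction_disc
    obtain ⟨w, hw, hw1, -⟩ := hu.exists_normalized h0
    exact ⟨_, w, hw, hw1, rfl⟩
  set Λ := sInf S with hΛ
  have hray : ∀ u, IsTestFunction disc u → Λ * ∫ x, u x ^ 2 ≤ ∫ x, ‖fderiv ℝ u x‖ ^ 2 := by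
    intro u hu
    rcases (integral_nonneg fun x => sq_nonneg (u x) : 0 ≤ ∫ x, u x ^ 2).eq_or_lt with h0 | h0
    · rw [← h0, mul_zero]; exact integral_nonneg fun x => by positivity
    · obtain ⟨w, hw, hw1, hw2⟩ := hu.exists_normalized h0
      have := csInf_le hbdd (⟨w, hw, hw1, rfl⟩ : _ ∈ S)
      rw [hw2, inv_mul_eq_div, le_div_iff₀ h0] at this
      exact this
  obtain ⟨E, -, hElim, hE⟩ := exists_seq_tendsto_sInf hne hbdd
  choose u hu hu1 huE using hE
  obtain ⟨M, hM⟩ := hElim.bddAbove_range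
  have hM' : ∀ n, ∫ x, ‖fderiv ℝ (u n) x‖ ^ 2 ≤ M := fun n => by
    rw [huE]; exact hM ⟨n, rfl⟩
  obtain ⟨k, hk, hcauchy⟩ := exists_cauchy_subseq volume_disc_ne_top hu (fun n => (hu1 n).le) hM'
  have hElim' := hElim.comp hk.tendsto_atTop
  -- By the parallelogram law the energy of a difference is 2Eₙ + 2Eₘ minus that of the sum, and the
  -- latter is at least Λ (4 - ‖uₙ - uₘ‖²). Near-minimality within ε / 8 contributes ε / 2 and the
  -- L² Cauchy property another ε / 2.
  have hcauchy' : ∀ ε : ℝ, 0 < ε → ∃ N, ∀ n ≥ N, ∀ m ≥ N,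
      ∫ x, ‖fderiv ℝ (u (k n) - u (k m)) x‖ ^ 2 < ε := by
    intro ε hε
    have hΛ0 : 0 ≤ Λ := le_csInf hne (by
      rintro _ ⟨u, -, -, rfl⟩
      exact integral_nonneg fun x => by positivity)
    obtain ⟨N₁, hN₁⟩ := hcauchy (ε / (2 * (Λ + 1))) (by positivity)
    obtain ⟨N₂, hN₂⟩ := eventually_atTop.1
      (hElim'.eventually_lt_const (show Λ < Λ + ε / 8 by linarith))
    refine ⟨max N₁ N₂, fun n hn m hm => ?_⟩
    have h1 := hN₁ n (le_of_max_le_left hn) m (le_of_max_le_left hm)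
    have h2 := hN₂ n (le_of_max_le_right hn)
    have h3 := hN₂ m (le_of_max_le_right hm)
    have h4 := (hu (k n)).energy_parallelogram (hu (k m))
    have h5 := (hu (k n)).parallelogram (hu (k m))
    have h6 := hray _ ((hu (k n)).add (hu (k m)))
    rw [huE, huE] at h4
    rw [hu1, hu1] at h5
    simp only [Function.comp_apply] at h2 h3
    have h7 : Λ * ∫ x, (u (k n) - u (k m)) x ^ 2 ≤ ε / 2 := by
      calc Λ * ∫ x, (u (k n) - u (k m)) x ^ 2
          ≤ (Λ + 1) * (ε / (2 * (Λ + 1))) :=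
            mul_le_mul (by linarith) h1.le (integral_nonneg fun x => by positivity) (by positivity)
        _ = ε / 2 := by field_simp
    have h8 : ∫ x, (u (k n) + u (k m)) x ^ 2 = 4 - ∫ x, (u (k n) - u (k m)) x ^ 2 := by linarith
    rw [h8, mul_sub] at h6
    linarith
  obtain ⟨f, hf, hflim⟩ := exists_limit_of_cauchy (fun n => (hu (k n)).memLp 2 disc) fun ε hε => by
    obtain ⟨N, hN⟩ := hcauchy ε hε
    refine ⟨N, fun n hn m hm => ?_⟩
    have := hN n hn m hm
    rwa [← ((hu (k n)).sub (hu (k m))).setIntegral_sq] at this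
  obtain ⟨F, hF, hFlim⟩ := exists_limit_of_cauchy
    (fun n => (hu (k n)).memLp_fderiv 2 disc) fun ε hε => by
    obtain ⟨N, hN⟩ := hcauchy' ε hε
    refine ⟨N, fun n hn m hm => ?_⟩
    have := hN n hn m hm
    rw [← ((hu (k n)).sub (hu (k m))).setIntegral_norm_fderiv_sq] at this
    simpa only [(hu (k n)).fderiv_sub' (hu (k m))] using this
  have l1 := tendsto_integral_norm_sq hf (fun n => (hu (k n)).memLp 2 disc) hflim
  have l2 := tendsto_integral_norm_sq hF (fun n => (hu (k n)).memLp_fderiv 2 disc) hFlim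
  simp only [(hu _).setIntegral_sq, hu1] at l1
  simp only [(hu _).setIntegral_norm_fderiv_sq, huE] at l2
  refine ⟨Λ, f, F, ⟨hf, hF, fun ε hε => ?_⟩, tendsto_nhds_unique l1 tendsto_const_nhds,
    tendsto_nhds_unique l2 hElim', fun g G hg => hg.rayleigh hray⟩
  obtain ⟨n, h1, h2⟩ := ((hflim.eventually_le_const (pos_iff_ne_zero.2 hε)).and
    (hFlim.eventually_le_const (pos_iff_ne_zero.2 hε))).exists
  exact ⟨u (k n), hu _, h1, h2⟩

lemma energy_one_self (F : ℂ → ℂ →L[ℝ] ℝ) :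
    energy (fun _ => 1) Ω F F = ∫ x in Ω, ‖F x‖ ^ 2 := by
  unfold energy
  simp only [Matrix.one_mulVec, norm_sq_eq_grad]

lemma eq_zero_of_quadratic_nonneg {b c : ℝ} (h : ∀ t : ℝ, 0 ≤ 2 * t * b + t ^ 2 * c) : b = 0 := by
  by_contra hb
  have hc : 0 < |c| + 1 := by positivity
  -- For c > 0 the minimum is at t = -b / c; the denominator |c| + 1 avoids the sign cases and still
  -- gives a negative value when b ≠ 0.
  have h1 := h (-b / (|c| + 1))
  have h2 : 2 * (-b / (|c| + 1)) * b + (-b / (|c| + 1)) ^ 2 * c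
      = b ^ 2 / (|c| + 1) ^ 2 * (c - 2 * (|c| + 1)) := by field_simp; ring
  rw [h2] at h1
  have h3 : 0 < b ^ 2 / (|c| + 1) ^ 2 := by positivity
  have h4 : c - 2 * (|c| + 1) < 0 := by linarith [le_abs_self c, abs_nonneg c]
  nlinarith

lemma integrable_grad_dotProduct {F G : ℂ → ℂ →L[ℝ] ℝ} (hF : MemLp F 2 (volume.restrict Ω))
    (hG : MemLp G 2 (volume.restrict Ω)) :
    Integrable (fun z => grad (F z) ⬝ᵥ grad (G z)) (volume.restrict Ω) := by
  have hm : ∀ {F : ℂ → ℂ →L[ℝ] ℝ}, MemLp F 2 (volume.restrict Ω) → ∀ v : ℂ,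
      MemLp (fun z => F z v) 2 (volume.restrict Ω) := fun hF v =>
    (ContinuousLinearMap.apply ℝ ℝ v).comp_memLp' hF
  simp only [grad_dotProduct]
  exact (integrable_smul_of_memLp (hm hF 1) (hm hG 1)).add
    (integrable_smul_of_memLp (hm hF _) (hm hG _))

/-- The Euler–Lagrange equation of a minimiser of the Rayleigh quotient. -/
lemma IsH10Pair.euler_lagrange {Λ : ℝ} {f : ℂ → ℝ} {F : ℂ → ℂ →L[ℝ] ℝ} (hf : IsH10Pair Ω f F)
    (heq : ∫ x in Ω, ‖F x‖ ^ 2 = Λ * ∫ x in Ω, ‖f x‖ ^ 2)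
    (hmin : ∀ g G, IsH10Pair Ω g G → Λ * ∫ x in Ω, ‖g x‖ ^ 2 ≤ ∫ x in Ω, ‖G x‖ ^ 2)
    {g : ℂ → ℝ} {G : ℂ → ℂ →L[ℝ] ℝ} (hg : IsH10Pair Ω g G) :
    energy (fun _ => 1) Ω F G = Λ * ∫ z in Ω, f z * g z := by
  have hFG := integrable_grad_dotProduct hf.memLp_deriv hg.memLp_deriv
  have hFF := integrable_grad_dotProduct hf.memLp_deriv hf.memLp_deriv
  have hGG := integrable_grad_dotProduct hg.memLp_deriv hg.memLp_deriv
  have hfg : Integrable (fun z => f z * g z) (volume.restrict Ω) :=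
    integrable_smul_of_memLp hf.memLp hg.memLp
  have hff : Integrable (fun z => f z * f z) (volume.restrict Ω) :=
    integrable_smul_of_memLp hf.memLp hf.memLp
  have hgg : Integrable (fun z => g z * g z) (volume.restrict Ω) :=
    integrable_smul_of_memLp hg.memLp hg.memLp
  have hE : energy (fun _ => 1) Ω F G = ∫ z in Ω, grad (F z) ⬝ᵥ grad (G z) := by
    unfold energy; simp only [Matrix.one_mulVec]
  have hns : ∀ y : ℝ, ‖y‖ ^ 2 = y * y := fun y => by rw [Real.norm_eq_abs, sq_abs, sq]
  rw [hE, ← sub_eq_zero]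
  refine eq_zero_of_quadratic_nonneg
    (c := (∫ z in Ω, grad (G z) ⬝ᵥ grad (G z)) - Λ * ∫ z in Ω, g z * g z) fun t => ?_
  -- The variation f + t g is compared with the minimum: the terms constant in `t` cancel by `heq`,
  -- and the linear coefficient must vanish.
  have h1 := hmin _ _ (hf.add (hg.const_smul t))
  have e1 : ∫ x in Ω, ‖(f + t • g) x‖ ^ 2 = (∫ z in Ω, f z * f z)
      + (2 * t) * (∫ z in Ω, f z * g z) + t ^ 2 * ∫ z in Ω, g z * g z := by
    rw [← integral_const_mul, ← integral_const_mul, ← integral_add hff (hfg.const_mul _),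
      ← integral_add (f := fun z => f z * f z + 2 * t * (f z * g z)) (hff.add (hfg.const_mul _))
        (hgg.const_mul _)]
    congr 1; ext z
    rw [hns]
    simp only [Pi.add_apply, Pi.smul_apply, smul_eq_mul]
    ring
  have e2 : ∫ x in Ω, ‖(F + t • G) x‖ ^ 2 = (∫ z in Ω, grad (F z) ⬝ᵥ grad (F z))
      + (2 * t) * (∫ z in Ω, grad (F z) ⬝ᵥ grad (G z))
      + t ^ 2 * ∫ z in Ω, grad (G z) ⬝ᵥ grad (G z) := by
    rw [← integral_const_mul, ← integral_const_mul, ← integral_add hFF (hFG.const_mul _),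
      ← integral_add (f := fun z => grad (F z) ⬝ᵥ grad (F z) + 2 * t * (grad (F z) ⬝ᵥ grad (G z)))
        (hFF.add (hFG.const_mul _)) (hGG.const_mul _)]
    congr 1; ext z
    rw [norm_sq_eq_grad]
    simp only [grad_dotProduct, Pi.add_apply, Pi.smul_apply, _root_.add_apply, _root_.smul_apply,
      smul_eq_mul]
    ring
  have e3 : (∫ z in Ω, grad (F z) ⬝ᵥ grad (F z)) = Λ * ∫ z in Ω, f z * f z := by
    simpa only [norm_sq_eq_grad, hns] using heq
  rw [e1, e2, e3] at h1
  linarith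

/-- The minimiser is an eigenfunction by its Euler–Lagrange equation. Conversely, testing an
eigenvalue equation with the eigenfunction itself shows the eigenvalue to be a Rayleigh quotient,
hence at least the minimum. -/
lemma isLeast_dirichletEigenvalues_disc :
    IsLeast (dirichletEigenvalues (fun _ => 1) disc) (firstEigenvalue (fun _ => 1) disc) := by
  obtain ⟨Λ, f, F, hf, hf1, hFΛ, hmin⟩ := exists_minimizer_disc
  have hiff : ∀ {g : ℂ → ℝ} {G : ℂ → ℂ →L[ℝ] ℝ},
      MemSobolevZero (fun _ => 1) disc g G ↔ IsH10Pair disc g G :=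
    (memEllipticClass_one disc).memSobolevZero_iff volume_disc_ne_top
  have hleast : IsLeast (dirichletEigenvalues (fun _ => 1) disc) Λ := by
    constructor
    · refine ⟨f, F, hiff.2 hf, fun h0 => ?_, fun g G hg =>
        hf.euler_lagrange (by rw [hf1, hFΛ, mul_one]) hmin (hiff.1 hg)⟩
      have : ∫ x in disc, ‖f x‖ ^ 2 = 0 := by
        rw [integral_congr_ae (g := fun _ => (0 : ℝ)) (h0.mono fun x hx => by simp [hx])]
        simp
      linarith
    · rintro Λ' ⟨g, G, hg, hg0, hΛ'⟩
      have hgp := hiff.1 hg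
      have h1 := hΛ' g G hg
      rw [energy_one_self] at h1
      have h2 := hmin g G hgp
      have h3 : ∫ x in disc, g x * g x = ∫ x in disc, ‖g x‖ ^ 2 := by
        congr 1; ext x; rw [Real.norm_eq_abs, sq_abs, sq]
      rw [h1, h3] at h2
      refine le_of_mul_le_mul_right h2 ?_
      refine lt_of_le_of_ne (integral_nonneg fun x => by positivity) fun h0 => hg0 ?_
      have h4 := (integral_eq_zero_iff_of_nonneg (fun x => by positivity)
        ((memLp_two_iff_integrable_sq_norm hgp.memLp.1).1 hgp.memLp)).1 h0.symm
      filter_upwards [h4] with x hx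
      simpa using hx
  have : firstEigenvalue (fun _ => 1) disc = Λ := hleast.csInf_eq
  rwa [this]

/-- The admissible constants form a closed set bounded below by 0, being an intersection of closed
half-lines and solution sets of linear inequalities. It contains √2 by the translation estimate, so
its infimum is attained. -/
lemma isLeast_poincareConstants_disc :
    IsLeast (poincareConstants (fun _ => 1) disc) (poincareConst (fun _ => 1) disc) := by
  have hbdd : BddBelow (poincareConstants (fun _ => 1) disc) := ⟨0, fun C hC => hC.1⟩
  refine ⟨IsClosed.csInf_mem ?_ ⟨√2, Real.sqrt_nonneg _, fun g G hg => ?_⟩ hbdd,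
    fun C hC => csInf_le hbdd hC⟩
  · have : poincareConstants (fun _ => 1) disc = Set.Ici 0 ∩
        ⋂ (f) (F) (_ : MemSobolevZero (fun _ => 1) disc f F),
          {C | normL2 disc f ≤ C * seminormA (fun _ => 1) disc F} := by
      ext C; simp [poincareConstants]
    rw [this]
    refine isClosed_Ici.inter (isClosed_iInter fun f => isClosed_iInter fun F =>
      isClosed_iInter fun _ => isClosed_le continuous_const (by fun_prop))
  · have hgp := ((memEllipticClass_one disc).memSobolevZero_iff volume_disc_ne_top).1 hg
    have h1 := hgp.rayleigh fun u hu => hu.poincare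
    unfold normL2 seminormA
    rw [energy_one_self, ← Real.sqrt_mul zero_le_two]
    refine Real.sqrt_le_sqrt ?_
    simp only [Real.norm_eq_abs] at h1
    linarith

end GroundState

end DirichletEig

end

theorem corollary4p2 (Ω : Set ℂ) (A : ℂ → Matrix (Fin 2) (Fin 2) ℝ)
    (hA : DirichletEig.MemEllipticClass Ω A)
    (hΩ : DirichletEig.IsVolumePreservingRegular ⊤ A Ω) :
    -- the best Poincaré constants are finite and attained, and `B(A, Ω) ≤ B(𝔻)`
    (IsLeast (DirichletEig.poincareConstants A Ω) (DirichletEig.poincareConst A Ω) ∧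
      IsLeast (DirichletEig.poincareConstants (fun _ => 1) DirichletEig.disc)
        (DirichletEig.poincareConst (fun _ => 1) DirichletEig.disc) ∧
      DirichletEig.poincareConst A Ω ≤
        DirichletEig.poincareConst (fun _ => 1) DirichletEig.disc) ∧
    -- the least eigenvalues exist, and `λ₁(𝔻) ≤ λ₁(A, Ω)`
    (IsLeast (DirichletEig.dirichletEigenvalues A Ω) (DirichletEig.firstEigenvalue A Ω) ∧
      IsLeast (DirichletEig.dirichletEigenvalues (fun _ => 1) DirichletEig.disc)
        (DirichletEig.firstEigenvalue (fun _ => 1) DirichletEig.disc) ∧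
      DirichletEig.firstEigenvalue (fun _ => 1) DirichletEig.disc ≤
        DirichletEig.firstEigenvalue A Ω) := by
  obtain ⟨-, -, -, e, D, hqc, hJ, -⟩ := hΩ
  have hiso := hqc.isEnergyIsometry hA DirichletEig.volume_disc_ne_top hJ
  obtain ⟨hs, ht⟩ := And.intro hqc.source_eq hqc.target_eq
  have hA' : DirichletEig.MemEllipticClass e.source A := hs ▸ hA
  have hfin : MeasureTheory.volume e.target ≠ ⊤ := ht ▸ DirichletEig.volume_disc_ne_top
  -- The sets of constants and of eigenvalues coincide with those of the disc, so existence carries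
  -- over and both inequalities hold with equality.
  have h1 := hiso.poincareConstants_eq hA' hfin
  have h2 := hiso.dirichletEigenvalues_eq hA' hfin
  rw [hs, ht] at h1 h2
  have hP := DirichletEig.isLeast_poincareConstants_disc
  have hE := DirichletEig.isLeast_dirichletEigenvalues_disc
  unfold DirichletEig.poincareConst DirichletEig.firstEigenvalue at *
  rw [h1, h2]
  exact ⟨⟨hP, hP, le_rfl⟩, hE, hE, le_rfl⟩
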